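/- Throughout, for a function $f$ on the upper half plane and $x\in\mathbb{Q}$, the limiting value $f(x)$ is $\lim_{t\downarrow 0} f(x+\mathrm{i}t)$, powers are principal values, $q=\mathrm{e}^{2\pi\mathrm{i}\tau}$, $L(s,f)$ is the analytic continuation of $\sum_{n\ge1} f(n)n^{-s}$ for a periodic function $f$, and $F(N)\simeq\sum_{k\ge0}c_kN^{-k}$ means that $F(N)-\sum_{k<K}c_kN^{-k}=O(N^{-K})$ as $N\to\infty$, $N\in\mathbb{Z}$, for every $K\ge 0$. (1) Let $\vec p=(p_1,\dots,p_4)$ be pairwise coprime positive integers, $P=p_1p_2p_3p_4$, and call $\vec\ell\in\mathbb{Z}^4$ admissible if $0<\ell_j<p_j$ for all $j$. For admissible $\vec\ell$ let $\chi_{2P}^{\vec\ell}(n)=-\prod_j\varepsilon_j$ if $n\equiv P\bigl(1+\sum_j\varepsilon_j\ell_j/p_j\bigr)\pmod{2P}$ for some $\varepsilon\in\{\pm1\}^4$, and $\chi_{2P}^{\vec\ell}(n)=0$ otherwise; put $$\widetilde\Phi_{\vec p}^{\vec\ell}(\tau)=\sum_{n\ge0}n\,\chi_{2P}^{\vec\ell}(n)\,q^{n^2/4P}\qquad(\operatorname{Im}\tau>0),$$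 $$\mathbf{S}_{\vec\ell}^{\vec\ell'}=\frac{16}{\sqrt{2P}}\,(-1)^{P\left(1+\sum_j\frac{\ell_j+\ell'_j}{p_j}\right)+P\sum_j\sum_{k\ne j}\frac{\ell_j\ell'_k}{p_jp_k}}\prod_{j=1}^4\sin\Bigl(P\frac{\ell_j\ell'_j}{p_j^2}\pi\Bigr).$$ Let the group generated by the maps $\sigma_{ij}$, $i\ne j$, which replace $\ell_i,\ell_j$ by $p_i-\ell_i,p_j-\ell_j$, act on the admissible quadruples. Then for every admissible $\vec\ell$ the limiting values of $\widetilde\Phi_{\vec p}^{\vec\ell}$ at $1/N$ and $-N$ exist for all nonzero integers $N$, and for any complete system $R$ of representatives of the orbits, $$\widetilde\Phi_{\vec p}^{\vec\ell}(1/N)+\Bigl(\frac N{\mathrm{i}}\Bigr)^{3/2}\sum_{\vec\ell'\in R}\mathbf{S}_{\vec\ell}^{\vec\ell'}\,\widetilde\Phi_{\vec p}^{\vec\ell'}(-N)\simeq\sum_{k=0}^\infty\frac{L(-2k-1,\chi_{2P}^{\vec\ell})}{k!}\Bigl(\frac{\pi\mathrm{i}}{2PN}\Bigr)^k .$$ (2)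 Let $P$ be a positive integer and, for integers $0<a<P$, let $\psi_{2P}^{(a)}(n)=\pm1$ if $n\equiv\pm a\pmod{2P}$ and $0$ otherwise; put $$\widetilde\Psi_P^{(a)}(\tau)=\sum_{n\ge0}\psi_{2P}^{(a)}(n)\,q^{n^2/4P}\qquad(\operatorname{Im}\tau>0),\qquad \mathbf{M}_a^b=\sqrt{\tfrac2P}\,\sin\Bigl(\frac{ab}P\pi\Bigr).$$ Then for $0<a<P$ the limiting values of $\widetilde\Psi_P^{(a)}$ at $1/N$ and $-N$ exist for all nonzero integers $N$, and $$\widetilde\Psi_P^{(a)}(1/N)+\sqrt{\frac N{\mathrm{i}}}\,\sum_{b=1}^{P-1}\mathbf{M}_a^b\,\widetilde\Psi_P^{(b)}(-N)\simeq\sum_{k=0}^\infty\frac{L(-2k,\psi_{2P}^{(a)})}{k!}\Bigl(\frac{\pi\mathrm{i}}{2PN}\Bigr)^k .$$ -/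

import Mathlib

open Filter Topology Asymptotics Complex

namespace SeifertEichler

/-- `P = p₁ p₂ p₃ p₄`. -/
abbrev P (p : Fin 4 → ℕ) : ℕ := ∏ j, p j

/-- The quadruples `ℓ` with `0 < ℓ_j < p_j` for all `j`. -/
def Admissible (p l : Fin 4 → ℕ) : Prop := ∀ j, 0 < l j ∧ l j < p j

/-- The residue class modulo `2P` of `P (1 + ∑ j, ε_j ℓ_j / p_j)`.
The natural number division `P / p_j` is exact. -/
def residue (p l : Fin 4 → ℕ) (ε : Fin 4 → ℤˣ) : ZMod (2 * P p) :=
  ((P p + ∑ j, (ε j : ℤ) * l j * (P p / p j : ℕ) : ℤ) : ZMod (2 * P p))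

/-- The even function `χ_{2P}^ℓ` of period `2P`: it is `-ε₁ε₂ε₃ε₄` on the residue class attached to
`ε`, and `0` on all other classes. The classes of different `ε` are different when the `p_j` are
pairwise coprime and `ℓ` is admissible (see `chi_residue`), so at most one summand is nonzero. -/
noncomputable def chi (p l : Fin 4 → ℕ) (x : ZMod (2 * P p)) : ℂ :=
  ∑ ε : Fin 4 → ℤˣ, if x = residue p l ε then -((∏ j, (ε j : ℤ) : ℤ) : ℂ) else 0

/-- The odd function `ψ_{2P}^{(a)}` of period `2P`: it is `±1` on the class of `±a`
and `0` elsewhere. -/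
noncomputable def psi (P a : ℕ) (x : ZMod (2 * P)) : ℂ :=
  if x = (a : ZMod (2 * P)) then 1 else if x = -(a : ZMod (2 * P)) then -1 else 0

/-- The Eichler integral `Φ̃_p^ℓ(τ) = ∑_{n ≥ 0} n χ(n) q^{n²/4P}`, `q = exp(2πiτ)`, for `Im τ > 0`. -/
noncomputable def PhiTilde (p l : Fin 4 → ℕ) (τ : ℂ) : ℂ :=
  ∑' n : ℕ, (n : ℂ) * chi p l (n : ZMod (2 * P p)) *
    cexp (2 * Real.pi * I * τ * ((n : ℂ) ^ 2 / (4 * (P p : ℂ))))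

/-- The Eichler integral `Ψ̃_P^{(a)}(τ) = ∑_{n ≥ 0} ψ(n) q^{n²/4P}`, `q = exp(2πiτ)`,
for `Im τ > 0`. -/
noncomputable def PsiTilde (P a : ℕ) (τ : ℂ) : ℂ :=
  ∑' n : ℕ, psi P a (n : ZMod (2 * P)) *
    cexp (2 * Real.pi * I * τ * ((n : ℂ) ^ 2 / (4 * (P : ℂ))))

/-- `f(τ) → c` as `τ → x` vertically in the upper half plane
(that is, radially in `q = exp(2πiτ)`). -/
def HasLimitingValue (f : ℂ → ℂ) (x : ℝ) (c : ℂ) : Prop :=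
  Tendsto (fun t : ℝ => f ((x : ℂ) + (t : ℂ) * I)) (𝓝[>] 0) (𝓝 c)

/-- The limiting value of `f` at the real point `x`; meaningful when the limit exists. -/
noncomputable def limitingValue (f : ℂ → ℂ) (x : ℝ) : ℂ :=
  limUnder (𝓝[>] (0 : ℝ)) (fun t : ℝ => f ((x : ℂ) + (t : ℂ) * I))

/-- The matrix `S`. The divisions of natural numbers in the exponent of `-1` are exact (`j ≠ k`). -/
noncomputable def S (p l l' : Fin 4 → ℕ) : ℝ :=
  16 / Real.sqrt (2 * (P p : ℝ)) *
    (-1) ^ (P p + ∑ j, (l j + l' j) * (P p / p j) +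
      ∑ j, ∑ k ∈ Finset.univ.erase j, l j * l' k * (P p / (p j * p k))) *
    ∏ j, Real.sin ((P p : ℝ) * ((l j * l' j : ℝ) / (p j : ℝ) ^ 2) * Real.pi)

/-- The matrix `M`. -/
noncomputable def M (P a b : ℕ) : ℝ :=
  Real.sqrt (2 / (P : ℝ)) * Real.sin ((a * b : ℝ) / (P : ℝ) * Real.pi)

/-- `ℓ` and `ℓ'` lie in the same orbit of the group generated by the `σ_{ij}` (`i ≠ j`), where
`σ_{ij}` replaces both `ℓ_i` by `p_i - ℓ_i` and `ℓ_j` by `p_j - ℓ_j`: they differ by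
`ℓ_j ↦ p_j - ℓ_j` on an even number of places. -/
def SameOrbit (p l l' : Fin 4 → ℕ) : Prop :=
  ∃ J : Finset (Fin 4), Even J.card ∧ ∀ j, l' j = if j ∈ J then p j - l j else l j

/-- `R` is a complete system of representatives of the orbits of the `σ_{ij}` on the admissible
quadruples. -/
def IsRepSystem (p : Fin 4 → ℕ) (R : Finset (Fin 4 → ℕ)) : Prop :=
  (∀ l ∈ R, Admissible p l) ∧ ∀ l, Admissible p l → ∃! m, m ∈ R ∧ SameOrbit p l m

/-- `f(N) ≃ ∑_{k ≥ 0} c_k N^{-k}` as `N → ∞` through the integers, an asymptotic expansion in the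
sense of Poincaré. -/
def HasAsymptoticExpansion (f : ℤ → ℂ) (c : ℕ → ℂ) : Prop :=
  ∀ K : ℕ, (fun N : ℤ => f N - ∑ k ∈ Finset.range K, c k * ((N : ℂ)⁻¹) ^ k)
    =O[atTop] fun N : ℤ => ((N : ℝ)⁻¹) ^ K

/-- The classes attached to different sign vectors are different. -/
theorem residue_injective {p l : Fin 4 → ℕ} (hp : ∀ i j, i ≠ j → (p i).Coprime (p j))
    (hl : Admissible p l) : Function.Injective (residue p l) := by
  intro ε ε' h
  by_contra hne
  obtain ⟨i, hi⟩ := Function.ne_iff.mp hne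
  have hp0 : ∀ j, 0 < p j := fun j => lt_trans (hl j).1 (hl j).2
  unfold residue at h
  rw [ZMod.intCast_eq_intCast_iff_dvd_sub] at h
  have hd : ∀ j, ∃ d : ℤ, (ε' j : ℤ) - (ε j : ℤ) = 2 * d ∧ (j = i → d = 1 ∨ d = -1) := by
    intro j
    rcases Int.units_eq_one_or (ε j) with h1 | h1 <;>
      rcases Int.units_eq_one_or (ε' j) with h2 | h2
    · exact ⟨0, by simp [h1, h2], by rintro rfl; exact absurd (h1.trans h2.symm) hi⟩
    · exact ⟨-1, by simp [h1, h2], by simp⟩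
    · exact ⟨1, by simp [h1, h2], by simp⟩
    · exact ⟨0, by simp [h1, h2], by rintro rfl; exact absurd (h1.trans h2.symm) hi⟩
  choose d hd1 hd2 using hd
  have e : ((P p : ℤ) + ∑ j, (ε' j : ℤ) * l j * (P p / p j : ℕ))
      - ((P p : ℤ) + ∑ j, (ε j : ℤ) * l j * (P p / p j : ℕ))
      = 2 * ∑ j, d j * l j * (P p / p j : ℕ) := by
    rw [add_sub_add_left_eq_sub, ← Finset.sum_sub_distrib, Finset.mul_sum]
    refine Finset.sum_congr rfl fun j _ => ?_
    linear_combination (l j * (P p / p j : ℕ) : ℤ) * hd1 j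
  rw [e, Nat.cast_mul, Nat.cast_ofNat, mul_dvd_mul_iff_left (by norm_num)] at h
  have hcof : ∀ j, P p / p j = ∏ k ∈ Finset.univ.erase j, p k := fun j => by
    rw [P, ← Finset.mul_prod_erase Finset.univ p (Finset.mem_univ j),
      Nat.mul_div_cancel_left _ (hp0 j)]
  have h2 : (p i : ℤ) ∣ ∑ j, d j * l j * (P p / p j : ℕ) :=
    dvd_trans (by exact_mod_cast Finset.dvd_prod_of_mem p (Finset.mem_univ i)) h
  rw [← Finset.add_sum_erase Finset.univ _ (Finset.mem_univ i)] at h2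
  have h3 : (p i : ℤ) ∣ ∑ j ∈ Finset.univ.erase i, d j * l j * (P p / p j : ℕ) := by
    refine Finset.dvd_sum fun j hj => Dvd.dvd.mul_left ?_ _
    rw [hcof j]
    exact_mod_cast Finset.dvd_prod_of_mem p
      (Finset.mem_erase.mpr ⟨(Finset.ne_of_mem_erase hj).symm, Finset.mem_univ i⟩)
  have h4 : (p i : ℤ) ∣ d i * l i * (P p / p i : ℕ) := (Int.dvd_add_left h3).mp h2
  have h5 : (p i).Coprime (P p / p i) := by
    rw [hcof i]
    exact Nat.Coprime.prod_right fun j hj => hp i j (Finset.ne_of_mem_erase hj).symm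
  have h6 : (p i : ℤ) ∣ d i * l i :=
    IsCoprime.dvd_of_dvd_mul_right (Nat.isCoprime_iff_coprime.mpr h5) h4
  have h7 : p i ∣ l i := by
    rcases hd2 i rfl with h | h <;> rw [h] at h6
    · exact_mod_cast (by simpa using h6 : (p i : ℤ) ∣ l i)
    · exact_mod_cast (by simpa using h6 : (p i : ℤ) ∣ l i)
  exact absurd (Nat.le_of_dvd (hl i).1 h7) (not_le.mpr (hl i).2)

/-- `chi` takes the value `-ε₁ε₂ε₃ε₄` on the class attached to `ε`. -/
theorem chi_residue {p l : Fin 4 → ℕ} (hp : ∀ i j, i ≠ j → (p i).Coprime (p j))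
    (hl : Admissible p l) (ε : Fin 4 → ℤˣ) :
    chi p l (residue p l ε) = -((∏ j, (ε j : ℤ) : ℤ) : ℂ) := by
  unfold chi
  rw [Finset.sum_eq_single ε]
  · simp
  · intro ε' _ h
    rw [if_neg fun h' => h (residue_injective hp hl h').symm]
  · simp

/-- `chi` vanishes off the classes attached to sign vectors. -/
theorem chi_eq_zero {p l : Fin 4 → ℕ} {x : ZMod (2 * P p)} (hx : ∀ ε, x ≠ residue p l ε) :
    chi p l x = 0 :=
  Finset.sum_eq_zero fun ε _ => if_neg (hx ε)

instance (p : Fin 4 → ℕ) [∀ j, NeZero (p j)] : NeZero (2 * P p) :=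
  ⟨mul_ne_zero two_ne_zero (Finset.prod_ne_zero_iff.mpr fun j _ => NeZero.ne (p j))⟩

end SeifertEichler

/-!
Both parts concern series `∑ f(n) n ^ j q ^ (n² / 4P)` with `f` of period `T = 2P` and mean zero, of
parity `(-1) ^ (j + 1)`: `f = χ`, `j = 1` in the first part, `f = ψ`, `j = 0` in the second.

*Limiting values.* At a rational point the factors `q ^ (n² / 4P)` are periodic in `n`, and a
periodic sequence `C` of mean zero has a regularized sum `∑ C(n) n ^ j`, the same for the factors
`exp (-ε n)` and `exp (-ε n²)` (`hasAbelSum_regularizedValue`, `hasGaussSum_regularizedValue`). The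
first kind suits Poisson summation, the second is the approach to the boundary. For `f` itself the
regularized value is `L(-j, f)` (`LFunction_neg_eq_regularizedValue`).

*Reciprocity* (`hasAbelSum_mul_fresnel`). Poisson summation is applied, residue class by residue class,
to `x ^ j exp (-δ x) (exp (i α x²) - 1)` on the half-line. Up to a multiple of `exp (-i ξ² / 4α)`,
present for the frequencies `ξ < 0`, whose stationary point lies in the half-line, the Fourier
transform is the integral `rotatedRemainder` along the ray through `exp (π i / 4)`; this decays
like `ξ ^ (-j - 3)`. As `δ → 0` the result reads

`∑ f(n) n ^ j exp (i α n²) = L(-j, f) + T⁻¹ ∑ f̂(m) R(ξ m) + c ∑ f̂(m) m ^ j exp (-i (ξ m)² / 4α)`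

where `f̂` is the discrete Fourier transform, `ξ m = 2 π m / T`, `R` is twice `rotatedRemainder`, and
the outer sums are Abel sums.

*The expansion* (`exists_norm_tsum_rotatedRemainder_sub_le`). Taylor expansion of `exp (-α y²)` in
`rotatedRemainder` produces the sums `∑ f̂(m) m ^ (-(2k + j + 1))`, which are `L(-2k - j, f)` up to
explicit factors, by the functional equation. With `α = π / (2PN)` the left hand side is the limiting
value at `1 / N` and the last sum is the series for `f̂` at `-N`.

*Fourier transforms.* It remains to expand `f̂` in the functions `ψ` (`dft_psi_eq_sum`), respectively `χ`
(`dft_chi_eq_sum`), whose coefficients are the matrices `M` and `S`. On the support of each of these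
functions `n²` is constant modulo `4P`, so at `-N` the factor `q ^ (n² / 4P)` is a constant and the mean
stays zero. At `1 / N` the mean vanishes because the reciprocity formula bounds the Abel sum.
-/

namespace SeifertEichler

/-! ### Regularized sums of periodic sequences -/

/-- The mean over a period of the partial sums of a sequence `C` of period `T`. -/
noncomputable def partialSumMean (T : ℕ) (C : ℕ → ℂ) : ℂ :=
  (∑ n ∈ Finset.range T, ∑ i ∈ Finset.range (n + 1), C i) / T

/-- The partial sums of `C`, shifted by a constant so that their mean over a period is zero. -/
noncomputable def centeredPartialSum (T : ℕ) (C : ℕ → ℂ) (n : ℕ) : ℂ :=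
  ∑ i ∈ Finset.range (n + 1), C i - partialSumMean T C

theorem sum_range_add_period {T : ℕ} {C : ℕ → ℂ} (hC : Function.Periodic C T)
    (h0 : ∑ n ∈ Finset.range T, C n = 0) (n : ℕ) :
    ∑ i ∈ Finset.range (n + T), C i = ∑ i ∈ Finset.range n, C i := by
  induction n with
  | zero => simpa using h0
  | succ n ih =>
    rw [show n + 1 + T = (n + T) + 1 by ring, Finset.sum_range_succ, ih, Finset.sum_range_succ, hC]

theorem centeredPartialSum_periodic {T : ℕ} {C : ℕ → ℂ} (hC : Function.Periodic C T)
    (h0 : ∑ n ∈ Finset.range T, C n = 0) : Function.Periodic (centeredPartialSum T C) T := by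
  intro n
  unfold centeredPartialSum
  rw [show n + T + 1 = (n + 1) + T by ring, sum_range_add_period hC h0]

theorem sum_centeredPartialSum {T : ℕ} (hT : 0 < T) (C : ℕ → ℂ) :
    ∑ n ∈ Finset.range T, centeredPartialSum T C n = 0 := by
  have : (T : ℂ) ≠ 0 := by exact_mod_cast hT.ne'
  simp only [centeredPartialSum, Finset.sum_sub_distrib, Finset.sum_const, Finset.card_range,
    nsmul_eq_mul, partialSumMean]
  field_simp
  simp

theorem exists_norm_le_of_periodic {T : ℕ} (hT : 0 < T) {C : ℕ → ℂ} (hC : Function.Periodic C T) :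
    ∃ B, 0 ≤ B ∧ ∀ n, ‖C n‖ ≤ B := by
  refine ⟨∑ n ∈ Finset.range T, ‖C n‖, Finset.sum_nonneg fun _ _ => norm_nonneg _, fun n => ?_⟩
  rw [← hC.map_mod_nat n]
  exact Finset.single_le_sum (f := fun n => ‖C n‖) (fun _ _ => norm_nonneg _)
    (Finset.mem_range.mpr (Nat.mod_lt n hT))

theorem summable_mul_of_norm_le {C g : ℕ → ℂ} {B : ℝ} (hB : ∀ n, ‖C n‖ ≤ B)
    (hg : Summable fun n => ‖g n‖) : Summable fun n => C n * g n := by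
  refine Summable.of_norm_bounded (hg.mul_left B) fun n => ?_
  rw [norm_mul]
  exact mul_le_mul_of_nonneg_right (hB n) (norm_nonneg _)

/-- Summation by parts against a sequence of mean zero. -/
theorem tsum_periodic_mul_eq {T : ℕ} (hT : 0 < T) {C : ℕ → ℂ} (hC : Function.Periodic C T)
    (h0 : ∑ n ∈ Finset.range T, C n = 0) {g : ℕ → ℂ} (hg : Summable fun n => ‖g n‖) :
    ∑' n, C n * g n = partialSumMean T C * g 0
      - ∑' n, centeredPartialSum T C n * (g (n + 1) - g n) := by
  obtain ⟨B, -, hB⟩ := exists_norm_le_of_periodic hT hC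
  obtain ⟨B', -, hB'⟩ := exists_norm_le_of_periodic hT (centeredPartialSum_periodic hC h0)
  have hg1 : Summable fun n => ‖g (n + 1)‖ := (summable_nat_add_iff 1).mpr hg
  have s1 := summable_mul_of_norm_le hB hg
  have s2 := summable_mul_of_norm_le hB' hg
  have s3 := summable_mul_of_norm_le hB' hg1
  have hgs : Summable g := hg.of_norm
  have e1 : ∑' n, centeredPartialSum T C n * (g (n + 1) - g n)
      = ∑' n, centeredPartialSum T C n * g (n + 1) - ∑' n, centeredPartialSum T C n * g n := by
    rw [← s3.tsum_sub s2]
    exact tsum_congr fun n => by ring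
  rw [e1, s2.tsum_eq_zero_add, s1.tsum_eq_zero_add]
  have e2 : ∑' n, centeredPartialSum T C (n + 1) * g (n + 1)
      = ∑' n, centeredPartialSum T C n * g (n + 1) + ∑' n, C (n + 1) * g (n + 1) := by
    rw [← s3.tsum_add ((summable_nat_add_iff (f := fun n => C n * g n) 1).mpr s1)]
    refine tsum_congr fun n => ?_
    simp only [centeredPartialSum, Finset.sum_range_succ _ (n + 1)]
    ring
  rw [e2]
  simp only [centeredPartialSum, zero_add, Finset.sum_range_one]
  ring

theorem norm_tsum_mul_le {C g : ℕ → ℂ} {B : ℝ} (hB : ∀ n, ‖C n‖ ≤ B)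
    (hg : Summable fun n => ‖g n‖) : ‖∑' n, C n * g n‖ ≤ B * ∑' n, ‖g n‖ := by
  rw [← tsum_mul_left]
  refine tsum_of_norm_bounded (hg.mul_left B).hasSum fun n => ?_
  rw [norm_mul]
  exact mul_le_mul_of_nonneg_right (hB n) (norm_nonneg _)

theorem abs_sub_le_of_hasDerivAt {F F' : ℝ → ℝ} {B a : ℝ} (hF : ∀ x, HasDerivAt F (F' x) x)
    (hB : ∀ x, a ≤ x → |F' x| ≤ B) {x ε : ℝ} (hx : a ≤ x) (hε : 0 ≤ ε) :
    |F (x + ε) - F x| ≤ B * ε := by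
  have := Convex.norm_image_sub_le_of_norm_hasDerivWithin_le (f := F) (f' := F') (C := B)
    (s := Set.Ici a) (fun y _ => (hF y).hasDerivWithinAt) (fun y hy => by simpa using hB y hy)
    (convex_Ici a) hx (show x + ε ∈ Set.Ici a from by simp; linarith)
  simpa [abs_of_nonneg hε] using this

/-- The third difference with step `ε` is at most `ε³` times a bound for the third derivative. -/
theorem abs_third_difference_le {G G₁ G₂ G₃ : ℝ → ℝ} (h1 : ∀ x, HasDerivAt G (G₁ x) x)
    (h2 : ∀ x, HasDerivAt G₁ (G₂ x) x) (h3 : ∀ x, HasDerivAt G₂ (G₃ x) x) {B a ε : ℝ}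
    (hB : ∀ x, a ≤ x → |G₃ x| ≤ B) (hε : 0 ≤ ε) :
    |G (a + ε + ε + ε) - 3 * G (a + ε + ε) + 3 * G (a + ε) - G a| ≤ B * ε ^ 3 := by
  have d : ∀ {F F' : ℝ → ℝ}, (∀ x, HasDerivAt F (F' x) x) →
      ∀ x, HasDerivAt (fun x => F (x + ε) - F x) (F' (x + ε) - F' x) x := fun h x =>
    ((h (x + ε)).comp_add_const x ε).sub (h x)
  have a1 : ∀ x, a ≤ x → |G₂ (x + ε) - G₂ x| ≤ B * ε := fun x hx =>
    abs_sub_le_of_hasDerivAt h3 hB hx hε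
  have a2 : ∀ x, a ≤ x → |(G₁ (x + ε + ε) - G₁ (x + ε)) - (G₁ (x + ε) - G₁ x)| ≤ B * ε * ε :=
    fun x hx => abs_sub_le_of_hasDerivAt (d h2) a1 hx hε
  have a3 := abs_sub_le_of_hasDerivAt (d (d h1)) a2 le_rfl hε
  calc _ = _ := by congr 1; ring
    _ ≤ _ := a3
    _ = _ := by ring

theorem summable_exp_neg_mul_nat {ε : ℝ} (hε : 0 < ε) : Summable fun n : ℕ => Real.exp (-(ε * n)) := by
  have := Real.summable_exp_nat_mul_iff.mpr (neg_lt_zero.mpr hε)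
  refine this.congr fun n => ?_
  congr 1; ring

theorem mul_tsum_exp_neg_le {ε : ℝ} (hε : 0 < ε) (h1 : ε ≤ 1) :
    ε * ∑' n : ℕ, Real.exp (-(ε * n)) ≤ 2 := by
  have e : ∀ n : ℕ, Real.exp (-(ε * n)) = Real.exp (-ε) ^ n := fun n => by
    rw [← Real.exp_nat_mul]; congr 1; ring
  have hlt : Real.exp (-ε) < 1 := by simpa using hε
  rw [tsum_congr e, tsum_geometric_of_lt_one (Real.exp_pos _).le hlt, ← div_eq_mul_inv,
    div_le_iff₀ (by linarith)]
  have h3 := Real.add_one_le_exp ε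
  have h4 : Real.exp (-ε) * Real.exp ε = 1 := by rw [← Real.exp_add]; simp
  nlinarith [Real.exp_pos (-ε)]

/-- A sequence `C` of period `T` and mean zero, summed against the dilates of a smooth function `G`:
up to `O(ε²)` only the first three differences of `G` at the origin matter. -/
theorem tsum_periodic_mul_dilate {T : ℕ} (hT : 0 < T) {C : ℕ → ℂ} (hC : Function.Periodic C T)
    (h0 : ∑ n ∈ Finset.range T, C n = 0) {G G₁ G₂ G₃ : ℝ → ℝ}
    (h1 : ∀ x, HasDerivAt G (G₁ x) x) (h2 : ∀ x, HasDerivAt G₁ (G₂ x) x)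
    (h3 : ∀ x, HasDerivAt G₂ (G₃ x) x) {M : ℝ} (hM : 0 ≤ M)
    (hG : ∀ x, 0 ≤ x → |G x| ≤ M * Real.exp (-(x / 2)))
    (hG₃ : ∀ x, 0 ≤ x → |G₃ x| ≤ M * Real.exp (-(x / 2))) :
    ∃ B, ∀ ε : ℝ, 0 < ε → ε ≤ 1 →
      ‖∑' n : ℕ, C n * (G (ε * n) : ℂ) - (partialSumMean T C * G 0
        - partialSumMean T (centeredPartialSum T C) * (G ε - G 0)
        + partialSumMean T (centeredPartialSum T (centeredPartialSum T C)) *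
            (G (2 * ε) - 2 * G ε + G 0))‖ ≤ B * ε ^ 2 := by
  have c1 := centeredPartialSum_periodic hC h0
  have z1 := sum_centeredPartialSum hT C
  have c2 := centeredPartialSum_periodic c1 z1
  have z2 := sum_centeredPartialSum hT (centeredPartialSum T C)
  have c3 := centeredPartialSum_periodic c2 z2
  obtain ⟨B, hB0, hB⟩ := exists_norm_le_of_periodic hT c3
  refine ⟨B * M * 4, fun ε hε hε1 => ?_⟩
  have hpos : ∀ n : ℕ, 0 ≤ ε * n := fun n => by positivity
  have sg : Summable fun n : ℕ => ‖(G (ε * n) : ℂ)‖ := by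
    refine Summable.of_nonneg_of_le (fun _ => norm_nonneg _) (fun n => ?_)
      ((summable_exp_neg_mul_nat (half_pos hε)).mul_left M)
    simpa [mul_div_right_comm] using hG _ (hpos n)
  have shift : ∀ {g : ℕ → ℂ}, (Summable fun n => ‖g n‖) →
      Summable fun n => ‖g (n + 1) - g n‖ := fun {g} hg =>
    Summable.of_nonneg_of_le (fun _ => norm_nonneg _) (fun n => norm_sub_le _ _)
      (((summable_nat_add_iff 1).mpr hg).add hg)
  have s1 := shift sg
  have s2 := shift s1
  have s3 := shift s2
  rw [tsum_periodic_mul_eq hT hC h0 sg, tsum_periodic_mul_eq hT c1 z1 s1,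
    tsum_periodic_mul_eq hT c2 z2 s2]
  set R := ∑' n, centeredPartialSum T (centeredPartialSum T (centeredPartialSum T C)) n *
    (((G (ε * (n + 1 + 1 + 1 : ℕ)) : ℂ) - G (ε * (n + 1 + 1 : ℕ))
      - (G (ε * (n + 1 + 1 : ℕ)) - G (ε * (n + 1 : ℕ))))
      - ((G (ε * (n + 1 + 1 : ℕ)) : ℂ) - G (ε * (n + 1 : ℕ)) - (G (ε * (n + 1 : ℕ)) - G (ε * n))))
    with hR
  have key : ‖R‖ ≤ B * M * 4 * ε ^ 2 := by
    refine (norm_tsum_mul_le hB s3).trans ?_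
    have : ∑' n : ℕ, ‖(((G (ε * (n + 1 + 1 + 1 : ℕ)) : ℂ) - G (ε * (n + 1 + 1 : ℕ))
      - (G (ε * (n + 1 + 1 : ℕ)) - G (ε * (n + 1 : ℕ))))
      - ((G (ε * (n + 1 + 1 : ℕ)) : ℂ) - G (ε * (n + 1 : ℕ))
        - (G (ε * (n + 1 : ℕ)) - G (ε * n))))‖
        ≤ ∑' n : ℕ, M * ε ^ 3 * Real.exp (-(ε / 2 * n)) := by
      refine s3.tsum_le_tsum (fun n => ?_) ((summable_exp_neg_mul_nat (half_pos hε)).mul_left _)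
      have := abs_third_difference_le h1 h2 h3 (a := ε * n) (ε := ε)
        (B := M * Real.exp (-(ε / 2 * n))) (fun x hx => (hG₃ x ((hpos n).trans hx)).trans
          (mul_le_mul_of_nonneg_left (Real.exp_le_exp.mpr (by linarith)) hM)) hε.le
      rw [show (M * ε ^ 3 * Real.exp (-(ε / 2 * n))) = M * Real.exp (-(ε / 2 * n)) * ε ^ 3 by ring]
      refine le_trans (le_of_eq ?_) this
      rw [← Real.norm_eq_abs, ← Complex.norm_real]
      push_cast
      rw [show ε * ((n : ℝ) + 1 + 1 + 1) = ε * n + ε + ε + ε by ring,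
        show ε * ((n : ℝ) + 1 + 1) = ε * n + ε + ε by ring,
        show ε * ((n : ℝ) + 1) = ε * n + ε by ring]
      congr 1; ring
    rw [tsum_mul_left] at this
    calc _ ≤ B * (M * ε ^ 3 * ∑' n : ℕ, Real.exp (-(ε / 2 * n))) :=
          mul_le_mul_of_nonneg_left this hB0
      _ = B * M * 2 * ε ^ 2 * (ε / 2 * ∑' n : ℕ, Real.exp (-(ε / 2 * n))) := by ring
      _ ≤ B * M * 2 * ε ^ 2 * 2 :=
          mul_le_mul_of_nonneg_left (mul_tsum_exp_neg_le (half_pos hε) (by linarith)) (by positivity)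
      _ = _ := by ring
  refine le_trans (le_of_eq ?_) key
  rw [← norm_neg R]
  congr 1
  simp only [Nat.cast_zero, mul_zero, zero_add, Nat.cast_one, mul_one, Nat.cast_add]
  rw [show ε * (1 + 1) = 2 * ε by ring, hR]
  push_cast
  ring

/-- `v` is the Abel sum of the series `∑ C n`. -/
def HasAbelSum (C : ℕ → ℂ) (v : ℂ) : Prop :=
  Tendsto (fun ε : ℝ => ∑' n : ℕ, C n * (Real.exp (-(ε * n)) : ℂ)) (𝓝[>] 0) (𝓝 v)

/-- `v` is the sum of the series `∑ C n` regularized by the factors `exp (-ε n²)`. -/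
def HasGaussSum (C : ℕ → ℂ) (v : ℂ) : Prop :=
  Tendsto (fun ε : ℝ => ∑' n : ℕ, C n * (Real.exp (-(ε * n ^ 2)) : ℂ)) (𝓝[>] 0) (𝓝 v)

/-- The value of the regularized sum `∑ C n * n ^ j`, for `j = 0` and `j = 1`. -/
noncomputable def regularizedValue (T : ℕ) (C : ℕ → ℂ) (j : ℕ) : ℂ :=
  if j = 0 then partialSumMean T C else -partialSumMean T (centeredPartialSum T C)

theorem exists_bound_tsum_periodic_mul_dilate {T : ℕ} (hT : 0 < T) {C : ℕ → ℂ}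
    (hC : Function.Periodic C T) (h0 : ∑ n ∈ Finset.range T, C n = 0) {j : ℕ} (hj : j ≤ 1)
    {φ G₁ G₂ G₃ : ℝ → ℝ} (h1 : ∀ x, HasDerivAt (fun x => x ^ j * φ x) (G₁ x) x)
    (h2 : ∀ x, HasDerivAt G₁ (G₂ x) x)
    (h3 : ∀ x, HasDerivAt G₂ (G₃ x) x) {M : ℝ} (hM : 0 ≤ M)
    (hG : ∀ x, 0 ≤ x → |x ^ j * φ x| ≤ M * Real.exp (-(x / 2)))
    (hG₃ : ∀ x, 0 ≤ x → |G₃ x| ≤ M * Real.exp (-(x / 2)))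
    (hφ : ∀ x, 0 ≤ x → |φ x - 1| ≤ x) :
    ∃ B, ∀ ε : ℝ, 0 < ε → ε ≤ 1 →
      ‖∑' n : ℕ, C n * n ^ j * (φ (ε * n) : ℂ) - regularizedValue T C j‖ ≤ B * ε := by
  obtain ⟨B, hB⟩ := tsum_periodic_mul_dilate hT hC h0 h1 h2 h3 hM hG hG₃
  have hB0 : 0 ≤ B := by simpa using (norm_nonneg _).trans (hB 1 one_pos le_rfl)
  have hφ0 : φ 0 = 1 := by
    have := hφ 0 le_rfl
    rw [abs_nonpos_iff] at this; linarith
  set d := partialSumMean T C with hd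
  set d' := partialSumMean T (centeredPartialSum T C) with hd'
  set d'' := partialSumMean T (centeredPartialSum T (centeredPartialSum T C)) with hd''
  refine ⟨B + ‖d'‖ + 6 * ‖d''‖, fun ε hε hε1 => ?_⟩
  have b1 : ‖(φ ε : ℂ) - 1‖ ≤ ε := by
    have := hφ ε hε.le
    rw [← Real.norm_eq_abs, ← Complex.norm_real] at this
    simpa using this
  have b2 : ‖(φ (2 * ε) : ℂ) - 1‖ ≤ 2 * ε := by
    have := hφ (2 * ε) (by linarith)
    rw [← Real.norm_eq_abs, ← Complex.norm_real] at this
    simpa using this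
  have b3 : ∀ a b : ℝ, 0 ≤ a → 0 ≤ b → ‖(a : ℂ) * ((φ (2 * ε) : ℂ) - 1) - b * ((φ ε : ℂ) - 1)‖
      ≤ a * (2 * ε) + b * ε := fun a b ha hb => by
    refine (norm_sub_le _ _).trans (add_le_add ?_ ?_)
    · rw [norm_mul, Complex.norm_real, Real.norm_of_nonneg ha]
      exact mul_le_mul_of_nonneg_left b2 ha
    · rw [norm_mul, Complex.norm_real, Real.norm_of_nonneg hb]
      exact mul_le_mul_of_nonneg_left b1 hb
  have hE := hB ε hε hε1
  interval_cases j
  · simp only [pow_zero, one_mul, mul_one, hφ0, ofReal_one] at hE ⊢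
    rw [regularizedValue, if_pos rfl, ← hd]
    set X := ∑' n : ℕ, C n * (φ (ε * n) : ℂ)
    have e : X - d = (X - (d - d' * (φ ε - 1) + d'' * (φ (2 * ε) - 2 * φ ε + 1)))
        - d' * (φ ε - 1) + d'' * (((1 : ℝ) : ℂ) * (φ (2 * ε) - 1) - (2 : ℝ) * (φ ε - 1)) := by
      push_cast; ring
    have b4 := b3 1 2 zero_le_one zero_le_two
    rw [e]
    refine (norm_add_le _ _).trans ((add_le_add_left (norm_sub_le _ _) _).trans ?_)
    rw [norm_mul, norm_mul]
    nlinarith [norm_nonneg d', norm_nonneg d'', mul_le_mul_of_nonneg_left b1 (norm_nonneg d'),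
      mul_le_mul_of_nonneg_left b4 (norm_nonneg d''), mul_le_mul_of_nonneg_left hε1 hε.le,
      mul_le_mul_of_nonneg_left (mul_le_mul_of_nonneg_left hε1 hε.le) hB0]
  · simp only [pow_one] at hE ⊢
    rw [regularizedValue, if_neg one_ne_zero, ← hd']
    set X := ∑' n : ℕ, C n * n * (φ (ε * n) : ℂ) with hX
    have eX : ∑' n : ℕ, C n * ((ε * n * φ (ε * n) : ℝ) : ℂ) = ε * X := by
      rw [hX, ← tsum_mul_left]
      exact tsum_congr fun n => by push_cast; ring
    rw [eX] at hE
    have hεc : (ε : ℂ) ≠ 0 := by exact_mod_cast hε.ne'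
    have e : X - -d' = (ε : ℂ)⁻¹ * (ε * X - (d * ((0 * φ 0 : ℝ) : ℂ)
        - d' * (((ε * φ ε : ℝ) : ℂ) - ((0 * φ 0 : ℝ) : ℂ))
        + d'' * (((2 * ε * φ (2 * ε) : ℝ) : ℂ) - 2 * ((ε * φ ε : ℝ) : ℂ)
          + ((0 * φ 0 : ℝ) : ℂ))))
        - d' * (φ ε - 1) + d'' * (((2 : ℝ) : ℂ) * (φ (2 * ε) - 1) - (2 : ℝ) * (φ ε - 1)) := by
      push_cast; field_simp; ring
    have b4 := b3 2 2 zero_le_two zero_le_two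
    rw [e]
    refine (norm_add_le _ _).trans ((add_le_add_left (norm_sub_le _ _) _).trans ?_)
    rw [norm_mul, norm_mul, norm_mul, norm_inv, Complex.norm_real, Real.norm_of_nonneg hε.le]
    have b5 := mul_le_mul_of_nonneg_left hE (inv_nonneg.mpr hε.le)
    rw [show ε⁻¹ * (B * ε ^ 2) = B * ε by field_simp] at b5
    nlinarith [norm_nonneg d', norm_nonneg d'', mul_le_mul_of_nonneg_left b1 (norm_nonneg d'),
      mul_le_mul_of_nonneg_left b4 (norm_nonneg d'')]

theorem le_two_mul_exp_half {x : ℝ} : x ≤ 2 * Real.exp (x / 2) := by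
  linarith [Real.add_one_le_exp (x / 2)]

/-- Abel regularization of `∑ C n * n ^ j`, with an error term. -/
theorem exists_bound_abel {T : ℕ} (hT : 0 < T) {C : ℕ → ℂ} (hC : Function.Periodic C T)
    (h0 : ∑ n ∈ Finset.range T, C n = 0) {j : ℕ} (hj : j ≤ 1) :
    ∃ B, ∀ ε : ℝ, 0 < ε → ε ≤ 1 →
      ‖∑' n : ℕ, C n * n ^ j * (Real.exp (-(ε * n)) : ℂ) - regularizedValue T C j‖ ≤ B * ε := by
  have he : ∀ x : ℝ, HasDerivAt (fun x => Real.exp (-x)) (-Real.exp (-x)) x := fun x => by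
    simpa using (hasDerivAt_neg x).exp
  have hlin : ∀ a b x : ℝ, HasDerivAt (fun x => (a + b * x) * Real.exp (-x))
      ((b - a + (-b) * x) * Real.exp (-x)) x := fun a b x => by
    have := (((hasDerivAt_id x).const_mul b).const_add a).mul (he x)
    refine this.congr_deriv ?_
    simp; ring
  have hbd : ∀ x : ℝ, 0 ≤ x → ∀ a b : ℝ, |a| ≤ 3 → |b| ≤ 1 →
      |(a + b * x) * Real.exp (-x)| ≤ 5 * Real.exp (-(x / 2)) := fun x hx a b ha hb => by
    rw [abs_mul, abs_of_pos (Real.exp_pos _), show -x = -(x / 2) + -(x / 2) by ring, Real.exp_add,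
      ← mul_assoc]
    refine mul_le_mul_of_nonneg_right ?_ (Real.exp_pos _).le
    have h1 : |a + b * x| ≤ 3 + x := (abs_add_le _ _).trans (by
      rw [abs_mul, abs_of_nonneg hx]; nlinarith)
    have h2 : Real.exp (x / 2) * Real.exp (-(x / 2)) = 1 := by rw [← Real.exp_add]; simp
    have h3 := le_two_mul_exp_half (x := x)
    have h4 : 1 ≤ Real.exp (x / 2) := Real.one_le_exp (by linarith)
    nlinarith [Real.exp_pos (-(x / 2))]
  have hφ : ∀ x : ℝ, 0 ≤ x → |Real.exp (-x) - 1| ≤ x := fun x hx => by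
    rw [abs_sub_comm, abs_of_nonneg (by simpa using hx)]
    linarith [Real.add_one_le_exp (-x)]
  interval_cases j
  · refine exists_bound_tsum_periodic_mul_dilate hT hC h0 zero_le_one (φ := fun x => Real.exp (-x))
      (fun x => ?_) (hlin (-1) 0) (fun x => hlin _ _ x) (M := 5) (by norm_num) (fun x hx => ?_)
      (fun x hx => hbd x hx _ _ (by norm_num) (by norm_num)) hφ
    · simpa using he x
    · simpa using hbd x hx 1 0 (by norm_num) (by norm_num)
  · refine exists_bound_tsum_periodic_mul_dilate hT hC h0 le_rfl (φ := fun x => Real.exp (-x))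
      (fun x => ?_) (hlin 1 (-1)) (fun x => hlin _ _ x) (M := 5) (by norm_num) (fun x hx => ?_)
      (fun x hx => hbd x hx _ _ (by norm_num) (by norm_num)) hφ
    · simpa using hlin 0 1 x
    · simpa using hbd x hx 0 1 (by norm_num) (by norm_num)

/-- Gaussian regularization of `∑ C n * n ^ j`, with an error term. -/
theorem exists_bound_gauss {T : ℕ} (hT : 0 < T) {C : ℕ → ℂ} (hC : Function.Periodic C T)
    (h0 : ∑ n ∈ Finset.range T, C n = 0) {j : ℕ} (hj : j ≤ 1) :
    ∃ B, ∀ ε : ℝ, 0 < ε → ε ≤ 1 →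
      ‖∑' n : ℕ, C n * n ^ j * (Real.exp (-(ε * n) ^ 2) : ℂ) - regularizedValue T C j‖
        ≤ B * ε := by
  have he : ∀ x : ℝ, HasDerivAt (fun x => Real.exp (-x ^ 2)) (-2 * x * Real.exp (-x ^ 2)) x :=
    fun x => by
    have := ((hasDerivAt_pow 2 x).neg).exp
    refine this.congr_deriv ?_
    simp; ring
  have hp : ∀ a b c d x : ℝ, HasDerivAt
      (fun x => (a + b * x + c * x ^ 2 + d * x ^ 3) * Real.exp (-x ^ 2))
      ((b + 2 * c * x + 3 * d * x ^ 2 - 2 * x * (a + b * x + c * x ^ 2 + d * x ^ 3))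
        * Real.exp (-x ^ 2)) x := fun a b c d x => by
    have := (((((hasDerivAt_id x).const_mul b).const_add a).add
      ((hasDerivAt_pow 2 x).const_mul c)).add ((hasDerivAt_pow 3 x).const_mul d)).mul (he x)
    refine this.congr_deriv ?_
    simp; ring
  have hbd : ∀ x : ℝ, 0 ≤ x → ∀ y : ℝ, |y| ≤ 128 + 64 * x ^ 2 + 8 * x ^ 4 →
      |y * Real.exp (-x ^ 2)| ≤ 256 * Real.exp (-(x / 2)) := fun x hx y hy => by
    rw [abs_mul, abs_of_pos (Real.exp_pos _)]
    have h1 : Real.exp (-x ^ 2) = Real.exp (-(x ^ 2 / 2)) * Real.exp (-(x ^ 2 / 2)) := by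
      rw [← Real.exp_add]; congr 1; ring
    have h2 : Real.exp (x ^ 2 / 2) * Real.exp (-(x ^ 2 / 2)) = 1 := by rw [← Real.exp_add]; simp
    have h3 : (1 + x ^ 2 / 4) ^ 2 ≤ Real.exp (x ^ 2 / 2) := by
      rw [show x ^ 2 / 2 = x ^ 2 / 4 + x ^ 2 / 4 by ring, Real.exp_add, ← sq]
      exact pow_le_pow_left₀ (by positivity) (by linarith [Real.add_one_le_exp (x ^ 2 / 4)]) 2
    have h4 : Real.exp (-(x ^ 2 / 2)) ≤ 2 * Real.exp (-(x / 2)) := by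
      have : Real.exp (1 / 8) ≤ 2 := by
        have := Real.add_one_le_exp (-(1 / 8) : ℝ)
        rw [Real.exp_neg] at this
        have h := Real.exp_pos (1 / 8)
        have h' : (1 / 2 : ℝ) ≤ (Real.exp (1 / 8))⁻¹ := by linarith
        rw [le_inv_comm₀ (by norm_num) h] at h'
        linarith
      calc _ ≤ Real.exp (1 / 8 + -(x / 2)) := Real.exp_le_exp.mpr (by nlinarith [sq_nonneg (x - 1/2)])
        _ = Real.exp (1 / 8) * Real.exp (-(x / 2)) := Real.exp_add _ _
        _ ≤ _ := mul_le_mul_of_nonneg_right this (Real.exp_pos _).le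
    have h5 : |y| * Real.exp (-(x ^ 2 / 2)) ≤ 128 := by
      calc _ ≤ (128 * Real.exp (x ^ 2 / 2)) * Real.exp (-(x ^ 2 / 2)) :=
            mul_le_mul_of_nonneg_right (by nlinarith) (Real.exp_pos _).le
        _ = 128 := by rw [mul_assoc, h2, mul_one]
    rw [h1, ← mul_assoc]
    nlinarith [Real.exp_pos (-(x ^ 2 / 2))]
  have hφ : ∀ x : ℝ, 0 ≤ x → |Real.exp (-x ^ 2) - 1| ≤ x := fun x hx => by
    rw [abs_sub_comm, abs_of_nonneg (by simp; positivity)]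
    rcases le_total x 1 with h | h
    · nlinarith [Real.add_one_le_exp (-x ^ 2)]
    · linarith [Real.exp_pos (-x ^ 2)]
  have ab : ∀ x : ℝ, 0 ≤ x → ∀ a b c d e : ℝ, |a| ≤ 6 → |b| ≤ 12 → |c| ≤ 24 → |d| ≤ 8 → |e| ≤ 8 →
      |a + b * x + c * x ^ 2 + d * x ^ 3 + e * x ^ 4| ≤ 128 + 64 * x ^ 2 + 8 * x ^ 4 + 8 * x ^ 4 := by
    intro x hx a b c d e ha hb hc hd he
    rw [abs_le] at *
    have := pow_nonneg hx 2
    have := pow_nonneg hx 3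
    have := pow_nonneg hx 4
    constructor <;> nlinarith [sq_nonneg (x - 1), sq_nonneg (x * (x - 1)), sq_nonneg (x ^ 2 - 1)]
  interval_cases j
  · refine exists_bound_tsum_periodic_mul_dilate hT hC h0 zero_le_one
      (φ := fun x => Real.exp (-x ^ 2)) (G₁ := fun x => (0 + -2 * x + 0 * x ^ 2 + 0 * x ^ 3) *
        Real.exp (-x ^ 2)) (fun x => ?_)
      (G₂ := fun x => (-2 + 0 * x + 4 * x ^ 2 + 0 * x ^ 3) * Real.exp (-x ^ 2))
      (fun x => (hp _ _ _ _ x).congr_deriv (by ring)) (fun x => hp _ _ _ _ x) (M := 256)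
      (by norm_num) (fun x hx => hbd x hx _ ?_)
      (fun x hx => hbd x hx _ ?_) hφ
    · exact ((he x).congr_deriv (by ring)).congr_of_eventuallyEq (.of_forall fun x => by simp)
    · rw [pow_zero, abs_one]; nlinarith [pow_nonneg hx 2, pow_nonneg hx 4]
    · have := pow_nonneg hx 2
      have := pow_nonneg hx 3
      have := pow_nonneg hx 4
      rw [abs_le]
      constructor <;> nlinarith [sq_nonneg (x - 1), sq_nonneg (x * (x - 1)), sq_nonneg (x ^ 2 - 1)]
  · refine exists_bound_tsum_periodic_mul_dilate hT hC h0 le_rfl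
      (φ := fun x => Real.exp (-x ^ 2)) (G₁ := fun x => (1 + 0 * x + (-2) * x ^ 2 + 0 * x ^ 3) *
        Real.exp (-x ^ 2)) (fun x => ?_)
      (G₂ := fun x => (0 + (-6) * x + 0 * x ^ 2 + 4 * x ^ 3) * Real.exp (-x ^ 2))
      (fun x => (hp _ _ _ _ x).congr_deriv (by ring)) (fun x => hp _ _ _ _ x) (M := 256)
      (by norm_num) (fun x hx => hbd x hx _ ?_)
      (fun x hx => hbd x hx _ ?_) hφ
    · exact ((hp 0 1 0 0 x).congr_deriv (by ring)).congr_of_eventuallyEq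
        (.of_forall fun x => by simp)
    · rw [pow_one, abs_of_nonneg hx]; nlinarith [pow_nonneg hx 2, pow_nonneg hx 4]
    · have := pow_nonneg hx 2
      have := pow_nonneg hx 3
      have := pow_nonneg hx 4
      rw [abs_le]
      constructor <;> nlinarith [sq_nonneg (x - 1), sq_nonneg (x * (x - 1)), sq_nonneg (x ^ 2 - 1)]

theorem tendsto_of_norm_sub_le {F : ℝ → ℂ} {v : ℂ} {B : ℝ}
    (h : ∀ ε : ℝ, 0 < ε → ε ≤ 1 → ‖F ε - v‖ ≤ B * ε) : Tendsto F (𝓝[>] 0) (𝓝 v) := by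
  rw [tendsto_iff_norm_sub_tendsto_zero]
  have h1 : Tendsto (fun ε : ℝ => B * ε) (𝓝[>] 0) (𝓝 0) := by
    have : Tendsto (fun ε : ℝ => B * ε) (𝓝 0) (𝓝 (B * 0)) := tendsto_id.const_mul B
    rw [mul_zero] at this
    exact this.mono_left nhdsWithin_le_nhds
  refine squeeze_zero' (.of_forall fun _ => norm_nonneg _) ?_ h1
  filter_upwards [Ioc_mem_nhdsGT (zero_lt_one' ℝ)] with ε hε using h ε hε.1 hε.2

theorem hasAbelSum_regularizedValue {T : ℕ} (hT : 0 < T) {C : ℕ → ℂ} (hC : Function.Periodic C T)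
    (h0 : ∑ n ∈ Finset.range T, C n = 0) {j : ℕ} (hj : j ≤ 1) :
    HasAbelSum (fun n => C n * n ^ j) (regularizedValue T C j) := by
  obtain ⟨B, hB⟩ := exists_bound_abel hT hC h0 hj
  exact tendsto_of_norm_sub_le hB

theorem hasGaussSum_regularizedValue {T : ℕ} (hT : 0 < T) {C : ℕ → ℂ}
    (hC : Function.Periodic C T) (h0 : ∑ n ∈ Finset.range T, C n = 0) {j : ℕ} (hj : j ≤ 1) :
    HasGaussSum (fun n => C n * n ^ j) (regularizedValue T C j) := by
  obtain ⟨B, hB⟩ := exists_bound_gauss hT hC h0 hj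
  have h1 : Tendsto (fun ε : ℝ => √ε) (𝓝[>] 0) (𝓝[>] 0) := by
    refine tendsto_nhdsWithin_iff.mpr ⟨?_, ?_⟩
    · simpa using (Real.continuous_sqrt.tendsto 0).mono_left nhdsWithin_le_nhds
    · filter_upwards [self_mem_nhdsWithin] with ε hε using Real.sqrt_pos.mpr hε
  refine ((tendsto_of_norm_sub_le hB).comp h1).congr' ?_
  filter_upwards [self_mem_nhdsWithin] with ε hε
  refine tsum_congr fun n => ?_
  rw [mul_pow, Real.sq_sqrt (le_of_lt hε)]

/-! ### Values of L-functions as Abel sums -/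

theorem sum_range_natCast_zmod {T : ℕ} [NeZero T] (f : ZMod T → ℂ) :
    ∑ n ∈ Finset.range T, f n = ∑ x, f x := by
  refine Finset.sum_bij' (fun n _ => (n : ZMod T)) (fun x _ => x.val) ?_ ?_ ?_ ?_ ?_
  · simp
  · intro x _; exact Finset.mem_range.mpr (ZMod.val_lt x)
  · intro n hn; exact ZMod.val_natCast_of_lt (Finset.mem_range.mp hn)
  · intro x _; simp
  · simp

theorem periodic_natCast_zmod {T : ℕ} (f : ZMod T → ℂ) :
    Function.Periodic (fun n : ℕ => f n) T := fun n => by simp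

theorem exists_norm_le_zmod {T : ℕ} [NeZero T] (f : ZMod T → ℂ) : ∃ B, 0 ≤ B ∧ ∀ x, ‖f x‖ ≤ B :=
  ⟨∑ x, ‖f x‖, Finset.sum_nonneg fun _ _ => norm_nonneg _, fun x =>
    Finset.single_le_sum (f := fun x => ‖f x‖) (fun _ _ => norm_nonneg _) (Finset.mem_univ x)⟩

theorem summable_pow_mul_exp_neg (j : ℕ) {t : ℝ} (ht : 0 < t) :
    Summable fun n : ℕ => (n : ℝ) ^ j * Real.exp (-(t * n)) := by
  have := Real.summable_pow_mul_exp_neg_nat_mul j ht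
  refine this.congr fun n => ?_
  congr 2; ring

/-- The value of the L-function of a periodic function of mean zero at `0` and `-1` is the
regularized value of the divergent series. The Mellin transform of
`∑ f n * n ^ j * exp (-n t) - v * exp (-t)` is `Γ s * (L(s - j, f) - v)`; when `v` is the limit of
the sum as `t → 0`, it is holomorphic near `s = 0`, where `1 / Γ` vanishes. -/
theorem LFunction_neg_eq_regularizedValue {T : ℕ} [NeZero T] {f : ZMod T → ℂ} (hf : ∑ x, f x = 0)
    {j : ℕ} (hj : j ≤ 1) (hf0 : f 0 * (0 : ℂ) ^ j = 0) :
    ZMod.LFunction f (-j) = regularizedValue T (fun n => f n) j := by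
  set v := regularizedValue T (fun n => f n) j with hv
  have hT : 0 < T := NeZero.pos T
  obtain ⟨B, hB⟩ := exists_bound_abel hT (periodic_natCast_zmod f)
    (by rw [sum_range_natCast_zmod, hf]) hj
  obtain ⟨A, hA0, hA⟩ := exists_norm_le_zmod f
  set a : ℕ → ℂ := fun n => f n * n ^ j - if n = 1 then v else 0 with ha
  have ha0 : a 0 = 0 := by simp [ha, hf0]
  have hab : ∀ n, ‖a n‖ ≤ (A + ‖v‖) * (n : ℝ) ^ j := fun n => by
    refine (norm_sub_le _ _).trans ?_
    rw [norm_mul, norm_pow, Complex.norm_natCast, add_mul]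
    refine add_le_add (mul_le_mul_of_nonneg_right (hA _) (by positivity)) ?_
    split_ifs with h
    · simp [h]
    · rw [norm_zero]; positivity
  have hnorm : ∀ (n : ℕ) (t : ℝ), ‖a n * (Real.exp (-(n : ℝ) * t) : ℂ)‖
      ≤ (A + ‖v‖) * ((n : ℝ) ^ j * Real.exp (-(t * n))) := fun n t => by
    rw [norm_mul, Complex.norm_real, Real.norm_of_nonneg (Real.exp_pos _).le, ← mul_assoc,
      show -(n : ℝ) * t = -(t * n) by ring]
    exact mul_le_mul_of_nonneg_right (hab n) (Real.exp_pos _).le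
  have hs : ∀ t : ℝ, 0 < t → Summable fun n : ℕ => a n * (Real.exp (-(n : ℝ) * t) : ℂ) :=
    fun t ht => Summable.of_norm_bounded ((summable_pow_mul_exp_neg j ht).mul_left _)
      fun n => hnorm n t
  set F : ℝ → ℂ := fun t => ∑' n : ℕ, a n * (Real.exp (-(n : ℝ) * t) : ℂ) with hF
  -- behaviour at the origin
  have hbot : F =O[𝓝[>] 0] (· ^ (-(-1 : ℝ))) := by
    refine IsBigO.of_bound (B + ‖v‖) ?_
    filter_upwards [Ioc_mem_nhdsGT (zero_lt_one' ℝ)] with t ht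
    have e1 : F t = (∑' n : ℕ, f n * n ^ j * (Real.exp (-(t * n)) : ℂ) - v)
        - v * ((Real.exp (-t) : ℂ) - 1) := by
      have s2 : Summable fun n : ℕ => (if n = 1 then v else 0) * (Real.exp (-(n : ℝ) * t) : ℂ) :=
        summable_of_ne_finset_zero (s := {1}) fun n hn => by
          rw [if_neg (by simpa using hn), zero_mul]
      have s1 : Summable fun n : ℕ => f n * n ^ j * (Real.exp (-(n : ℝ) * t) : ℂ) :=
        ((hs t ht.1).add s2).congr fun n => by simp only [ha]; ring
      have e2 : ∑' n : ℕ, (if n = 1 then v else 0) * (Real.exp (-(n : ℝ) * t) : ℂ)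
          = v * Real.exp (-t) := by
        rw [tsum_eq_single 1 fun n hn => by rw [if_neg hn, zero_mul]]
        simp
      have e3 : F t = ∑' n : ℕ, f n * n ^ j * (Real.exp (-(n : ℝ) * t) : ℂ)
          - v * Real.exp (-t) := by
        rw [← e2, ← s1.tsum_sub s2]
        exact tsum_congr fun n => by simp only [ha]; ring
      rw [e3, tsum_congr fun n : ℕ => by rw [show -(n : ℝ) * t = -(t * n) by ring]]
      ring
    have b1 : ‖(Real.exp (-t) : ℂ) - 1‖ ≤ t := by
      rw [← ofReal_one, ← ofReal_sub, Complex.norm_real, Real.norm_eq_abs, abs_sub_comm,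
        abs_of_nonneg (by simpa using ht.1.le)]
      linarith [Real.add_one_le_exp (-t)]
    rw [e1, neg_neg, Real.rpow_one, Real.norm_of_nonneg ht.1.le, add_mul]
    refine (norm_sub_le _ _).trans (add_le_add (hB t ht.1 ht.2) ?_)
    rw [norm_mul]
    exact mul_le_mul_of_nonneg_left b1 (norm_nonneg v)
  -- decay at infinity
  have htop : F =O[atTop] fun t => Real.exp (-(1 / 2) * t) := by
    refine IsBigO.of_bound (∑' n : ℕ, (A + ‖v‖) * ((n : ℝ) ^ j * Real.exp (-(1 / 2 * n)))) ?_
    filter_upwards [eventually_ge_atTop 1] with t ht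
    rw [Real.norm_of_nonneg (Real.exp_pos _).le, ← tsum_mul_right]
    refine tsum_of_norm_bounded (((summable_pow_mul_exp_neg j
      (half_pos (zero_lt_one' ℝ))).mul_left (A + ‖v‖)).mul_right _).hasSum fun n => ?_
    rcases Nat.eq_zero_or_pos n with rfl | hn
    · rw [ha0, zero_mul, norm_zero]; positivity
    refine (hnorm n t).trans ?_
    rw [mul_assoc, mul_assoc, ← Real.exp_add]
    have : (1 : ℝ) ≤ n := by exact_mod_cast hn
    gcongr
    nlinarith
  have hcont : ContinuousOn F (Set.Ioi 0) := by
    intro t ht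
    have ht' : (0 : ℝ) < t / 2 := half_pos ht
    refine ContinuousAt.continuousWithinAt ?_
    have : ContinuousOn F (Set.Ici (t / 2)) := by
      refine continuousOn_tsum (u := fun n : ℕ => (A + ‖v‖) * ((n : ℝ) ^ j *
        Real.exp (-(t / 2 * n)))) (fun n => by fun_prop)
        ((summable_pow_mul_exp_neg j ht').mul_left _) fun n x hx => (hnorm n x).trans ?_
      have : t / 2 ≤ x := hx
      gcongr
    exact this.continuousAt (Ici_mem_nhds (by simpa using ht))
  have hdiff : ∀ s : ℂ, -1 < s.re → DifferentiableAt ℂ (mellin F) s := fun s hs =>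
    mellin_differentiableAt_of_isBigO_rpow_exp (half_pos one_pos)
      (hcont.locallyIntegrableOn measurableSet_Ioi) htop hbot hs
  -- the Mellin transform in the region of convergence
  have hmel : ∀ s : ℂ, 1 + j < s.re → mellin F s = Gamma s * (ZMod.LFunction f (s - j) - v) := by
    intro s hsr
    have hjr : (0 : ℝ) ≤ j := Nat.cast_nonneg j
    have hs0 : 0 < s.re := by linarith
    have hsj : 1 < (s - j).re := by simpa using by linarith
    have h1 := hasSum_mellin (a := a) (p := fun n : ℕ => (n : ℝ)) (F := F) (s := s)
      (fun n => by
        rcases Nat.eq_zero_or_pos n with rfl | hn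
        · exact Or.inl ha0
        · exact Or.inr (by exact_mod_cast hn)) hs0 (fun t ht => (hs t ht).hasSum) (by
        refine Summable.of_nonneg_of_le (fun n => by positivity) (fun n => ?_)
          ((Real.summable_nat_rpow_inv.mpr (show 1 < s.re - j by linarith)).mul_left (A + ‖v‖))
        rcases Nat.eq_zero_or_pos n with rfl | hn
        · rw [ha0, norm_zero, zero_div]; positivity
        · have hn' : (0 : ℝ) < n := by exact_mod_cast hn
          rw [div_le_iff₀ (Real.rpow_pos_of_pos hn' _), Real.rpow_sub_natCast hn'.ne', inv_div,
            mul_assoc, div_mul_cancel₀ _ (Real.rpow_pos_of_pos hn' _).ne']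
          exact hab n)
    have h2 : HasSum (fun n : ℕ => f n * n ^ j / (n : ℂ) ^ s) (ZMod.LFunction f (s - j)) := by
      rw [ZMod.LFunction_eq_LSeries f hsj]
      have h := (ZMod.LSeriesSummable_of_one_lt_re f hsj).hasSum
      convert! h using 1
      funext n
      rcases eq_or_ne n 0 with rfl | hn
      · simp [hf0]
      · have hn' : (n : ℂ) ≠ 0 := by exact_mod_cast hn
        rw [LSeries.term_of_ne_zero hn, cpow_sub _ _ hn', cpow_natCast]
        have := (cpow_ne_zero_iff_of_exponent_ne_zero
          (show s ≠ 0 by rintro rfl; simp at hs0)).mpr hn'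
        field_simp
    have h4 : HasSum (fun n : ℕ => (if n = 1 then v else 0) / (n : ℂ) ^ s) v := by
      have := hasSum_single (f := fun n : ℕ => (if n = 1 then v else 0) / (n : ℂ) ^ s) 1
        fun n hn => by rw [if_neg hn, zero_div]
      simpa using this
    have h5 := (h2.sub h4).mul_left (Gamma s)
    refine h1.unique ?_
    convert! h5 using 1
    funext n
    simp only [ha, ofReal_natCast]
    ring
  have hopen : IsOpen {s : ℂ | -1 < s.re} := isOpen_lt continuous_const continuous_re
  have hEq : Set.EqOn (fun s => ZMod.LFunction f (s - j) - v)
      (fun s => mellin F s * (Gamma s)⁻¹) {s : ℂ | -1 < s.re} := by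
    refine AnalyticOnNhd.eqOn_of_preconnected_of_eventuallyEq (𝕜 := ℂ) (z₀ := (3 : ℂ))
      ?_ ?_ ?_ ?_ ?_
    · refine DifferentiableOn.analyticOnNhd (fun s _ => ?_) hopen
      have h : Differentiable ℂ fun s : ℂ => ZMod.LFunction f (s - j) :=
        (ZMod.differentiable_LFunction_of_sum_zero hf).comp (differentiable_id.sub_const (j : ℂ))
      exact (h.sub_const v s).differentiableWithinAt
    · refine DifferentiableOn.analyticOnNhd (fun s hs => ?_) hopen
      have h : DifferentiableAt ℂ (fun s => (Gamma s)⁻¹) s := differentiable_one_div_Gamma s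
      exact ((hdiff s hs).mul h).differentiableWithinAt
    · exact (convex_halfSpace_re_gt (-1)).isPreconnected
    · simp; norm_num
    · have : ∀ᶠ s : ℂ in 𝓝 3, 2 < s.re :=
        continuous_re.continuousAt.eventually (lt_mem_nhds (by norm_num))
      filter_upwards [this] with s hs
      have hj' : (j : ℝ) ≤ 1 := by exact_mod_cast hj
      rw [hmel s (by linarith)]
      have : Gamma s ≠ 0 := Gamma_ne_zero_of_re_pos (by linarith)
      field_simp
  have := hEq (show (0 : ℂ) ∈ {s : ℂ | -1 < s.re} by simp)
  simp only [Gamma_zero, inv_zero, mul_zero, zero_sub] at this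
  exact sub_eq_zero.mp this

open MeasureTheory

/-! ### Exponential integrals of quadratic polynomials over a half-line -/

/-- The integral `∫₀^∞ x ^ j exp (A x² + c x) dx`. -/
noncomputable def quadExpIntegral (A c : ℂ) (j : ℕ) : ℂ :=
  ∫ x in Set.Ioi (0 : ℝ), (x : ℂ) ^ j * cexp (A * x ^ 2 + c * x)

theorem integrableOn_pow_mul_exp_neg (j : ℕ) {b : ℝ} (hb : 0 < b) :
    IntegrableOn (fun x : ℝ => x ^ j * Real.exp (-(b * x))) (Set.Ioi 0) := by
  have h := integrableOn_rpow_mul_exp_neg_mul_rpow (p := 1) (s := j) (b := b)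
    (by linarith [(Nat.cast_nonneg j : (0 : ℝ) ≤ j)]) one_pos hb
  refine h.congr_fun (fun x _ => ?_) measurableSet_Ioi
  simp

theorem integral_pow_mul_exp_neg (j : ℕ) {b : ℝ} (hb : 0 < b) :
    ∫ x in Set.Ioi (0 : ℝ), x ^ j * Real.exp (-(b * x)) = j.factorial / b ^ (j + 1) := by
  have h := Real.integral_rpow_mul_exp_neg_mul_Ioi (a := j + 1) (r := b) (by positivity) hb
  rw [Real.Gamma_nat_eq_factorial] at h
  calc _ = ∫ t in Set.Ioi (0 : ℝ), t ^ ((j : ℝ) + 1 - 1) * Real.exp (-(b * t)) :=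
        setIntegral_congr_fun measurableSet_Ioi fun x _ => by simp
    _ = _ := h
    _ = _ := by
      rw [show ((j : ℝ) + 1) = ((j + 1 : ℕ) : ℝ) by push_cast; ring, Real.rpow_natCast, one_div, inv_pow]
      field_simp

theorem norm_pow_mul_cexp_quad (A c : ℂ) (j : ℕ) {x : ℝ} (hx : 0 < x) :
    ‖(x : ℂ) ^ j * cexp (A * x ^ 2 + c * x)‖ = x ^ j * Real.exp (A.re * x ^ 2 + c.re * x) := by
  rw [norm_mul, norm_pow, Complex.norm_real, Real.norm_of_nonneg hx.le, Complex.norm_exp]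
  congr 2
  simp [← ofReal_pow]

/-- The condition under which `∫₀^∞ x ^ j exp (A x² + c x) dx` converges absolutely. -/
def QuadExpConvergent (A c : ℂ) : Prop := A.re < 0 ∨ (A.re ≤ 0 ∧ c.re < 0)

theorem QuadExpConvergent.integrableOn_real {A c : ℂ} (h : QuadExpConvergent A c) (j : ℕ) :
    IntegrableOn (fun x : ℝ => x ^ j * Real.exp (A.re * x ^ 2 + c.re * x)) (Set.Ioi 0) := by
  obtain ⟨b, C, hb, hC⟩ : ∃ b C : ℝ, 0 < b ∧ ∀ x : ℝ, 0 < x →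
      Real.exp (A.re * x ^ 2 + c.re * x) ≤ C * Real.exp (-(b * x)) := by
    rcases h with h | ⟨h, h'⟩
    · refine ⟨1, Real.exp ((c.re + 1) ^ 2 / (4 * -A.re)), one_pos, fun x hx => ?_⟩
      rw [← Real.exp_add, Real.exp_le_exp]
      have : 0 ≤ (c.re + 1) ^ 2 / (4 * -A.re) - (c.re + 1) * x + -A.re * x ^ 2 := by
        have hA : A.re ≠ 0 := h.ne
        rw [show (c.re + 1) ^ 2 / (4 * -A.re) - (c.re + 1) * x + -A.re * x ^ 2
          = (c.re + 1 + 2 * A.re * x) ^ 2 / (4 * -A.re) by field_simp; ring]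
        exact div_nonneg (sq_nonneg _) (by linarith)
      linarith
    · refine ⟨-c.re, 1, by linarith, fun x hx => ?_⟩
      rw [one_mul, Real.exp_le_exp]
      nlinarith [sq_nonneg x]
  refine Integrable.mono' ((integrableOn_pow_mul_exp_neg j hb).const_mul C)
    (by fun_prop) ?_
  filter_upwards [ae_restrict_mem measurableSet_Ioi] with x hx
  have hx' : (0 : ℝ) < x := hx
  rw [Real.norm_of_nonneg (by positivity)]
  calc _ ≤ x ^ j * (C * Real.exp (-(b * x))) :=
        mul_le_mul_of_nonneg_left (hC x hx') (by positivity)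
    _ = _ := by ring

theorem QuadExpConvergent.integrableOn {A c : ℂ} (h : QuadExpConvergent A c) (j : ℕ) :
    IntegrableOn (fun x : ℝ => (x : ℂ) ^ j * cexp (A * x ^ 2 + c * x)) (Set.Ioi 0) := by
  refine Integrable.mono' (h.integrableOn_real j) (by fun_prop) ?_
  filter_upwards [ae_restrict_mem measurableSet_Ioi] with x hx
  exact (norm_pow_mul_cexp_quad A c j hx).le

theorem QuadExpConvergent.hasDerivAt {A c : ℂ} (h : QuadExpConvergent A c) (j : ℕ) :
    HasDerivAt (fun c => quadExpIntegral A c j) (quadExpIntegral A c (j + 1)) c := by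
  obtain ⟨r, hr, hc⟩ : ∃ r : ℝ, 0 < r ∧ QuadExpConvergent A (c + r) := by
    rcases h with h | ⟨h, h'⟩
    · exact ⟨1, one_pos, Or.inl h⟩
    · exact ⟨-c.re / 2, by linarith, Or.inr ⟨h, by simp; linarith⟩⟩
  unfold quadExpIntegral
  refine (hasDerivAt_integral_of_dominated_loc_of_deriv_le (Metric.ball_mem_nhds c hr)
    (F := fun c (x : ℝ) => (x : ℂ) ^ j * cexp (A * x ^ 2 + c * x))
    (F' := fun c (x : ℝ) => (x : ℂ) ^ (j + 1) * cexp (A * x ^ 2 + c * x))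
    (bound := fun x : ℝ => x ^ (j + 1) * Real.exp (A.re * x ^ 2 + (c + r).re * x))
    (.of_forall fun _ => by fun_prop) (h.integrableOn j) (by fun_prop) ?_
    (hc.integrableOn_real (j + 1)) ?_).2
  · filter_upwards [ae_restrict_mem measurableSet_Ioi] with x hx c' hc'
    have hx' : (0 : ℝ) < x := hx
    rw [norm_pow_mul_cexp_quad A c' _ hx']
    have : c'.re ≤ (c + r).re := by
      have h1 := (Complex.re_le_norm (c' - c)).trans (by
        simpa [dist_eq_norm] using (Metric.mem_ball.mp hc').le : ‖c' - c‖ ≤ r)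
      simp at h1 ⊢
      linarith
    gcongr
  · refine .of_forall fun x c' _ => ?_
    have h1 : HasDerivAt (fun c : ℂ => A * x ^ 2 + c * x) x c' := by
      simpa using ((hasDerivAt_id c').mul_const (x : ℂ)).const_add (A * x ^ 2)
    exact (h1.cexp.const_mul ((x : ℂ) ^ j)).congr_deriv (by ring)

theorem norm_quadExpIntegral_le {A c : ℂ} (hA : A.re ≤ 0) (hc : c.re < 0) :
    ‖quadExpIntegral A c 0‖ ≤ 1 / -c.re := by
  have h := integral_pow_mul_exp_neg 0 (b := -c.re) (by linarith)
  simp only [pow_zero, one_mul, Nat.factorial_zero, Nat.cast_one, zero_add, pow_one] at h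
  rw [← h]
  have hi := integrableOn_pow_mul_exp_neg 0 (b := -c.re) (by linarith)
  simp only [pow_zero, one_mul] at hi
  refine norm_integral_le_of_norm_le hi ?_
  filter_upwards [ae_restrict_mem measurableSet_Ioi] with x hx
  rw [norm_pow_mul_cexp_quad A c 0 hx, pow_zero, one_mul, Real.exp_le_exp]
  nlinarith [sq_nonneg x]

/-- Integration by parts: the integral of the derivative of `exp (A x² + c x)`. -/
theorem QuadExpConvergent.two_mul_add {A c : ℂ} (h : QuadExpConvergent A c) :
    2 * A * quadExpIntegral A c 1 + c * quadExpIntegral A c 0 = -1 := by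
  have hd : ∀ x : ℝ, HasDerivAt (fun x : ℝ => cexp (A * x ^ 2 + c * x))
      (2 * A * ((x : ℂ) ^ 1 * cexp (A * x ^ 2 + c * x)) + c * ((x : ℂ) ^ 0 *
        cexp (A * x ^ 2 + c * x))) x := fun x => by
    have h1 : HasDerivAt (fun z : ℂ => cexp (A * z ^ 2 + c * z))
        (cexp (A * x ^ 2 + c * x) * (A * (2 * x) + c * 1)) (x : ℂ) := by
      have := (((hasDerivAt_pow 2 (x : ℂ)).const_mul A).add ((hasDerivAt_id (x : ℂ)).const_mul c))
      simpa using this.cexp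
    exact h1.comp_ofReal.congr_deriv (by ring)
  have i1 := (h.integrableOn 1).const_mul (2 * A)
  have i0 := (h.integrableOn 0).const_mul c
  have hlim : Tendsto (fun x : ℝ => cexp (A * x ^ 2 + c * x)) atTop (𝓝 0) := by
    rw [Complex.tendsto_exp_nhds_zero_iff]
    have e : ∀ x : ℝ, (A * x ^ 2 + c * x).re = x * (A.re * x + c.re) := fun x => by
      simp [← ofReal_pow]; ring
    simp only [e]
    rcases h with h | ⟨h, h'⟩
    · exact tendsto_id.atTop_mul_atBot₀
        (tendsto_atBot_add_const_right _ _ (tendsto_id.const_mul_atTop_of_neg h))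
    · refine tendsto_atBot_mono' _ ?_ (tendsto_id.const_mul_atTop_of_neg h')
      filter_upwards [eventually_ge_atTop 0] with x hx
      simp only [id]
      nlinarith [sq_nonneg x]
  have := integral_Ioi_of_hasDerivAt_of_tendsto' (a := 0) (fun x _ => hd x) (i1.add i0) hlim
  rw [integral_add i1 i0, integral_const_mul, integral_const_mul] at this
  simpa [quadExpIntegral] using this

theorem quadExpIntegral_zero_left {c : ℂ} (hc : c.re < 0) (j : ℕ) :
    quadExpIntegral 0 c j = j.factorial / (-c) ^ (j + 1) := by
  induction j generalizing c with
  | zero =>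
    have := integral_exp_mul_complex_Ioi hc 0
    simp only [ofReal_zero, mul_zero, Complex.exp_zero] at this
    simp only [quadExpIntegral, pow_zero, one_mul, zero_mul, zero_add, this]
    simp [neg_div, div_neg]
  | succ j ih =>
    have hc0 : -c ≠ 0 := by rintro h; simp [neg_eq_zero.mp h] at hc
    have h1 : QuadExpConvergent 0 c := Or.inr ⟨by simp, hc⟩
    have h2 : (fun c => quadExpIntegral 0 c j) =ᶠ[𝓝 c] fun c => j.factorial / (-c) ^ (j + 1) := by
      filter_upwards [(isOpen_lt continuous_re continuous_const).mem_nhds hc] with c' hc'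
      exact ih hc'
    have h3 : HasDerivAt (fun c : ℂ => (j.factorial : ℂ) / (-c) ^ (j + 1))
        ((j + 1).factorial / (-c) ^ (j + 1 + 1)) c := by
      have := (((hasDerivAt_neg c).fun_pow (j + 1)).fun_inv (pow_ne_zero _ hc0)).const_mul (j.factorial : ℂ)
      refine this.congr_deriv ?_
      rw [Nat.factorial_succ, Nat.add_sub_cancel]
      push_cast
      field_simp
      ring
    exact ((h1.hasDerivAt j).congr_of_eventuallyEq h2.symm).unique h3

/-- The Taylor polynomial of `exp (-x)` approximates it to within the first omitted term. -/
theorem abs_exp_neg_sub_sum_le (K : ℕ) {x : ℝ} (hx : 0 ≤ x) :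
    |Real.exp (-x) - ∑ k ∈ Finset.range K, (-x) ^ k / k.factorial| ≤ x ^ K / K.factorial := by
  induction K generalizing x with
  | zero => simpa using hx
  | succ K ih =>
    have hB : ∀ y : ℝ, HasDerivAt (fun y : ℝ => y ^ (K + 1) / (K + 1).factorial)
        (y ^ K / K.factorial) y := fun y => by
      refine ((hasDerivAt_pow (K + 1) y).div_const _).congr_deriv ?_
      rw [Nat.factorial_succ]; push_cast; field_simp
    have hf : ∀ y : ℝ, HasDerivAt
        (fun y : ℝ => Real.exp (-y) - ∑ k ∈ Finset.range (K + 1), (-y) ^ k / k.factorial)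
        (-(Real.exp (-y) - ∑ k ∈ Finset.range K, (-y) ^ k / k.factorial)) y := fun y => by
      have h1 : HasDerivAt (fun y => Real.exp (-y)) (-Real.exp (-y)) y := by
        simpa using (hasDerivAt_neg y).exp
      have h2 : HasDerivAt (fun y : ℝ => ∑ k ∈ Finset.range (K + 1), (-y) ^ k / k.factorial)
          (∑ k ∈ Finset.range (K + 1), (k * (-y) ^ (k - 1) * (-1)) / k.factorial) y :=
        HasDerivAt.fun_sum fun k _ => ((hasDerivAt_neg y).fun_pow k).div_const _
      refine (h1.sub h2).congr_deriv ?_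
      rw [Finset.sum_range_succ']
      simp only [Nat.cast_zero, zero_mul, zero_div, add_zero, Nat.add_sub_cancel]
      rw [neg_sub, sub_eq_add_neg, add_comm, ← Finset.sum_neg_distrib, ← sub_eq_add_neg]
      congr 1
      refine Finset.sum_congr rfl fun k _ => ?_
      rw [Nat.factorial_succ]; push_cast; field_simp
    have := image_norm_le_of_norm_deriv_right_le_deriv_boundary (a := 0) (b := x)
      (f := fun y : ℝ => Real.exp (-y) - ∑ k ∈ Finset.range (K + 1), (-y) ^ k / k.factorial)
      (fun y _ => (hf y).continuousAt.continuousWithinAt) (fun y _ => (hf y).hasDerivWithinAt)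
      (B := fun y : ℝ => y ^ (K + 1) / (K + 1).factorial) ?_ hB
      (fun y hy => by rw [norm_neg]; exact ih hy.1) ⟨hx, le_rfl⟩
    · exact this
    · simp [Finset.sum_range_succ']

/-- Watson's lemma for `∫₀^∞ x ^ j exp (-α x² + c x) dx`, with an explicit remainder. -/
theorem norm_quadExpIntegral_sub_sum_le {α : ℝ} (hα : 0 < α) {c : ℂ} (hc : c.re < 0) (j K : ℕ) :
    ‖quadExpIntegral (-α) c j - ∑ k ∈ Finset.range K,
        (-α : ℂ) ^ k / k.factorial * quadExpIntegral 0 c (2 * k + j)‖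
      ≤ α ^ K / K.factorial * ((2 * K + j).factorial / (-c.re) ^ (2 * K + j + 1)) := by
  have h0 : QuadExpConvergent (-α) c := Or.inl (by simpa using hα)
  have h1 : QuadExpConvergent 0 c := Or.inr ⟨by simp, hc⟩
  have e : quadExpIntegral (-α) c j - ∑ k ∈ Finset.range K,
      (-α : ℂ) ^ k / k.factorial * quadExpIntegral 0 c (2 * k + j)
      = ∫ x in Set.Ioi (0 : ℝ), ((x : ℂ) ^ j * cexp (-α * x ^ 2 + c * x) -
        ∑ k ∈ Finset.range K, (-α : ℂ) ^ k / k.factorial *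
          ((x : ℂ) ^ (2 * k + j) * cexp (0 * x ^ 2 + c * x))) := by
    rw [integral_sub (h0.integrableOn j) (integrable_finsetSum _ fun k _ =>
      (h1.integrableOn _).const_mul _), integral_finsetSum _ fun k _ =>
      (h1.integrableOn _).const_mul _]
    simp only [integral_const_mul]
    rfl
  rw [e, ← integral_pow_mul_exp_neg _ (show 0 < -c.re by linarith), ← integral_const_mul]
  refine norm_integral_le_of_norm_le
    ((integrableOn_pow_mul_exp_neg _ (by linarith)).const_mul _) ?_
  filter_upwards [ae_restrict_mem measurableSet_Ioi] with x hx
  have hx' : (0 : ℝ) < x := hx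
  have e2 : (x : ℂ) ^ j * cexp (-α * x ^ 2 + c * x) -
        ∑ k ∈ Finset.range K, (-α : ℂ) ^ k / k.factorial *
          ((x : ℂ) ^ (2 * k + j) * cexp (0 * x ^ 2 + c * x))
      = (x : ℂ) ^ j * cexp (0 * x ^ 2 + c * x) * ((Real.exp (-(α * x ^ 2)) -
        ∑ k ∈ Finset.range K, (-(α * x ^ 2)) ^ k / k.factorial : ℝ) : ℂ) := by
    rw [zero_mul, zero_add, Complex.exp_add]
    push_cast
    rw [mul_sub, Finset.mul_sum]
    congr 1
    · rw [neg_mul]; ring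
    · refine Finset.sum_congr rfl fun k _ => ?_
      ring
  rw [e2, norm_mul, norm_pow_mul_cexp_quad _ _ _ hx', Complex.norm_real, Real.norm_eq_abs]
  refine (mul_le_mul_of_nonneg_left (abs_exp_neg_sub_sum_le K (by positivity))
    (by positivity)).trans (le_of_eq ?_)
  simp only [zero_re, zero_mul, zero_add]
  rw [show -(-c.re * x) = c.re * x by ring, mul_pow, pow_add]
  ring

/-! ### Rotating the line of integration of a Fresnel integral -/

/-- The primitive eighth root of unity `exp (π i / 4)`. -/
noncomputable def eighthRoot : ℂ := ((√2 / 2 : ℝ) : ℂ) * (1 + I)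

theorem eighthRoot_sq : eighthRoot ^ 2 = I := by
  have h : ((√2 / 2 : ℝ) : ℂ) ^ 2 = 1 / 2 := by
    rw [← ofReal_pow, div_pow, Real.sq_sqrt (by norm_num)]; push_cast; norm_num
  rw [eighthRoot, mul_pow, h]
  linear_combination (1 / 2 : ℂ) * I_sq

theorem eighthRoot_ne_zero : eighthRoot ≠ 0 := fun h => by
  have := eighthRoot_sq; rw [h] at this; simp [I_ne_zero.symm] at this

theorem norm_eighthRoot : ‖eighthRoot‖ = 1 := by
  have h1 : ‖eighthRoot‖ ^ 2 = 1 := by rw [← norm_pow, eighthRoot_sq, norm_I]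
  exact (pow_eq_one_iff_of_nonneg (norm_nonneg _) two_ne_zero).mp h1

theorem re_I_mul_eighthRoot_mul (ζ : ℂ) :
    (I * eighthRoot * ζ).re = -(√2 / 2) * (ζ.re + ζ.im) := by
  have : I * eighthRoot * ζ = ((√2 / 2 : ℝ) : ℂ) * (I * (1 + I) * ζ) := by
    unfold eighthRoot; ring
  rw [this, re_ofReal_mul]
  simp
  ring

/-- The integral of `z ^ j exp (i α z² + i ζ z)` over the ray from `0` through `exp (π i / 4)`. -/
noncomputable def rotatedIntegral (α : ℝ) (ζ : ℂ) (j : ℕ) : ℂ :=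
  eighthRoot ^ (j + 1) * quadExpIntegral (-α) (I * eighthRoot * ζ) j

theorem quadExpConvergent_neg {α : ℝ} (hα : 0 < α) (c : ℂ) : QuadExpConvergent (-α) c :=
  Or.inl (by simpa using hα)

theorem quadExpConvergent_I {α : ℝ} {ζ : ℂ} (hζ : 0 < ζ.im) :
    QuadExpConvergent (I * α) (I * ζ) := Or.inr ⟨by simp, by simpa using hζ⟩

theorem hasDerivAt_rotatedIntegral {α : ℝ} (hα : 0 < α) (ζ : ℂ) (j : ℕ) :
    HasDerivAt (fun ζ => rotatedIntegral α ζ j) (I * rotatedIntegral α ζ (j + 1)) ζ := by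
  have h := (quadExpConvergent_neg hα (I * eighthRoot * ζ)).hasDerivAt j
  have h2 : HasDerivAt (fun ζ : ℂ => I * eighthRoot * ζ) (I * eighthRoot) ζ := by
    simpa using (hasDerivAt_id ζ).const_mul (I * eighthRoot)
  refine ((h.comp ζ h2).const_mul (eighthRoot ^ (j + 1))).congr_deriv ?_
  unfold rotatedIntegral
  ring

theorem hasDerivAt_quadExpIntegral_I {α : ℝ} {ζ : ℂ} (hζ : 0 < ζ.im) (j : ℕ) :
    HasDerivAt (fun ζ => quadExpIntegral (I * α) (I * ζ) j)
      (I * quadExpIntegral (I * α) (I * ζ) (j + 1)) ζ := by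
  have h := (quadExpConvergent_I (α := α) hζ).hasDerivAt j
  have h2 : HasDerivAt (fun ζ : ℂ => I * ζ) I ζ := by
    simpa using (hasDerivAt_id ζ).const_mul I
  exact (h.comp ζ h2).congr_deriv (by ring)

theorem rotatedIntegral_two_mul_add {α : ℝ} (hα : 0 < α) (ζ : ℂ) :
    2 * (I * α) * rotatedIntegral α ζ 1 + I * ζ * rotatedIntegral α ζ 0 = -1 := by
  rw [← (quadExpConvergent_neg hα (I * eighthRoot * ζ)).two_mul_add]
  unfold rotatedIntegral
  have := eighthRoot_sq
  linear_combination (2 * I * α * quadExpIntegral (-α) (I * eighthRoot * ζ) 1) * this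
    + 2 * α * quadExpIntegral (-α) (I * eighthRoot * ζ) 1 * I_sq

/-- The line of integration of `exp (i α x² + i ζ x)` may be rotated by `π / 4`. Both integrals
satisfy the same first order differential equation in `ζ`, so that their difference is a multiple of
`exp (-i ζ² / 4α)`; that function grows along horizontal lines while the integrals are bounded. -/
theorem quadExpIntegral_eq_rotatedIntegral_zero {α : ℝ} (hα : 0 < α) {ζ : ℂ} (hζ : 0 < ζ.im) :
    quadExpIntegral (I * α) (I * ζ) 0 = rotatedIntegral α ζ 0 := by
  set z : ℝ → ℂ := fun ξ => ξ + ζ.im * I with hz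
  have hzim : ∀ ξ, (z ξ).im = ζ.im := fun ξ => by simp [hz]
  have hzre : ∀ ξ, (z ξ).re = ξ := fun ξ => by simp [hz]
  have hαc : (α : ℂ) ≠ 0 := by exact_mod_cast hα.ne'
  set D : ℂ → ℂ := fun w => (quadExpIntegral (I * α) (I * w) 0 - rotatedIntegral α w 0) *
    cexp (I * w ^ 2 / (4 * α)) with hD
  have hd : ∀ ξ : ℝ, HasDerivAt (fun ξ : ℝ => D (z ξ)) 0 ξ := fun ξ => by
    have him : 0 < (z ξ).im := by rw [hzim]; exact hζ
    have h1 := (hasDerivAt_quadExpIntegral_I (α := α) him 0).sub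
      (hasDerivAt_rotatedIntegral hα (z ξ) 0)
    have h2 : HasDerivAt (fun w : ℂ => cexp (I * w ^ 2 / (4 * α)))
        (cexp (I * (z ξ) ^ 2 / (4 * α)) * (I * (2 * z ξ) / (4 * α))) (z ξ) := by
      have := (((hasDerivAt_pow 2 (z ξ)).const_mul I).div_const (4 * (α : ℂ))).cexp
      simpa using this
    have h3 : HasDerivAt D 0 (z ξ) := by
      refine (h1.mul h2).congr_deriv ?_
      have o1 := (quadExpConvergent_I (α := α) him).two_mul_add
      have o2 := rotatedIntegral_two_mul_add hα (z ξ)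
      simp only [zero_add] at *
      set a := quadExpIntegral (I * α) (I * z ξ) 1
      set b := quadExpIntegral (I * α) (I * z ξ) 0
      set a' := rotatedIntegral α (z ξ) 1
      set b' := rotatedIntegral α (z ξ) 0
      have : (I * a - I * a') + (b - b') * (I * (2 * z ξ) / (4 * α)) = 0 := by
        field_simp
        linear_combination 2 * (o1 - o2)
      simp only [Pi.sub_apply]
      linear_combination cexp (I * (z ξ) ^ 2 / (4 * α)) * this
    have h4 : HasDerivAt z 1 ξ := by
      exact (hasDerivAt_id ξ).ofReal_comp.add_const ((ζ.im : ℂ) * I)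
    exact (h3.scomp ξ h4).congr_deriv (by simp)
  have hconst : ∀ ξ : ℝ, D (z ξ) = D (z ζ.re) := fun ξ =>
    is_const_of_deriv_eq_zero (fun x => (hd x).differentiableAt) (fun x => (hd x).deriv) ξ ζ.re
  have hs2 : 0 < √2 / 2 := by positivity
  have hlim : Tendsto (fun ξ : ℝ => D (z ξ)) atTop (𝓝 0) := by
    have hb : Tendsto (fun ξ : ℝ => (1 / ζ.im + 1 / (√2 / 2 * ζ.im)) *
        Real.exp (-(ζ.im / (2 * α)) * ξ)) atTop (𝓝 0) := by
      have := (Real.tendsto_exp_atBot.comp (tendsto_id.const_mul_atTop_of_neg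
        (show -(ζ.im / (2 * α)) < 0 from neg_lt_zero.mpr (by positivity)))).const_mul
          (1 / ζ.im + 1 / (√2 / 2 * ζ.im))
      simpa using this
    refine squeeze_zero_norm' ?_ hb
    filter_upwards [eventually_ge_atTop 0] with ξ hξ
    have him : 0 < (z ξ).im := by rw [hzim]; exact hζ
    rw [hD, norm_mul]
    refine mul_le_mul ((norm_sub_le _ _).trans (add_le_add ?_ ?_)) (le_of_eq ?_)
      (norm_nonneg _) (by positivity)
    · have := norm_quadExpIntegral_le (A := I * α) (c := I * z ξ) (by simp) (by simpa using him)
      simpa [hzim] using this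
    · have hre := re_I_mul_eighthRoot_mul (z ξ)
      rw [hzim, hzre] at hre
      have hpos : √2 / 2 * ζ.im ≤ -(I * eighthRoot * z ξ).re := by rw [hre]; nlinarith
      have := norm_quadExpIntegral_le (A := -α) (c := I * eighthRoot * z ξ)
        (by simpa using hα.le) (by nlinarith)
      rw [rotatedIntegral, norm_mul, norm_pow, norm_eighthRoot, one_pow, one_mul]
      exact this.trans (one_div_le_one_div_of_le (by positivity) hpos)
    · rw [Complex.norm_exp]
      congr 1
      have : I * z ξ ^ 2 / (4 * α) = ((1 / (4 * α) : ℝ) : ℂ) * (I * z ξ ^ 2) := by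
        push_cast; ring
      rw [this, re_ofReal_mul, I_mul_re, sq, mul_im, hzim, hzre]
      field_simp
      ring
  have h0 : D (z ζ.re) = 0 :=
    tendsto_nhds_unique (tendsto_const_nhds.congr fun ξ => (hconst ξ).symm) hlim
  have hzζ : z ζ.re = ζ := by simp [hz]
  rw [hzζ] at h0
  exact sub_eq_zero.mp ((mul_eq_zero.mp h0).resolve_right (Complex.exp_ne_zero _))

theorem quadExpIntegral_eq_rotatedIntegral {α : ℝ} (hα : 0 < α) {ζ : ℂ} (hζ : 0 < ζ.im) (j : ℕ) :
    quadExpIntegral (I * α) (I * ζ) j = rotatedIntegral α ζ j := by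
  induction j generalizing ζ with
  | zero => exact quadExpIntegral_eq_rotatedIntegral_zero hα hζ
  | succ j ih =>
    have h2 : (fun ζ => quadExpIntegral (I * α) (I * ζ) j) =ᶠ[𝓝 ζ]
        fun ζ => rotatedIntegral α ζ j := by
      filter_upwards [(isOpen_lt continuous_const continuous_im).mem_nhds hζ] with w hw
      exact ih hw
    have := (hasDerivAt_quadExpIntegral_I hζ j).unique
      ((hasDerivAt_rotatedIntegral hα ζ j).congr_of_eventuallyEq h2)
    exact mul_left_cancel₀ I_ne_zero this

/-- The contribution of the stationary point: the integral over the whole rotated line. -/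
noncomputable def stationaryTerm (α : ℝ) (ζ : ℂ) (j : ℕ) : ℂ :=
  eighthRoot * (√(Real.pi / α) : ℝ) * (-ζ / (2 * α)) ^ j * cexp (-I * ζ ^ 2 / (4 * α))

theorem rotatedIntegral_add_neg_zero {α : ℝ} (hα : 0 < α) (ζ : ℂ) :
    rotatedIntegral α ζ 0 + rotatedIntegral α (-ζ) 0 = stationaryTerm α ζ 0 := by
  set c := I * eighthRoot * ζ with hc
  have hi : Integrable fun x : ℝ => cexp (-α * x ^ 2 + c * x) := by
    simpa using integrable_cexp_quadratic' (b := -α) (by simpa using hα) c 0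
  have h1 : ∫ x : ℝ, cexp (-α * x ^ 2 + c * x)
      = (√(Real.pi / α) : ℝ) * cexp (-I * ζ ^ 2 / (4 * α)) := by
    have := integral_cexp_quadratic (b := -α) (by simpa using hα) c 0
    simp only [add_zero, neg_neg, zero_sub] at this
    rw [this]
    congr 1
    · rw [← ofReal_div, Real.sqrt_eq_rpow, ofReal_cpow (by positivity)]
      norm_num
    · congr 1
      rw [hc, mul_pow, mul_pow, eighthRoot_sq, I_sq]
      ring
  have h2 : ∫ x : ℝ, cexp (-α * x ^ 2 + c * x)
      = quadExpIntegral (-α) (-c) 0 + quadExpIntegral (-α) c 0 := by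
    rw [← intervalIntegral.integral_Iic_add_Ioi (b := 0) hi.integrableOn hi.integrableOn]
    congr 1
    · rw [quadExpIntegral, ← neg_zero, ← integral_comp_neg_Ioi, neg_zero]
      refine setIntegral_congr_fun measurableSet_Ioi fun x _ => ?_
      simp
    · simp [quadExpIntegral]
  simp only [rotatedIntegral, stationaryTerm, zero_add, pow_one, pow_zero, mul_one, mul_neg, ← hc]
  rw [← mul_add, mul_assoc, ← h1, h2]
  ring

theorem rotatedIntegral_add_neg {α : ℝ} (hα : 0 < α) (ζ : ℂ) {j : ℕ} (hj : j ≤ 1) :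
    rotatedIntegral α ζ j + (-1) ^ j * rotatedIntegral α (-ζ) j = stationaryTerm α ζ j := by
  interval_cases j
  · simpa using rotatedIntegral_add_neg_zero hα ζ
  · have hαc : (α : ℂ) ≠ 0 := by exact_mod_cast hα.ne'
    have h1 := (hasDerivAt_rotatedIntegral hα ζ 0).add
      ((hasDerivAt_rotatedIntegral hα (-ζ) 0).comp ζ (hasDerivAt_neg ζ))
    have h2 : HasDerivAt (fun ζ => stationaryTerm α ζ 0)
        (eighthRoot * (√(Real.pi / α) : ℝ) * (cexp (-I * ζ ^ 2 / (4 * α)) *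
          (-I * (2 * ζ) / (4 * α)))) ζ := by
      have := ((((hasDerivAt_pow 2 ζ).const_mul (-I)).div_const (4 * (α : ℂ))).cexp).const_mul
        (eighthRoot * (√(Real.pi / α) : ℝ))
      simpa [stationaryTerm] using this
    have h3 := h1.unique (h2.congr_of_eventuallyEq
      (.of_forall fun w => rotatedIntegral_add_neg_zero hα w))
    refine mul_left_cancel₀ I_ne_zero (Eq.trans ?_ (h3.trans ?_))
    · ring
    · simp only [stationaryTerm, pow_one]
      field_simp
      ring

/-- The rotated integral with the factor `exp (i α z²)` replaced by `exp (i α z²) - 1`. -/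
noncomputable def rotatedRemainder (α : ℝ) (ζ : ℂ) (j : ℕ) : ℂ :=
  eighthRoot ^ (j + 1) * (quadExpIntegral (-α) (I * eighthRoot * ζ) j -
    quadExpIntegral 0 (I * eighthRoot * ζ) j)

theorem eighthRoot_pow_mul_quadExpIntegral_zero {ζ : ℂ} (hζ : 0 < ζ.re + ζ.im) (j : ℕ) :
    eighthRoot ^ (j + 1) * quadExpIntegral 0 (I * eighthRoot * ζ) j
      = j.factorial * (I / ζ) ^ (j + 1) := by
  have hs2 : 0 < √2 / 2 := by positivity
  have hζ0 : ζ ≠ 0 := by rintro rfl; simp at hζ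
  have := eighthRoot_ne_zero
  rw [quadExpIntegral_zero_left (by rw [re_I_mul_eighthRoot_mul]; nlinarith), mul_div_left_comm,
    ← div_pow]
  congr 2
  field_simp
  rw [I_sq]

theorem quadExpIntegral_zero_I {ζ : ℂ} (hζ : 0 < ζ.im) (j : ℕ) :
    quadExpIntegral 0 (I * ζ) j = j.factorial * (I / ζ) ^ (j + 1) := by
  have hζ0 : ζ ≠ 0 := by rintro rfl; simp at hζ
  rw [quadExpIntegral_zero_left (by simpa using hζ), div_eq_mul_inv, ← inv_pow]
  congr 2
  field_simp
  rw [I_sq]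

/-- The half-line Fourier integral of `x ^ j (exp (i α x²) - 1)`. -/
noncomputable def fresnelRemainder (α : ℝ) (ζ : ℂ) (j : ℕ) : ℂ :=
  quadExpIntegral (I * α) (I * ζ) j - quadExpIntegral 0 (I * ζ) j

theorem fresnelRemainder_of_pos {α : ℝ} (hα : 0 < α) {ζ : ℂ} (hζ : 0 < ζ.im)
    (hζ' : 0 < ζ.re + ζ.im) (j : ℕ) : fresnelRemainder α ζ j = rotatedRemainder α ζ j := by
  rw [fresnelRemainder, rotatedRemainder, mul_sub, eighthRoot_pow_mul_quadExpIntegral_zero hζ',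
    quadExpIntegral_zero_I hζ, quadExpIntegral_eq_rotatedIntegral hα hζ, rotatedIntegral]

theorem fresnelRemainder_of_neg {α : ℝ} (hα : 0 < α) {ζ : ℂ} (hζ : 0 < ζ.im)
    (hζ' : ζ.re + ζ.im < 0) {j : ℕ} (hj : j ≤ 1) : fresnelRemainder α ζ j
      = stationaryTerm α ζ j + (-1) ^ (j + 1) * rotatedRemainder α (-ζ) j := by
  have h1 := rotatedIntegral_add_neg hα ζ hj
  rw [fresnelRemainder, rotatedRemainder, mul_sub, eighthRoot_pow_mul_quadExpIntegral_zero
    (by simp; linarith), quadExpIntegral_zero_I hζ, quadExpIntegral_eq_rotatedIntegral hα hζ,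
    ← h1, rotatedIntegral]
  rw [div_neg, neg_pow (I / ζ)]
  have : ((-1 : ℂ) ^ (j + 1)) * (-1) ^ (j + 1) = 1 := by rw [← mul_pow]; simp
  simp only [rotatedIntegral]
  linear_combination (j.factorial * (I / ζ) ^ (j + 1)) * this

/-- The Taylor expansion of `rotatedRemainder` in powers of `α`. -/
theorem norm_rotatedRemainder_sub_sum_le {α : ℝ} (hα : 0 < α) {ζ : ℂ} {r : ℝ} (hr : 0 < r)
    (hζ : 2 * r ≤ ζ.re + ζ.im) (j K : ℕ) :
    ‖rotatedRemainder α ζ j - ∑ k ∈ Finset.range K, (I * α) ^ (k + 1) / (k + 1).factorial *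
        ((-1) ^ (k + 1) * (2 * (k + 1) + j).factorial * I ^ (j + 1) / ζ ^ (2 * (k + 1) + j + 1))‖
      ≤ α ^ (K + 1) / (K + 1).factorial *
        ((2 * (K + 1) + j).factorial / r ^ (2 * (K + 1) + j + 1)) := by
  have hre := re_I_mul_eighthRoot_mul ζ
  have hs2 : 1 ≤ √2 := by rw [Real.one_le_sqrt]; norm_num
  have hr' : r ≤ -(I * eighthRoot * ζ).re := by rw [hre]; nlinarith
  have hζpos : 0 < ζ.re + ζ.im := by linarith
  have hζ0 : ζ ≠ 0 := by rintro rfl; simp at hζpos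
  have h := norm_quadExpIntegral_sub_sum_le hα (c := I * eighthRoot * ζ) (by linarith) j (K + 1)
  have e : rotatedRemainder α ζ j - ∑ k ∈ Finset.range K, (I * α) ^ (k + 1) / (k + 1).factorial *
        ((-1) ^ (k + 1) * (2 * (k + 1) + j).factorial * I ^ (j + 1) / ζ ^ (2 * (k + 1) + j + 1))
      = eighthRoot ^ (j + 1) * (quadExpIntegral (-α) (I * eighthRoot * ζ) j -
        ∑ k ∈ Finset.range (K + 1), (-α : ℂ) ^ k / k.factorial *
          quadExpIntegral 0 (I * eighthRoot * ζ) (2 * k + j)) := by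
    rw [Finset.sum_range_succ', rotatedRemainder]
    simp only [mul_zero, zero_add, pow_zero, Nat.factorial_zero, Nat.cast_one, div_one, one_mul]
    rw [← sub_sub, sub_right_comm, mul_sub _ (_ - _), Finset.mul_sum]
    congr 1
    refine Finset.sum_congr rfl fun k _ => ?_
    have h1 := eighthRoot_pow_mul_quadExpIntegral_zero hζpos (2 * (k + 1) + j)
    have h2 : eighthRoot ^ (2 * (k + 1) + j + 1) = I ^ (k + 1) * eighthRoot ^ (j + 1) := by
      rw [show 2 * (k + 1) + j + 1 = 2 * (k + 1) + (j + 1) by ring, pow_add, pow_mul, eighthRoot_sq]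
    have h3 : I ^ (2 * (k + 1) + j + 1) = (-1) ^ (k + 1) * I ^ (j + 1) := by
      rw [show 2 * (k + 1) + j + 1 = 2 * (k + 1) + (j + 1) by ring, pow_add, pow_mul, I_sq]
    have h4 : (I : ℂ) ^ (k + 1) * I ^ (k + 1) = (-1) ^ (k + 1) := by rw [← mul_pow, I_mul_I]
    rw [h2, div_pow, h3] at h1
    have h5 : (I : ℂ) ^ (k + 1) ≠ 0 := pow_ne_zero _ I_ne_zero
    refine mul_left_cancel₀ h5 ?_
    rw [show I ^ (k + 1) * (eighthRoot ^ (j + 1) * ((-α : ℂ) ^ (k + 1) / (k + 1).factorial *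
      quadExpIntegral 0 (I * eighthRoot * ζ) (2 * (k + 1) + j)))
      = (-α : ℂ) ^ (k + 1) / (k + 1).factorial * (I ^ (k + 1) * eighthRoot ^ (j + 1) *
      quadExpIntegral 0 (I * eighthRoot * ζ) (2 * (k + 1) + j)) by ring, h1, mul_pow, neg_pow]
    linear_combination ((α : ℂ) ^ (k + 1) / (k + 1).factorial *
        ((-1) ^ (k + 1) * (2 * (k + 1) + j).factorial * I ^ (j + 1) / ζ ^ (2 * (k + 1) + j + 1)))
        * h4
  rw [e, norm_mul, norm_pow, norm_eighthRoot, one_pow, one_mul]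
  refine h.trans ?_
  gcongr

/-! ### Poisson summation for damped Fresnel weights -/

/-- The function `x ^ j exp (-δ x) (exp (i α x²) - 1)` on `x ≥ 0`, extended by zero. -/
noncomputable def fresnelWeight (α δ : ℝ) (j : ℕ) (x : ℝ) : ℂ :=
  ((max x 0 : ℝ) : ℂ) ^ j * (Real.exp (-(δ * max x 0)) : ℂ) *
    (cexp (I * α * ((max x 0 : ℝ) : ℂ) ^ 2) - 1)

theorem fresnelWeight_of_nonpos (α δ : ℝ) (j : ℕ) {x : ℝ} (hx : x ≤ 0) :
    fresnelWeight α δ j x = 0 := by simp [fresnelWeight, max_eq_right hx]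

theorem fresnelWeight_of_nonneg (α δ : ℝ) (j : ℕ) {x : ℝ} (hx : 0 ≤ x) :
    fresnelWeight α δ j x = (x : ℂ) ^ j * (Real.exp (-(δ * x)) : ℂ) *
      (cexp (I * α * (x : ℂ) ^ 2) - 1) := by simp only [fresnelWeight, max_eq_left hx]

theorem continuous_fresnelWeight (α δ : ℝ) (j : ℕ) : Continuous (fresnelWeight α δ j) := by
  unfold fresnelWeight
  fun_prop

theorem norm_fresnelWeight_le (α δ : ℝ) (j : ℕ) {x : ℝ} (hx : 0 ≤ x) :
    ‖fresnelWeight α δ j x‖ ≤ 2 * (x ^ j * Real.exp (-(δ * x))) := by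
  rw [fresnelWeight_of_nonneg α δ j hx, norm_mul, norm_mul, norm_pow, Complex.norm_real,
    Complex.norm_real, Real.norm_of_nonneg hx, Real.norm_of_nonneg (Real.exp_pos _).le, mul_comm]
  refine mul_le_mul_of_nonneg_right ((norm_sub_le _ _).trans ?_) (by positivity)
  rw [Complex.norm_exp, norm_one, show I * α * (x : ℂ) ^ 2 = ((α * x ^ 2 : ℝ) : ℂ) * I by
    push_cast; ring, re_ofReal_mul, I_re, mul_zero, Real.exp_zero]
  norm_num

theorem isBigO_fresnelWeight (α : ℝ) {δ : ℝ} (hδ : 0 < δ) (j : ℕ) :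
    fresnelWeight α δ j =O[cocompact ℝ] (|·| ^ (-2 : ℝ)) := by
  refine IsBigO.of_bound (2 * ((j + 2).factorial / δ ^ (j + 2))) ?_
  filter_upwards [(isCompact_singleton (x := (0 : ℝ))).compl_mem_cocompact] with x hx
  have hx0 : x ≠ 0 := hx
  rw [Real.norm_of_nonneg (by positivity)]
  rcases le_total x 0 with h | h
  · rw [fresnelWeight_of_nonpos α δ j h, norm_zero]; positivity
  · have hx' : 0 < x := lt_of_le_of_ne h hx0.symm
    refine (norm_fresnelWeight_le α δ j h).trans ?_
    rw [mul_assoc, abs_of_pos hx', Real.rpow_neg hx'.le, Real.rpow_two]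
    refine mul_le_mul_of_nonneg_left ?_ zero_le_two
    have h1 := Real.pow_div_factorial_le_exp (δ * x) (by positivity) (j + 2)
    have h2 : Real.exp (-(δ * x)) * Real.exp (δ * x) = 1 := by rw [← Real.exp_add]; simp
    rw [div_le_iff₀ (by positivity), mul_pow] at h1
    rw [← div_eq_mul_inv, le_div_iff₀ (by positivity), le_div_iff₀ (by positivity)]
    calc x ^ j * Real.exp (-(δ * x)) * x ^ 2 * δ ^ (j + 2)
        = (δ ^ (j + 2) * x ^ (j + 2)) * Real.exp (-(δ * x)) := by ring
      _ ≤ (Real.exp (δ * x) * (j + 2).factorial) * Real.exp (-(δ * x)) :=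
        mul_le_mul_of_nonneg_right h1 (Real.exp_pos _).le
      _ = _ := by linear_combination ((j + 2).factorial : ℝ) * h2

theorem integral_exp_smul_fresnelWeight (α : ℝ) {δ : ℝ} (hδ : 0 < δ) (j : ℕ) (ξ : ℝ) :
    ∫ x : ℝ, cexp ((ξ * x : ℝ) * I) • fresnelWeight α δ j x
      = fresnelRemainder α (ξ + δ * I) j := by
  have him : 0 < ((ξ : ℂ) + δ * I).im := by simpa using hδ
  have h1 : QuadExpConvergent (I * α) (I * (ξ + δ * I)) := quadExpConvergent_I him
  have h2 : QuadExpConvergent 0 (I * (ξ + δ * I)) := Or.inr ⟨by simp, by simpa using hδ⟩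
  rw [← setIntegral_eq_integral_of_forall_compl_eq_zero (s := Set.Ioi 0) fun x hx => by
    rw [fresnelWeight_of_nonpos α δ j (not_lt.mp hx), smul_zero], fresnelRemainder,
    quadExpIntegral, quadExpIntegral, ← integral_sub (h1.integrableOn j) (h2.integrableOn j)]
  refine setIntegral_congr_fun measurableSet_Ioi fun x hx => ?_
  have e : cexp (I * (ξ + δ * I) * x) = cexp ((ξ * x : ℝ) * I) * (Real.exp (-(δ * x)) : ℂ) := by
    rw [ofReal_exp, ← Complex.exp_add]
    congr 1
    push_cast
    linear_combination (δ * x : ℂ) * I_sq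
  simp only [fresnelWeight_of_nonneg α δ j (le_of_lt hx), smul_eq_mul, zero_mul, zero_add,
    Complex.exp_add, e]
  ring

theorem fourier_fresnelWeight_comp_mul (α : ℝ) {δ : ℝ} (hδ : 0 < δ) (j : ℕ) {T : ℝ} (hT : 0 < T)
    (m : ℝ) : FourierTransform.fourier (fun y : ℝ => fresnelWeight α δ j (T * y)) m
      = (T : ℂ)⁻¹ * fresnelRemainder α (-(2 * Real.pi * m / T : ℝ) + δ * I) j := by
  rw [Real.fourier_real_eq_integral_exp_smul, ← ofReal_neg,
    ← integral_exp_smul_fresnelWeight α hδ j]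
  have := Measure.integral_comp_mul_left (fun x : ℝ =>
    cexp ((-(2 * Real.pi * m / T) * x : ℝ) * I) • fresnelWeight α δ j x) T
  rw [abs_of_pos (inv_pos.mpr hT)] at this
  rw [← ofReal_inv, ← Complex.real_smul, ← this]
  refine integral_congr_ae (.of_forall fun y => ?_)
  simp only
  congr 4
  field_simp

theorem norm_rotatedRemainder_le {α : ℝ} (hα : 0 < α) {ζ : ℂ} {r : ℝ} (hr : 0 < r)
    (hζ : 2 * r ≤ ζ.re + ζ.im) (j : ℕ) :
    ‖rotatedRemainder α ζ j‖ ≤ α * (2 + j).factorial / r ^ (j + 3) := by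
  have := norm_rotatedRemainder_sub_sum_le hα hr hζ j 0
  simp only [Finset.range_zero, Finset.sum_empty, sub_zero, zero_add, pow_one,
    Nat.factorial_one, Nat.cast_one, div_one, mul_one] at this
  rw [mul_div_assoc, show j + 3 = 2 + j + 1 by ring]
  exact this

/-- The frequency `2 π m / T`. -/
noncomputable def freq (T : ℕ) (m : ℝ) : ℝ := 2 * Real.pi * m / T

theorem norm_rotatedRemainder_freq_le {α : ℝ} (hα : 0 < α) {T : ℕ} (hT : 0 < T) {δ : ℝ}
    (hδ : |δ| ≤ Real.pi / T) (j : ℕ) {n : ℕ} (hn : 0 < n) :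
    ‖rotatedRemainder α (freq T n + δ * I) j‖
      ≤ α * (2 + j).factorial / (Real.pi / (2 * T)) ^ (j + 3) * ((n : ℝ) ^ 2)⁻¹ := by
  have hT' : (0 : ℝ) < T := by exact_mod_cast hT
  have hn1 : (1 : ℝ) ≤ n := by exact_mod_cast hn
  have hpi := Real.pi_pos
  have h := norm_rotatedRemainder_le hα (ζ := freq T n + δ * I) (r := Real.pi / (2 * T) * n)
    (by positivity) (by
      have h1 : -(Real.pi / T) ≤ δ := (abs_le.mp hδ).1
      have h2 : Real.pi / T ≤ Real.pi / T * n := le_mul_of_one_le_right (by positivity) hn1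
      have h3 : 2 * (Real.pi / (2 * T) * n) = Real.pi / T * n := by field_simp
      have h4 : freq T n = 2 * (Real.pi / T * n) := by rw [freq]; ring
      simp [h3, h4]
      linarith) j
  refine h.trans ?_
  rw [mul_pow, ← div_div, div_eq_mul_inv _ ((n : ℝ) ^ (j + 3))]
  refine mul_le_mul_of_nonneg_left ?_ (by positivity)
  exact inv_anti₀ (by positivity) (pow_le_pow_right₀ hn1 (by omega))

theorem stationaryTerm_freq {α : ℝ} {T : ℕ} (hT : 0 < T) (δ : ℝ) (j n : ℕ) :
    stationaryTerm α (-freq T n + δ * I) j = eighthRoot * (√(Real.pi / α) : ℝ) *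
      cexp (I * δ ^ 2 / (4 * α)) * (cexp (-I * freq T n ^ 2 / (4 * α)) *
      ((freq T 1 * n - δ * I) / (2 * α)) ^ j *
      (Real.exp (-(freq T 1 * δ / (2 * α) * n)) : ℂ)) := by
  have hT' : (T : ℂ) ≠ 0 := by exact_mod_cast hT.ne'
  have h1 : (freq T n : ℂ) = freq T 1 * n := by simp [freq]; ring
  have e : cexp (-I * (-freq T n + δ * I) ^ 2 / (4 * α)) = cexp (I * δ ^ 2 / (4 * α)) *
      cexp (-I * freq T n ^ 2 / (4 * α)) * (Real.exp (-(freq T 1 * δ / (2 * α) * n)) : ℂ) := by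
    rw [ofReal_exp, ← Complex.exp_add, ← Complex.exp_add]
    congr 1
    push_cast
    rw [h1]
    have : (I : ℂ) ^ 3 = -I := by rw [pow_succ, I_sq]; ring
    linear_combination (2 * freq T 1 * n * δ / (4 * α) : ℂ) * I_sq - (δ ^ 2 / (4 * α) : ℂ) * this
  rw [stationaryTerm, e, h1]
  ring

theorem summable_mul_exp_neg {C : ℕ → ℂ} {B : ℝ} (hB : ∀ n, ‖C n‖ ≤ B) (j : ℕ) {ε : ℝ}
    (hε : 0 < ε) : Summable fun n : ℕ => C n * n ^ j * (Real.exp (-(ε * n)) : ℂ) := by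
  have := summable_mul_of_norm_le hB (g := fun n : ℕ => (n : ℂ) ^ j * (Real.exp (-(ε * n)) : ℂ))
    ((summable_pow_mul_exp_neg j hε).congr fun n => by
      rw [norm_mul, norm_pow, Complex.norm_natCast, Complex.norm_real,
        Real.norm_of_nonneg (Real.exp_pos _).le])
  exact this.congr fun n => by ring

/-! ### Reciprocity between Fresnel sums -/

theorem dft_intCast_eq_sum {T : ℕ} [NeZero T] (f : ZMod T → ℂ) (m : ℤ) :
    ZMod.dft f m = ∑ x : ZMod T, f x * cexp (-(2 * Real.pi * I * m * x.val / T)) := by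
  rw [ZMod.dft_apply]
  refine Finset.sum_congr rfl fun x _ => ?_
  have : -(x * (m : ZMod T)) = ((-(x.val * m) : ℤ) : ZMod T) := by simp
  rw [this, ZMod.stdAddChar_coe, smul_eq_mul, mul_comm]
  congr 2
  push_cast
  ring

theorem pow_sub_div_eq {j : ℕ} (hj : j ≤ 1) (a b c x : ℂ) :
    ((a * x - b) / c) ^ j = (a / c) ^ j * x ^ j - j * (b / c) := by
  interval_cases j
  · simp
  · simp; ring

theorem norm_cexp_neg_I_mul_freq (α : ℝ) (T : ℕ) (x : ℝ) :
    ‖cexp (-I * freq T x ^ 2 / (4 * α))‖ = 1 := by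
  rw [show -I * freq T x ^ 2 / (4 * α) = ((-(freq T x ^ 2 / (4 * α)) : ℝ) : ℂ) * I by
    push_cast; ring, Complex.norm_exp_ofReal_mul_I]

/-- The sum of the stationary terms is a combination of exponentially damped sums. -/
theorem hasSum_mul_stationaryTerm {α : ℝ} (hα : 0 < α) {T : ℕ} (hT : 0 < T) {δ : ℝ} (hδ : 0 < δ)
    {j : ℕ} (hj : j ≤ 1) {C : ℕ → ℂ} {B : ℝ} (hC : ∀ n, ‖C n‖ ≤ B) :
    HasSum (fun n : ℕ => C n * stationaryTerm α (-freq T n + δ * I) j)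
      (eighthRoot * (√(Real.pi / α) : ℝ) * cexp (I * δ ^ 2 / (4 * α)) *
        ((freq T 1 / (2 * α)) ^ j * ∑' n : ℕ, C n * cexp (-I * freq T n ^ 2 / (4 * α)) * n ^ j *
            (Real.exp (-(freq T 1 * δ / (2 * α) * n)) : ℂ)
          - j * (δ * I / (2 * α)) * ∑' n : ℕ, C n * cexp (-I * freq T n ^ 2 / (4 * α)) *
            (Real.exp (-(freq T 1 * δ / (2 * α) * n)) : ℂ))) := by
  have hT' : (0 : ℝ) < T := by exact_mod_cast hT
  have hε : 0 < freq T 1 * δ / (2 * α) := by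
    have : 0 < freq T 1 := by unfold freq; have := Real.pi_pos; positivity
    positivity
  have hg : ∀ n : ℕ, ‖C n * cexp (-I * freq T n ^ 2 / (4 * α))‖ ≤ B := fun n => by
    rw [norm_mul, norm_cexp_neg_I_mul_freq, mul_one]; exact hC n
  have s0 := (summable_mul_exp_neg hg 0 hε).hasSum.mul_left (j * (δ * I / (2 * α)))
  have s1 := (summable_mul_exp_neg hg j hε).hasSum.mul_left ((freq T 1 / (2 * α) : ℂ) ^ j)
  simp only [pow_zero, mul_one] at s0
  convert! (s1.sub s0).mul_left (eighthRoot * (√(Real.pi / α) : ℝ) *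
    cexp (I * δ ^ 2 / (4 * α))) using 1
  funext n
  rw [stationaryTerm_freq hT, pow_sub_div_eq hj]
  ring

theorem summable_fresnelRemainder_freq {α : ℝ} (hα : 0 < α) {T : ℕ} (hT : 0 < T) {δ : ℝ}
    (hδ : 0 < δ) (hδT : δ ≤ Real.pi / T) {j : ℕ} (hj : j ≤ 1) :
    Summable fun m : ℤ => fresnelRemainder α (freq T m + δ * I) j := by
  have hT' : (0 : ℝ) < T := by exact_mod_cast hT
  have hpi := Real.pi_pos
  have hfreq : ∀ n : ℕ, δ < freq T (n + 1) := fun n => by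
    refine hδT.trans_lt ?_
    unfold freq
    gcongr
    nlinarith [(Nat.cast_nonneg n : (0 : ℝ) ≤ n)]
  have hsq : Summable fun n : ℕ => (((n + 1 : ℕ) : ℝ) ^ 2)⁻¹ :=
    (summable_nat_add_iff 1).mpr (Real.summable_nat_pow_inv.mpr one_lt_two)
  have hK : ∀ δ' : ℝ, |δ'| ≤ Real.pi / T →
      Summable fun n : ℕ => rotatedRemainder α (freq T (n + 1 : ℕ) + δ' * I) j := fun δ' hδ' =>
    Summable.of_norm_bounded (hsq.mul_left _) fun n =>
      norm_rotatedRemainder_freq_le hα hT hδ' j n.succ_pos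
  refine Summable.of_nat_of_neg_add_one ?_ ?_
  · refine (summable_nat_add_iff 1).mp ((hK δ (by rwa [abs_of_pos hδ])).congr fun n => ?_)
    have := hfreq n
    rw [fresnelRemainder_of_pos hα (by simpa using hδ) (by simp; linarith)]
    simp
  · have h1 := (summable_nat_add_iff 1).mpr
      (hasSum_mul_stationaryTerm hα hT hδ hj (C := fun _ => 1) (B := 1) (by simp)).summable
    have h2 := (hK (-δ) (by rwa [abs_neg, abs_of_pos hδ])).mul_left ((-1) ^ (j + 1))
    refine (h1.add h2).congr fun n => ?_
    have := hfreq n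
    have e : ((freq T ((-((n : ℤ) + 1) : ℤ) : ℝ) : ℝ) : ℂ) = -freq T (n + 1 : ℕ) := by
      simp [freq]; ring
    rw [e, fresnelRemainder_of_neg hα (by simpa using hδ) (by simp; linarith) hj, one_mul]
    congr 3
    push_cast
    ring

/-- Poisson summation for a periodic function against the damped Fresnel weight. -/
theorem tsum_mul_fresnelWeight {α : ℝ} (hα : 0 < α) {T : ℕ} [NeZero T] {δ : ℝ}
    (hδ : 0 < δ) (hδT : δ ≤ Real.pi / T) {j : ℕ} (hj : j ≤ 1) (f : ZMod T → ℂ) :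
    ∑' n : ℕ, f n * fresnelWeight α δ j n
      = (T : ℂ)⁻¹ * ∑' m : ℤ, ZMod.dft f m * fresnelRemainder α (freq T m + δ * I) j := by
  have hT : 0 < T := NeZero.pos T
  have hT' : (0 : ℝ) < T := by exact_mod_cast hT
  obtain ⟨B, hB0, hB⟩ := exists_norm_le_zmod f
  have hsum : Summable fun n : ℕ => f n * fresnelWeight α δ j n := by
    refine Summable.of_norm_bounded (((summable_pow_mul_exp_neg j hδ).mul_left 2).mul_left B)
      fun n => ?_
    rw [norm_mul]
    exact mul_le_mul (hB _) (norm_fresnelWeight_le α δ j (Nat.cast_nonneg n)) (norm_nonneg _) hB0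
  have hfr := summable_fresnelRemainder_freq hα hT hδ hδT hj
  have hfr' : Summable fun m : ℤ => fresnelRemainder α (-freq T m + δ * I) j := by
    refine ((Equiv.neg ℤ).summable_iff.mpr hfr).congr fun m => ?_
    simp [freq]; ring_nf
  have hF : ∀ m : ℤ, FourierTransform.fourier (fun y : ℝ => fresnelWeight α δ j (T * y)) m
      = (T : ℂ)⁻¹ * fresnelRemainder α (-freq T m + δ * I) j := fun m => by
    rw [fourier_fresnelWeight_comp_mul α hδ j hT' m]
    simp [freq]
  -- the sum over one residue class
  have hres : ∀ x : ZMod T, ∑' k : ℕ, f (x.val + T * k : ℕ) *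
      fresnelWeight α δ j (x.val + T * k : ℕ) = ∑' m : ℤ, f x * ((T : ℂ)⁻¹ *
        fresnelRemainder α (-freq T m + δ * I) j * cexp (2 * Real.pi * I * m * x.val / T)) := by
    intro x
    have e1 : ∀ k : ℕ, f (x.val + T * k : ℕ) = f x := fun k => by simp
    simp only [e1]
    rw [tsum_mul_left, tsum_mul_left]
    congr 1
    have hc : Continuous fun y : ℝ => fresnelWeight α δ j (T * y) :=
      (continuous_fresnelWeight α δ j).comp (continuous_const.mul continuous_id)
    have hO : (fun y : ℝ => fresnelWeight α δ j (T * y)) =O[cocompact ℝ] (|·| ^ (-2 : ℝ)) := by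
      have h1 : Tendsto (fun y : ℝ => (T : ℝ) * y) (cocompact ℝ) (cocompact ℝ) :=
        (Homeomorph.mulLeft₀ (T : ℝ) hT'.ne').isClosedEmbedding.tendsto_cocompact
      refine ((isBigO_fresnelWeight α hδ j).comp_tendsto h1).trans ?_
      refine IsBigO.of_bound (|(T : ℝ)| ^ (-2 : ℝ)) (.of_forall fun y => ?_)
      simp only [Function.comp]
      rw [abs_mul, Real.mul_rpow (abs_nonneg _) (abs_nonneg _), norm_mul,
        Real.norm_of_nonneg (by positivity)]
    have hP := Real.tsum_eq_tsum_fourier_of_rpow_decay_of_summable hc one_lt_two hO (by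
      simp only [hF]; exact hfr'.mul_left _) ((x.val : ℝ) / T)
    simp only [hF, fourier_coe_apply] at hP
    have e2 : ∑' k : ℕ, fresnelWeight α δ j (x.val + T * k : ℕ)
        = ∑' k : ℤ, fresnelWeight α δ j (T * (x.val / T + k)) := by
      rw [← Function.Injective.tsum_eq (g := ((↑) : ℕ → ℤ)) Nat.cast_injective]
      · refine tsum_congr fun k => ?_
        congr 1
        push_cast
        field_simp
      · intro k hk
        by_contra hneg
        refine hk (fresnelWeight_of_nonpos α δ j ?_)
        have hk0 : k ≤ -1 := by
          by_contra h
          exact hneg ⟨k.toNat, by simp; omega⟩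
        have h1 : (k : ℝ) ≤ -1 := by exact_mod_cast hk0
        have h2 : (x.val : ℝ) / T ≤ 1 := by
          rw [div_le_one hT']; exact_mod_cast (ZMod.val_lt x).le
        exact mul_nonpos_of_nonneg_of_nonpos hT'.le (by linarith)
    rw [e2, hP]
    refine tsum_congr fun m => ?_
    push_cast
    congr 2
    ring
  rw [Nat.sumByResidueClasses hsum T, Finset.sum_congr rfl fun x _ => hres x,
    ← Summable.tsum_finsetSum, ← tsum_mul_left, ← (Equiv.neg ℤ).tsum_eq]
  · refine tsum_congr fun m => ?_
    rw [dft_intCast_eq_sum, Finset.sum_mul, Finset.mul_sum]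
    refine Finset.sum_congr rfl fun x _ => ?_
    have e3 : (-(freq T ((Equiv.neg ℤ m : ℤ) : ℝ)) : ℂ) = freq T m := by simp [freq]; ring
    rw [e3]
    have e4 : (2 * Real.pi * I * ((Equiv.neg ℤ m : ℤ) : ℂ) * x.val / T : ℂ)
      = -(2 * Real.pi * I * m * x.val / T) := by simp; ring
    rw [e4]
    ring
  · intro x _
    refine Summable.mul_left _ ?_
    refine Summable.of_norm ((hfr'.mul_left (T : ℂ)⁻¹).norm.congr fun m => ?_)
    rw [show (2 * Real.pi * I * m * x.val / T : ℂ)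
      = ((2 * Real.pi * m * x.val / T : ℝ) : ℂ) * I by push_cast; ring, norm_mul _ (cexp _),
      Complex.norm_exp_ofReal_mul_I, mul_one]

theorem tendsto_nhdsGT_of_const_mul {c : ℝ} (hc : 0 < c) :
    Tendsto (fun δ : ℝ => c * δ) (𝓝[>] 0) (𝓝[>] 0) := by
  refine tendsto_nhdsWithin_iff.mpr ⟨?_, ?_⟩
  · have : Tendsto (fun δ : ℝ => c * δ) (𝓝 0) (𝓝 (c * 0)) := tendsto_id.const_mul c
    rw [mul_zero] at this
    exact this.mono_left nhdsWithin_le_nhds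
  · filter_upwards [self_mem_nhdsWithin] with δ hδ using mul_pos hc hδ

theorem continuousAt_rotatedRemainder {α : ℝ} (hα : 0 < α) {ζ : ℂ} (hζ : 0 < ζ.re + ζ.im)
    (j : ℕ) : ContinuousAt (fun ζ => rotatedRemainder α ζ j) ζ := by
  have hre := re_I_mul_eighthRoot_mul ζ
  have hs2 : 0 < √2 / 2 := by positivity
  have h1 : ContinuousAt (fun ζ : ℂ => I * eighthRoot * ζ) ζ := by fun_prop
  have h2 := ((quadExpConvergent_neg hα (I * eighthRoot * ζ)).hasDerivAt j).continuousAt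
  have h3 := ((show QuadExpConvergent 0 (I * eighthRoot * ζ) from
    Or.inr ⟨by simp, by rw [hre]; nlinarith⟩).hasDerivAt j).continuousAt
  exact ((h2.comp h1).sub (h3.comp h1)).const_mul _

/-- **Reciprocity** for the Abel sums of `f n * n ^ j * exp (i α n²)`: up to the contribution of the
stationary points, which is an Abel sum of the same kind with `1 / α` in place of `α`, only a rapidly
convergent sum of remainder integrals survives. -/
theorem hasAbelSum_mul_fresnel {α : ℝ} (hα : 0 < α) {T : ℕ} [NeZero T] {j : ℕ} (hj : j ≤ 1)
    {f : ZMod T → ℂ} (hf : ∑ x, f x = 0) (hpar : ∀ x, f (-x) = (-1) ^ (j + 1) * f x)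
    {L v₀ v : ℂ} (hL : HasAbelSum (fun n => f n * n ^ j) L)
    (hv₀ : HasAbelSum (fun n => ZMod.dft f n * cexp (-I * freq T n ^ 2 / (4 * α))) v₀)
    (hv : HasAbelSum (fun n => ZMod.dft f n * cexp (-I * freq T n ^ 2 / (4 * α)) * n ^ j) v) :
    HasAbelSum (fun n => f n * cexp (I * α * n ^ 2) * n ^ j)
      (L + (T : ℂ)⁻¹ * (∑' n : ℕ, ZMod.dft f n * (2 * rotatedRemainder α (freq T n) j)
        + (-1) ^ (j + 1) * (eighthRoot * (√(Real.pi / α) : ℝ) *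
          ((freq T 1 / (2 * α)) ^ j * v)))) := by
  have hT : 0 < T := NeZero.pos T
  have hT' : (0 : ℝ) < T := by exact_mod_cast hT
  have hpi := Real.pi_pos
  have hpiT : 0 < Real.pi / T := by positivity
  obtain ⟨B, hB0, hB⟩ := exists_norm_le_zmod f
  obtain ⟨A, hA0, hA⟩ := exists_norm_le_zmod (ZMod.dft f)
  have hd0 : ZMod.dft f 0 = 0 := by rw [ZMod.dft_apply_zero, hf]
  have hdpar : ∀ x, ZMod.dft f (-x) = (-1) ^ (j + 1) * ZMod.dft f x := fun x => by
    have := congrFun (ZMod.dft_comp_neg f) x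
    rw [← this, funext hpar, ZMod.dft_const_mul]
  have hbd : ∀ δ : ℝ, |δ| ≤ Real.pi / T → ∀ n : ℕ,
      ‖ZMod.dft f n * rotatedRemainder α (freq T n + δ * I) j‖ ≤ A *
        (α * (2 + j).factorial / (Real.pi / (2 * T)) ^ (j + 3) * ((n : ℝ) ^ 2)⁻¹) :=
    fun δ hδ n => by
    rcases Nat.eq_zero_or_pos n with rfl | hn
    · rw [Nat.cast_zero, hd0, zero_mul, norm_zero]; positivity
    · rw [norm_mul]
      exact mul_le_mul (hA _) (norm_rotatedRemainder_freq_le hα hT hδ j hn) (norm_nonneg _) hA0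
  have hbs : Summable fun n : ℕ => A *
      (α * (2 + j).factorial / (Real.pi / (2 * T)) ^ (j + 3) * ((n : ℝ) ^ 2)⁻¹) :=
    ((Real.summable_nat_pow_inv.mpr one_lt_two).mul_left _).mul_left _
  -- the damped identity
  have key : ∀ δ : ℝ, 0 < δ → δ ≤ Real.pi / T →
      ∑' n : ℕ, f n * cexp (I * α * n ^ 2) * n ^ j * (Real.exp (-(δ * n)) : ℂ)
      = ∑' n : ℕ, f n * n ^ j * (Real.exp (-(δ * n)) : ℂ) + (T : ℂ)⁻¹ *
        (∑' n : ℕ, (ZMod.dft f n * rotatedRemainder α (freq T n + δ * I) j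
          + ZMod.dft f n * rotatedRemainder α (freq T n + (-δ : ℝ) * I) j)
        + (-1) ^ (j + 1) * ∑' n : ℕ, ZMod.dft f n *
          stationaryTerm α (-freq T n + δ * I) j) := by
    intro δ hδ hδT
    have habs : |δ| ≤ Real.pi / T := by rwa [abs_of_pos hδ]
    have habs' : |-δ| ≤ Real.pi / T := by rwa [abs_neg]
    have hP := tsum_mul_fresnelWeight hα hδ hδT hj f
    have s1 : Summable fun n : ℕ => f n * cexp (I * α * n ^ 2) * n ^ j *
        (Real.exp (-(δ * n)) : ℂ) := summable_mul_exp_neg (B := B) (fun n => by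
      rw [norm_mul, show I * α * (n : ℂ) ^ 2 = ((α * n ^ 2 : ℝ) : ℂ) * I by push_cast; ring,
        Complex.norm_exp_ofReal_mul_I, mul_one]
      exact hB _) j hδ
    have s2 : Summable fun n : ℕ => f n * n ^ j * (Real.exp (-(δ * n)) : ℂ) :=
      summable_mul_exp_neg (fun n : ℕ => hB n) j hδ
    have e1 : ∑' n : ℕ, f n * fresnelWeight α δ j n
        = ∑' n : ℕ, f n * cexp (I * α * n ^ 2) * n ^ j * (Real.exp (-(δ * n)) : ℂ)
          - ∑' n : ℕ, f n * n ^ j * (Real.exp (-(δ * n)) : ℂ) := by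
      rw [← s1.tsum_sub s2]
      refine tsum_congr fun n => ?_
      rw [fresnelWeight_of_nonneg α δ j (Nat.cast_nonneg n)]
      push_cast
      ring
    have r1 := Summable.of_norm_bounded hbs (hbd δ habs)
    have r2 := Summable.of_norm_bounded hbs (hbd (-δ) habs')
    have r3 := (hasSum_mul_stationaryTerm hα hT hδ hj (C := fun n => ZMod.dft f n)
      (fun n => hA n)).summable
    have hfreq : ∀ n : ℕ, 0 < n → δ < freq T n := fun n hn => by
      refine hδT.trans_lt ?_
      have : (1 : ℝ) ≤ n := by exact_mod_cast hn
      unfold freq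
      gcongr
      nlinarith
    have p1 : ∀ n : ℕ, ZMod.dft f ((n : ℤ) : ZMod T) *
        fresnelRemainder α (freq T ((n : ℤ) : ℝ) + δ * I) j
        = ZMod.dft f n * rotatedRemainder α (freq T n + δ * I) j := fun n => by
      rw [Int.cast_natCast, Int.cast_natCast]
      rcases Nat.eq_zero_or_pos n with rfl | hn
      · rw [Nat.cast_zero, hd0, zero_mul, zero_mul]
      · have := hfreq n hn
        rw [fresnelRemainder_of_pos hα (by simpa using hδ) (by simp; linarith)]
    have p2 : ∀ n : ℕ, ZMod.dft f ((-(n : ℤ) : ℤ) : ZMod T) *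
        fresnelRemainder α (freq T ((-(n : ℤ) : ℤ) : ℝ) + δ * I) j
        = (-1) ^ (j + 1) * (ZMod.dft f n * stationaryTerm α (-freq T n + δ * I) j)
          + ZMod.dft f n * rotatedRemainder α (freq T n + (-δ : ℝ) * I) j := fun n => by
      rw [Int.cast_neg, Int.cast_neg, Int.cast_natCast, Int.cast_natCast, hdpar]
      rcases Nat.eq_zero_or_pos n with rfl | hn
      · rw [Nat.cast_zero, hd0]; simp
      · have := hfreq n hn
        have e2 : ((freq T (-(n : ℝ)) : ℝ) : ℂ) = -freq T n := by simp [freq]; ring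
        rw [e2, fresnelRemainder_of_neg hα (by simpa using hδ) (by simp; linarith) hj]
        have e3 : (-(-(freq T n : ℂ) + δ * I)) = freq T n + (-δ : ℝ) * I := by push_cast; ring
        rw [e3]
        have e4 : ((-1 : ℂ) ^ (j + 1)) * (-1) ^ (j + 1) = 1 := by rw [← mul_pow]; simp
        linear_combination (ZMod.dft f n * rotatedRemainder α (freq T n + (-δ : ℝ) * I) j) * e4
    have e5 : ∑' m : ℤ, ZMod.dft f m * fresnelRemainder α (freq T m + δ * I) j
        = ∑' n : ℕ, ZMod.dft f n * rotatedRemainder α (freq T n + δ * I) j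
          + ((-1) ^ (j + 1) * ∑' n : ℕ, ZMod.dft f n * stationaryTerm α (-freq T n + δ * I) j
          + ∑' n : ℕ, ZMod.dft f n * rotatedRemainder α (freq T n + (-δ : ℝ) * I) j) := by
      rw [Summable.tsum_of_nat_of_neg (r1.congr fun n => (p1 n).symm)
        (((r3.mul_left _).add r2).congr fun n => (p2 n).symm), tsum_congr p1, tsum_congr p2,
        Int.cast_zero, hd0, zero_mul, sub_zero, (r3.mul_left _).tsum_add r2, tsum_mul_left]
    rw [e1, e5] at hP
    rw [sub_eq_iff_eq_add'.mp hP, r1.tsum_add r2]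
    ring
  -- passage to the limit
  have hev : ∀ᶠ δ : ℝ in 𝓝[>] 0, 0 < δ ∧ δ ≤ Real.pi / T := by
    filter_upwards [Ioc_mem_nhdsGT hpiT] with δ hδ using hδ
  have hid : Tendsto (fun δ : ℝ => δ) (𝓝[>] 0) (𝓝 0) := tendsto_id.mono_left nhdsWithin_le_nhds
  have l1 : Tendsto (fun δ : ℝ => ∑' n : ℕ,
      (ZMod.dft f n * rotatedRemainder α (freq T n + δ * I) j
        + ZMod.dft f n * rotatedRemainder α (freq T n + (-δ : ℝ) * I) j)) (𝓝[>] 0)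
      (𝓝 (∑' n : ℕ, ZMod.dft f n * (2 * rotatedRemainder α (freq T n) j))) := by
    refine tendsto_tsum_of_dominated_convergence (hbs.add hbs) (fun n => ?_) ?_
    · rcases Nat.eq_zero_or_pos n with rfl | hn
      · simp [hd0]
      · have hc : ∀ s : ℝ → ℝ, Tendsto s (𝓝[>] 0) (𝓝 0) → Tendsto (fun δ : ℝ =>
            rotatedRemainder α (freq T n + s δ * I) j) (𝓝[>] 0)
            (𝓝 (rotatedRemainder α (freq T n) j)) := fun s hs => by
          have hpos : 0 < freq T n := by
            have : (0 : ℝ) < n := by exact_mod_cast hn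
            unfold freq; positivity
          have h := continuousAt_rotatedRemainder hα (ζ := (freq T n : ℂ)) (by simpa using hpos) j
          refine h.tendsto.comp ?_
          have h2 : Tendsto (fun δ : ℝ => (freq T n : ℂ) + s δ * I) (𝓝[>] 0)
              (𝓝 (freq T n + (0 : ℝ) * I)) :=
            ((continuous_ofReal.tendsto 0).comp hs).mul_const I |>.const_add _
          simpa using h2
        have h1 := (hc (fun δ => δ) hid).const_mul (ZMod.dft f n)
        have h2 := (hc (fun δ => -δ) (by simpa using hid.neg)).const_mul (ZMod.dft f n)
        refine (h1.add h2).trans_eq ?_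
        congr 1; ring
    · filter_upwards [hev] with δ hδ n
      exact (norm_add_le _ _).trans (add_le_add (hbd δ (by rw [abs_of_pos hδ.1]; exact hδ.2) n)
        (hbd (-δ) (by rw [abs_neg, abs_of_pos hδ.1]; exact hδ.2) n))
  have hc : 0 < freq T 1 / (2 * α) := by unfold freq; positivity
  have l2 : Tendsto (fun δ : ℝ => ∑' n : ℕ, ZMod.dft f n *
      stationaryTerm α (-freq T n + δ * I) j) (𝓝[>] 0)
      (𝓝 (eighthRoot * (√(Real.pi / α) : ℝ) * ((freq T 1 / (2 * α)) ^ j * v))) := by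
    have t := tendsto_nhdsGT_of_const_mul hc
    have a0 := hv₀.comp t
    have a1 := hv.comp t
    have hidc : Tendsto (fun δ : ℝ => (δ : ℂ)) (𝓝[>] 0) (𝓝 ((0 : ℝ) : ℂ)) :=
      (continuous_ofReal.tendsto 0).comp hid
    have b1 : Tendsto (fun δ : ℝ => cexp (I * δ ^ 2 / (4 * α))) (𝓝[>] 0) (𝓝 1) := by
      have h : Continuous fun δ : ℝ => cexp (I * δ ^ 2 / (4 * α)) := by fun_prop
      have := (h.tendsto 0).mono_left (nhdsWithin_le_nhds (s := Set.Ioi 0))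
      simpa using this
    have b2 : Tendsto (fun δ : ℝ => (j : ℂ) * (δ * I / (2 * α))) (𝓝[>] 0) (𝓝 0) := by
      have h : Continuous fun δ : ℝ => (j : ℂ) * (δ * I / (2 * α)) := by fun_prop
      have := (h.tendsto 0).mono_left (nhdsWithin_le_nhds (s := Set.Ioi 0))
      simpa using this
    have := (b1.const_mul (eighthRoot * (√(Real.pi / α) : ℝ))).mul
      ((a1.const_mul ((freq T 1 / (2 * α) : ℂ) ^ j)).sub (b2.mul a0))
    rw [mul_one, zero_mul, sub_zero] at this
    refine this.congr' ?_
    filter_upwards [hev] with δ hδ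
    rw [(hasSum_mul_stationaryTerm hα hT hδ.1 hj (C := fun n => ZMod.dft f n)
      (fun n => hA n)).tsum_eq]
    simp only [Function.comp, mul_div_right_comm]
  refine (hL.add ((l1.add (l2.const_mul ((-1) ^ (j + 1)))).const_mul ((T : ℂ)⁻¹))).congr' ?_
  filter_upwards [hev] with δ hδ
  exact (key δ hδ.1 hδ.2).symm

/-! ### The asymptotic expansion of the remainder -/

/-- The functional equation, as a series for the values of the L-function at negative integers. -/
theorem hasSum_LFunction_neg {T : ℕ} [NeZero T] {j : ℕ} {f : ZMod T → ℂ} (hf : ∑ x, f x = 0)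
    (hpar : ∀ x, f (-x) = (-1) ^ (j + 1) * f x) (k : ℕ) :
    HasSum (fun n : ℕ => (T : ℂ)⁻¹ * (ZMod.dft f n * (2 * ((-1) ^ (k + 1) *
      (2 * (k + 1) + j).factorial * I ^ (j + 1) / (freq T n : ℂ) ^ (2 * (k + 1) + j + 1)))))
      (ZMod.LFunction f (-(2 * (k + 1 : ℕ)) - j)) := by
  set m := 2 * (k + 1) + j with hm
  have hT : (T : ℂ) ≠ 0 := NeZero.ne _
  have hpi : (Real.pi : ℂ) ≠ 0 := by exact_mod_cast Real.pi_ne_zero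
  have hd0 : ZMod.dft f 0 = 0 := by rw [ZMod.dft_apply_zero, hf]
  have hs : 1 < ((m + 1 : ℕ) : ℂ).re := by
    rw [natCast_re]; exact_mod_cast (by omega : 1 < m + 1)
  have h1 := ZMod.LFunction_one_sub f (s := ((m + 1 : ℕ) : ℂ))
    (fun n h => by
      have := congrArg re h
      rw [neg_re, natCast_re, natCast_re] at this
      have h2 : (0 : ℝ) ≤ n := Nat.cast_nonneg n
      have h3 : (0 : ℝ) < (m + 1 : ℕ) := by positivity
      linarith) (Or.inr fun h => by rw [h] at hs; simp at hs)
  have e1 : (1 : ℂ) - ((m + 1 : ℕ) : ℂ) = -(2 * (k + 1 : ℕ)) - j := by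
    rw [hm]; push_cast; ring
  have e2 : cexp (Real.pi * I * ((m + 1 : ℕ) : ℂ) / 2) = I ^ (m + 1) := by
    rw [show Real.pi * I * ((m + 1 : ℕ) : ℂ) / 2 = ((m + 1 : ℕ) : ℂ) * (Real.pi / 2 * I) by ring,
      Complex.exp_nat_mul, Complex.exp_pi_div_two_mul_I]
  have e3 : cexp (-Real.pi * I * ((m + 1 : ℕ) : ℂ) / 2) = (-I) ^ (m + 1) := by
    rw [show -Real.pi * I * ((m + 1 : ℕ) : ℂ) / 2 = ((m + 1 : ℕ) : ℂ) * (-Real.pi / 2 * I) by ring,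
      Complex.exp_nat_mul, Complex.exp_neg_pi_div_two_mul_I]
  have e4 : ZMod.dft (fun x => f (-x)) = fun x => (-1) ^ (j + 1) * ZMod.dft f x := by
    rw [funext hpar, ZMod.dft_const_mul]
  have e5 : ZMod.LFunction (fun x => (-1) ^ (j + 1) * ZMod.dft f x) ((m + 1 : ℕ) : ℂ)
      = (-1) ^ (j + 1) * ZMod.LFunction (ZMod.dft f) ((m + 1 : ℕ) : ℂ) := by
    simp only [ZMod.LFunction, Finset.mul_sum]
    exact Finset.sum_congr rfl fun x _ => by ring
  have e6 : (-I : ℂ) ^ (m + 1) * (-1) ^ (j + 1) = I ^ (m + 1) := by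
    rw [neg_pow, hm, show 2 * (k + 1) + j + 1 = 2 * (k + 1) + (j + 1) by ring, pow_add (-1 : ℂ),
      pow_mul (-1 : ℂ)]
    have : ((-1 : ℂ) ^ (j + 1)) * (-1) ^ (j + 1) = 1 := by rw [← mul_pow]; simp
    simp only [even_two, Even.neg_pow, one_pow, one_mul]
    linear_combination I ^ (2 * (k + 1) + (j + 1)) * this
  have e7 : (I : ℂ) ^ (m + 1) = (-1) ^ (k + 1) * I ^ (j + 1) := by
    rw [hm, show 2 * (k + 1) + j + 1 = 2 * (k + 1) + (j + 1) by ring, pow_add, pow_mul, I_sq]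
  rw [e1, e2, e3, e4, e5, ← mul_assoc ((-I) ^ (m + 1)), e6, ← two_mul] at h1
  have e8 : (T : ℂ) ^ (((m + 1 : ℕ) : ℂ) - 1) = T ^ m := by
    rw [show ((m + 1 : ℕ) : ℂ) - 1 = (m : ℕ) by push_cast; ring, cpow_natCast]
  have e9 : (2 * Real.pi : ℂ) ^ (-((m + 1 : ℕ) : ℂ)) = ((2 * Real.pi : ℂ) ^ (m + 1))⁻¹ := by
    rw [cpow_neg, cpow_natCast]
  have e10 : Gamma ((m + 1 : ℕ) : ℂ) = m.factorial := by
    rw [Nat.cast_add, Nat.cast_one, Gamma_nat_eq_factorial]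
  rw [e8, e9, e10, e7] at h1
  rw [h1]
  have h2 : HasSum (fun n : ℕ => ZMod.dft f n / (n : ℂ) ^ (m + 1))
      (ZMod.LFunction (ZMod.dft f) ((m + 1 : ℕ) : ℂ)) := by
    rw [ZMod.LFunction_eq_LSeries _ hs]
    have h := (ZMod.LSeriesSummable_of_one_lt_re (ZMod.dft f) hs).hasSum
    convert! h using 1
    funext n
    rcases eq_or_ne n 0 with rfl | hn
    · simp [hd0]
    · rw [LSeries.term_of_ne_zero hn, cpow_natCast]
  have h3 := h2.mul_left ((T : ℂ) ^ m * ((2 * Real.pi : ℂ) ^ (m + 1))⁻¹ * m.factorial *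
    (2 * ((-1) ^ (k + 1) * I ^ (j + 1))))
  convert! h3 using 1
  · funext n
    rcases eq_or_ne n 0 with rfl | hn
    · simp [hd0]
    · have hn' : (n : ℂ) ≠ 0 := by exact_mod_cast hn
      simp only [freq, ofReal_div, ofReal_mul, ofReal_natCast, ofReal_ofNat, mul_pow, div_pow]
      field_simp
      ring
  · ring

/-- The sum of the remainder integrals has an asymptotic expansion in powers of `α` whose
coefficients are the values of the L-function of `f` at negative integers. -/
theorem exists_norm_tsum_rotatedRemainder_sub_le {T : ℕ} [NeZero T] {j : ℕ} {f : ZMod T → ℂ}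
    (hf : ∑ x, f x = 0) (hpar : ∀ x, f (-x) = (-1) ^ (j + 1) * f x) (K : ℕ) :
    ∃ B, ∀ α : ℝ, 0 < α →
      ‖(T : ℂ)⁻¹ * ∑' n : ℕ, ZMod.dft f n * (2 * rotatedRemainder α (freq T n) j)
        - ∑ k ∈ Finset.range K, ZMod.LFunction f (-(2 * (k + 1 : ℕ)) - j) / (k + 1).factorial *
          (I * α) ^ (k + 1)‖ ≤ B * α ^ (K + 1) := by
  have hT : 0 < T := NeZero.pos T
  have hT' : (0 : ℝ) < T := by exact_mod_cast hT
  have hpi := Real.pi_pos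
  have hd0 : ZMod.dft f 0 = 0 := by rw [ZMod.dft_apply_zero, hf]
  obtain ⟨A, hA0, hA⟩ := exists_norm_le_zmod (ZMod.dft f)
  set D : ℝ := (T : ℝ)⁻¹ * (A * (2 * (((2 * (K + 1) + j).factorial : ℝ) / (K + 1).factorial /
    (Real.pi / T) ^ (2 * (K + 1) + j + 1)))) with hD
  have hsq : Summable fun n : ℕ => D * ((n : ℝ) ^ 2)⁻¹ :=
    (Real.summable_nat_pow_inv.mpr one_lt_two).mul_left D
  refine ⟨∑' n : ℕ, D * ((n : ℝ) ^ 2)⁻¹, fun α hα => ?_⟩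
  have hs1 : Summable fun n : ℕ =>
      (T : ℂ)⁻¹ * (ZMod.dft f n * (2 * rotatedRemainder α (freq T n) j)) := by
    refine Summable.mul_left _ (Summable.of_norm_bounded
      (((Real.summable_nat_pow_inv.mpr one_lt_two).mul_left
        (2 * (α * (2 + j).factorial / (Real.pi / (2 * T)) ^ (j + 3)))).mul_left A) fun n => ?_)
    rcases Nat.eq_zero_or_pos n with rfl | hn
    · rw [Nat.cast_zero, hd0, zero_mul, norm_zero]; positivity
    · have h := norm_rotatedRemainder_freq_le hα hT (δ := 0)
        (by rw [abs_zero]; positivity) j hn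
      rw [ofReal_zero, zero_mul, add_zero] at h
      rw [norm_mul, norm_mul, Complex.norm_ofNat, mul_assoc 2]
      exact mul_le_mul (hA _) (mul_le_mul_of_nonneg_left h zero_le_two) (by positivity) hA0
  have hs2 := hasSum_sum (s := Finset.range K) fun k _ =>
    (hasSum_LFunction_neg hf hpar k).mul_left ((I * α) ^ (k + 1) / ((k + 1).factorial : ℂ))
  have e : (T : ℂ)⁻¹ * ∑' n : ℕ, ZMod.dft f n * (2 * rotatedRemainder α (freq T n) j)
        - ∑ k ∈ Finset.range K, ZMod.LFunction f (-(2 * (k + 1 : ℕ)) - j) / (k + 1).factorial *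
          (I * α) ^ (k + 1)
      = ∑' n : ℕ, (T : ℂ)⁻¹ * (ZMod.dft f n * (2 * (rotatedRemainder α (freq T n) j -
        ∑ k ∈ Finset.range K, (I * α) ^ (k + 1) / (k + 1).factorial *
        ((-1) ^ (k + 1) * (2 * (k + 1) + j).factorial * I ^ (j + 1) /
          (freq T n : ℂ) ^ (2 * (k + 1) + j + 1))))) := by
    rw [← tsum_mul_left]
    have h := hs1.hasSum.sub hs2
    refine Eq.trans ?_ (h.tsum_eq.symm.trans ?_)
    · congr 1
      exact Finset.sum_congr rfl fun k _ => by ring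
    · refine tsum_congr fun n => ?_
      simp only [mul_sub, Finset.mul_sum]
      congr 1
      exact Finset.sum_congr rfl fun k _ => by ring
  rw [e, ← tsum_mul_right]
  refine tsum_of_norm_bounded (hsq.mul_right _).hasSum fun n => ?_
  rcases Nat.eq_zero_or_pos n with rfl | hn
  · rw [Nat.cast_zero, hd0]; simp
  have hn1 : (1 : ℝ) ≤ n := by exact_mod_cast hn
  have h := norm_rotatedRemainder_sub_sum_le hα (ζ := (freq T n : ℂ)) (r := Real.pi / T * n)
    (by positivity) (by simp [freq]; apply le_of_eq; ring) j K
  rw [norm_mul, norm_mul, norm_mul, Complex.norm_ofNat, norm_inv, Complex.norm_natCast]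
  have h2 : α ^ (K + 1) / (K + 1).factorial * ((2 * (K + 1) + j).factorial /
      (Real.pi / T * n) ^ (2 * (K + 1) + j + 1)) ≤ (((2 * (K + 1) + j).factorial : ℝ) /
      (K + 1).factorial / (Real.pi / T) ^ (2 * (K + 1) + j + 1)) * ((n : ℝ) ^ 2)⁻¹ *
      α ^ (K + 1) := by
    have h3 : ((n : ℝ) ^ (2 * (K + 1) + j + 1))⁻¹ ≤ ((n : ℝ) ^ 2)⁻¹ :=
      inv_anti₀ (by positivity) (pow_le_pow_right₀ hn1 (by omega))
    rw [mul_pow, ← div_div, div_eq_mul_inv _ ((n : ℝ) ^ (2 * (K + 1) + j + 1))]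
    calc _ = (((2 * (K + 1) + j).factorial : ℝ) /
      (K + 1).factorial / (Real.pi / T) ^ (2 * (K + 1) + j + 1)) *
        ((n : ℝ) ^ (2 * (K + 1) + j + 1))⁻¹ * α ^ (K + 1) := by ring
      _ ≤ _ := by gcongr
  calc _ ≤ (T : ℝ)⁻¹ * (A * (2 * ((((2 * (K + 1) + j).factorial : ℝ) /
      (K + 1).factorial / (Real.pi / T) ^ (2 * (K + 1) + j + 1)) * ((n : ℝ) ^ 2)⁻¹ *
      α ^ (K + 1)))) := by
        refine mul_le_mul_of_nonneg_left (mul_le_mul (hA _) ?_ (by positivity) hA0) (by positivity)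
        exact mul_le_mul_of_nonneg_left (h.trans h2) zero_le_two
    _ = _ := by rw [hD]; ring

/-! ### Limiting values of Eichler integrals -/

theorem HasAbelSum.unique {C : ℕ → ℂ} {v w : ℂ} (hv : HasAbelSum C v) (hw : HasAbelSum C w) :
    v = w :=
  tendsto_nhds_unique hv hw

/-- A periodic sequence whose Abel sum exists, possibly with a weight `n`, has mean zero: a nonzero
mean would make the sums grow like a power of `1 / ε`. -/
theorem sum_range_eq_zero_of_hasAbelSum {T : ℕ} (hT : 0 < T) {C : ℕ → ℂ}
    (hC : Function.Periodic C T) {j : ℕ} (hj : j ≤ 1) {v : ℂ}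
    (hv : HasAbelSum (fun n => C n * n ^ j) v) : ∑ n ∈ Finset.range T, C n = 0 := by
  have hT' : (T : ℂ) ≠ 0 := by exact_mod_cast hT.ne'
  obtain ⟨B, hB0, hB⟩ := exists_norm_le_of_periodic hT hC
  set μ : ℂ := (∑ n ∈ Finset.range T, C n) / T with hμ
  suffices h : μ = 0 by rwa [hμ, div_eq_zero_iff, or_iff_left hT'] at h
  have h0 := hasAbelSum_regularizedValue hT (C := fun n => C n - μ)
    (fun n => by simp only [hC n]) (by
      rw [Finset.sum_sub_distrib, Finset.sum_const, Finset.card_range, nsmul_eq_mul, hμ,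
        mul_div_cancel₀ _ hT', sub_self]) hj
  have hB' : ∀ n, ‖C n - μ‖ ≤ B + ‖μ‖ := fun n =>
    (norm_sub_le _ _).trans (add_le_add (hB n) le_rfl)
  have h1 := hv.sub h0
  have hr : Tendsto (fun ε : ℝ => (Real.exp (-ε) : ℂ)) (𝓝[>] 0) (𝓝 1) := by
    have h : Continuous fun ε : ℝ => (Real.exp (-ε) : ℂ) := by fun_prop
    have := (h.tendsto 0).mono_left (nhdsWithin_le_nhds (s := Set.Ioi 0))
    simpa using this
  have h2 := ((hr.const_sub 1).pow (j + 1)).mul h1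
  rw [sub_self, zero_pow (Nat.succ_ne_zero j), zero_mul] at h2
  have h3 : Tendsto (fun ε : ℝ => μ * (Real.exp (-ε) : ℂ) ^ j) (𝓝[>] 0) (𝓝 μ) := by
    simpa using (hr.pow j).const_mul μ
  refine tendsto_nhds_unique h3 (h2.congr' ?_)
  filter_upwards [self_mem_nhdsWithin] with ε hε
  have hε' : (0 : ℝ) < ε := hε
  rw [← (summable_mul_exp_neg hB j hε').tsum_sub (summable_mul_exp_neg hB' j hε')]
  set r : ℂ := (Real.exp (-ε) : ℂ) with hr'
  have hrn : ‖r‖ < 1 := by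
    rw [hr', Complex.norm_real, Real.norm_of_nonneg (Real.exp_pos _).le]; simpa using hε'
  have hr1 : 1 - r ≠ 0 := sub_ne_zero.mpr fun h => by rw [← h] at hrn; simp at hrn
  have e : ∀ n : ℕ, C n * n ^ j * (Real.exp (-(ε * n)) : ℂ)
      - (C n - μ) * n ^ j * (Real.exp (-(ε * n)) : ℂ) = μ * ((n : ℂ) ^ j * r ^ n) := fun n => by
    have : (Real.exp (-(ε * n)) : ℂ) = r ^ n := by
      rw [hr', ← ofReal_pow, ← Real.exp_nat_mul]; congr 2; ring
    rw [this]; ring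
  rw [tsum_congr e, tsum_mul_left]
  interval_cases j
  · simp only [pow_zero, one_mul]
    rw [tsum_geometric_of_norm_lt_one hrn]
    field_simp
    ring
  · simp only [pow_one]
    rw [tsum_coe_mul_geometric_of_norm_lt_one hrn]
    field_simp

theorem partialSumMean_sum_mul {ι : Type*} (s : Finset ι) (W : ι → ℂ) (T : ℕ) (C : ι → ℕ → ℂ) :
    partialSumMean T (fun n => ∑ i ∈ s, W i * C i n) = ∑ i ∈ s, W i * partialSumMean T (C i) := by
  simp only [partialSumMean, mul_div_assoc', ← Finset.sum_div, Finset.mul_sum]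
  congr 1
  rw [Finset.sum_comm (s := s)]
  exact Finset.sum_congr rfl fun n _ => Finset.sum_comm

theorem regularizedValue_sum_mul {ι : Type*} (s : Finset ι) (W : ι → ℂ) (T : ℕ) (C : ι → ℕ → ℂ)
    (j : ℕ) : regularizedValue T (fun n => ∑ i ∈ s, W i * C i n) j
      = ∑ i ∈ s, W i * regularizedValue T (C i) j := by
  unfold regularizedValue
  split_ifs
  · exact partialSumMean_sum_mul s W T C
  · have : centeredPartialSum T (fun n => ∑ i ∈ s, W i * C i n)
        = fun n => ∑ i ∈ s, W i * centeredPartialSum T (C i) n := by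
      funext n
      simp only [centeredPartialSum, partialSumMean_sum_mul, mul_sub, Finset.sum_sub_distrib,
        Finset.mul_sum]
      rw [Finset.sum_comm]
    rw [this, partialSumMean_sum_mul]
    simp only [mul_neg, Finset.sum_neg_distrib]

/-- The series `∑ f n * n ^ j * q ^ (n² / 4P)` attached to a function `f` of period `2P`. -/
noncomputable def eichlerIntegral (P : ℕ) (f : ZMod (2 * P) → ℂ) (j : ℕ) (τ : ℂ) : ℂ :=
  ∑' n : ℕ, f n * n ^ j * cexp (2 * Real.pi * I * τ * ((n : ℂ) ^ 2 / (4 * P)))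

/-- The coefficients `f n * q ^ (n² / 4P)` at the boundary point `x`. -/
noncomputable def boundaryTerm (P : ℕ) (f : ZMod (2 * P) → ℂ) (x : ℝ) (n : ℕ) : ℂ :=
  f n * cexp (2 * Real.pi * I * x * ((n : ℂ) ^ 2 / (4 * P)))

theorem hasLimitingValue_eichlerIntegral {P : ℕ} (hP : 0 < P) {f : ZMod (2 * P) → ℂ} {x : ℝ}
    {T : ℕ} (hT : 0 < T) (hC : Function.Periodic (boundaryTerm P f x) T)
    (h0 : ∑ n ∈ Finset.range T, boundaryTerm P f x n = 0) {j : ℕ} (hj : j ≤ 1) :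
    HasLimitingValue (eichlerIntegral P f j) x (regularizedValue T (boundaryTerm P f x) j) := by
  have hP' : (0 : ℝ) < P := by exact_mod_cast hP
  have hpi := Real.pi_pos
  have h := (hasGaussSum_regularizedValue hT hC h0 hj).comp
    (tendsto_nhdsGT_of_const_mul (c := 2 * Real.pi / (4 * P)) (by positivity))
  refine h.congr fun t => tsum_congr fun n => ?_
  simp only [boundaryTerm]
  rw [ofReal_exp, mul_right_comm _ (cexp _), mul_assoc _ (cexp _), ← Complex.exp_add]
  congr 2
  push_cast
  have : (P : ℂ) ≠ 0 := by exact_mod_cast hP.ne'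
  field_simp
  linear_combination (-(t : ℂ) * n ^ 2) * I_sq

theorem HasLimitingValue.limitingValue_eq {F : ℂ → ℂ} {x : ℝ} {c : ℂ}
    (h : HasLimitingValue F x c) : limitingValue F x = c :=
  Tendsto.limUnder_eq h

theorem boundaryTerm_one_div_periodic {P : ℕ} (hP : 0 < P) (f : ZMod (2 * P) → ℂ) {N : ℤ}
    (hN : N ≠ 0) : Function.Periodic (boundaryTerm P f (1 / N)) (2 * P * N.natAbs) := by
  intro n
  have hP' : (P : ℂ) ≠ 0 := by exact_mod_cast hP.ne'
  have hN' : (N : ℂ) ≠ 0 := by exact_mod_cast hN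
  obtain ⟨a, ha⟩ : ∃ a, a = N.natAbs := ⟨_, rfl⟩
  rw [← ha]
  obtain ⟨e, he, he2⟩ : ∃ e : ℤ, (a : ℤ) = e * N ∧ e ^ 2 = 1 := by
    rcases Int.natAbs_eq N with h | h
    · exact ⟨1, by omega, by norm_num⟩
    · exact ⟨-1, by omega, by norm_num⟩
  replace he : (a : ℂ) = e * N := by exact_mod_cast congrArg (Int.cast : ℤ → ℂ) he
  replace he2 : (e : ℂ) ^ 2 = 1 := by exact_mod_cast congrArg (Int.cast : ℤ → ℂ) he2
  unfold boundaryTerm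
  congr 1
  · congr 1
    rw [Nat.cast_add, Nat.cast_mul, ZMod.natCast_self, zero_mul, add_zero]
  · rw [Complex.exp_eq_exp_iff_exists_int]
    refine ⟨e * n + P * N, ?_⟩
    push_cast
    rw [he]
    field_simp
    linear_combination (4 * (P : ℂ) ^ 2 * N ^ 2) * he2

/-- `n²` is constant modulo `4P` on the support of `f`. -/
def HasConstantSquare (P : ℕ) (f : ZMod (2 * P) → ℂ) : Prop :=
  ∃ r : ℤ, ∀ x : ℤ, f x ≠ 0 → (4 * P : ℤ) ∣ x ^ 2 - r

/-- At an integer `-N` the factors `q ^ (n² / 4P)` are constant on the support of `f`. -/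
theorem HasConstantSquare.exists_boundaryTerm_eq {P : ℕ} [NeZero P] {f : ZMod (2 * P) → ℂ}
    (hf : HasConstantSquare P f) (N : ℤ) :
    ∃ c : ℂ, ∀ n : ℕ, boundaryTerm P f (-N) n = c * f n := by
  obtain ⟨r, hr⟩ := hf
  have hP' : (P : ℂ) ≠ 0 := NeZero.ne _
  refine ⟨cexp (2 * Real.pi * I * (-N) * (r / (4 * P))), fun n => ?_⟩
  unfold boundaryTerm
  by_cases h : f n = 0
  · rw [h]; simp
  obtain ⟨d, hd⟩ := hr n (by simpa using h)
  rw [mul_comm]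
  congr 1
  rw [Complex.exp_eq_exp_iff_exists_int]
  refine ⟨-N * d, ?_⟩
  have hd' : (n : ℂ) ^ 2 - r = 4 * P * d := by exact_mod_cast congrArg (Int.cast : ℤ → ℂ) hd
  rw [sub_eq_iff_eq_add.mp hd']
  push_cast
  field_simp
  ring

theorem HasConstantSquare.boundaryTerm_periodic {P : ℕ} [NeZero P] {f : ZMod (2 * P) → ℂ}
    (hf : HasConstantSquare P f) (N : ℤ) :
    Function.Periodic (boundaryTerm P f (-N)) (2 * P) := by
  obtain ⟨c, hc⟩ := hf.exists_boundaryTerm_eq N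
  intro n
  rw [hc, hc]
  exact congrArg (c * ·) (periodic_natCast_zmod f n)

theorem HasConstantSquare.sum_boundaryTerm {P : ℕ} [NeZero P] {f : ZMod (2 * P) → ℂ}
    (hf : HasConstantSquare P f) (h0 : ∑ x, f x = 0) (N : ℤ) :
    ∑ n ∈ Finset.range (2 * P), boundaryTerm P f (-N) n = 0 := by
  obtain ⟨c, hc⟩ := hf.exists_boundaryTerm_eq N
  rw [Finset.sum_congr rfl fun n _ => hc n, ← Finset.mul_sum, sum_range_natCast_zmod, h0, mul_zero]

theorem HasConstantSquare.hasLimitingValue {P : ℕ} [NeZero P] {f : ZMod (2 * P) → ℂ}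
    (hf : HasConstantSquare P f) (h0 : ∑ x, f x = 0) (N : ℤ) {j : ℕ} (hj : j ≤ 1) :
    HasLimitingValue (eichlerIntegral P f j) (-N)
      (regularizedValue (2 * P) (boundaryTerm P f (-N)) j) :=
  hasLimitingValue_eichlerIntegral (NeZero.pos P) (NeZero.pos _) (hf.boundaryTerm_periodic N)
    (hf.sum_boundaryTerm h0 N) hj

/-- The automorphy factor, by principal values. -/
theorem div_I_cpow (j : ℕ) {x : ℝ} (hx : 0 < x) :
    (x / I) ^ (j + 1 / 2 : ℂ) = x ^ j * (-I) ^ (j + 1) * eighthRoot * (√x : ℝ) := by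
  have hx0 : (x : ℂ) ≠ 0 := by exact_mod_cast hx.ne'
  have h0 : (x : ℂ) / I ≠ 0 := div_ne_zero hx0 I_ne_zero
  have hs : ((√x : ℝ) : ℂ) ^ 2 = x := by exact_mod_cast Real.sq_sqrt hx.le
  have h2 : ((-I) * eighthRoot * (√x : ℝ)) ^ 2 = x / I := by
    rw [mul_pow, mul_pow, eighthRoot_sq, hs, div_I]
    linear_combination (I * x) * I_sq
  have h1 : (x / I) ^ (1 / 2 : ℂ) = (-I) * eighthRoot * (√x : ℝ) := by
    rw [← h2, one_div]
    refine Complex.sq_cpow_two_inv ?_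
    have : ((-I) * eighthRoot * (√x : ℝ)).re = √2 / 2 * √x := by simp [eighthRoot]
    rw [this]
    have := Real.sqrt_pos.mpr hx
    positivity
  rw [cpow_add _ _ h0, cpow_natCast, h1, div_I, pow_succ]
  rw [show -(x * I) = x * (-I) by ring, mul_pow]
  ring

/-- A periodic function of parity `(-1) ^ (j + 1)` whose Fourier transform is a linear combination
of functions `g i` with constant squares; `√(2P) * (-I ^ (j + 1))` normalizes the coefficients. -/
structure IsModularSystem {ι : Type*} (P : ℕ) [NeZero P] (j : ℕ) (f : ZMod (2 * P) → ℂ)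
    (s : Finset ι) (W : ι → ℂ) (g : ι → ZMod (2 * P) → ℂ) : Prop where
  sum_eq_zero : ∑ x, f x = 0
  map_neg : ∀ x, f (-x) = (-1) ^ (j + 1) * f x
  map_zero : f 0 * (0 : ℂ) ^ j = 0
  real : ∀ x, (starRingEnd ℂ) (f x) = f x
  dft_eq : ∀ x, ZMod.dft f x = -I ^ (j + 1) * √(2 * P : ℝ) * ∑ i ∈ s, W i * g i x
  sum_eq_zero' : ∀ i ∈ s, ∑ x, g i x = 0
  constantSquare : ∀ i ∈ s, HasConstantSquare P (g i)

namespace IsModularSystem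

variable {ι : Type*} {P : ℕ} [NeZero P] {j : ℕ} {f : ZMod (2 * P) → ℂ} {s : Finset ι} {W : ι → ℂ}
  {g : ι → ZMod (2 * P) → ℂ}

theorem boundaryTerm_dft (h : IsModularSystem P j f s W g) (x : ℝ) :
    boundaryTerm P (ZMod.dft f) x
      = fun n => ∑ i ∈ s, (-I ^ (j + 1) * √(2 * P : ℝ) * W i) * boundaryTerm P (g i) x n := by
  funext n
  rw [boundaryTerm, h.dft_eq, Finset.mul_sum, Finset.sum_mul]
  exact Finset.sum_congr rfl fun i _ => by rw [boundaryTerm]; ring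

/-- The reciprocity formula at `1 / N`, in terms of Abel sums. -/
theorem hasAbelSum (h : IsModularSystem P j f s W g) (hj : j ≤ 1) {N : ℤ} (hN : 0 < N) :
    HasAbelSum (fun n => boundaryTerm P f (1 / N) n * n ^ j)
      (ZMod.LFunction f (-j) + ((2 * P : ℕ) : ℂ)⁻¹ *
        (∑' n : ℕ, ZMod.dft f n *
          (2 * rotatedRemainder (Real.pi / (2 * P * N)) (freq (2 * P) n) j)
        + (-1) ^ (j + 1) * (eighthRoot * √(2 * P * N : ℝ) * (N ^ j *
          ∑ i ∈ s, (-I ^ (j + 1) * √(2 * P : ℝ) * W i) *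
            regularizedValue (2 * P) (boundaryTerm P (g i) (-N)) j)))) := by
  have hP : 0 < P := NeZero.pos P
  have hP' : (0 : ℝ) < P := by exact_mod_cast hP
  have hP2 : (P : ℂ) ≠ 0 := NeZero.ne _
  have hN' : (0 : ℝ) < N := by exact_mod_cast hN
  have hN2 : (N : ℂ) ≠ 0 := by exact_mod_cast hN.ne'
  have hpi := Real.pi_pos
  have hpi2 : (Real.pi : ℂ) ≠ 0 := by exact_mod_cast hpi.ne'
  have hT : 0 < 2 * P := NeZero.pos _
  have hα : 0 < Real.pi / (2 * P * N) := by positivity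
  have hL := hasAbelSum_regularizedValue hT (periodic_natCast_zmod f)
    (by rw [sum_range_natCast_zmod, h.sum_eq_zero]) hj
  rw [← LFunction_neg_eq_regularizedValue h.sum_eq_zero hj h.map_zero] at hL
  have hper : Function.Periodic (boundaryTerm P (ZMod.dft f) (-N)) (2 * P) := fun n => by
    rw [h.boundaryTerm_dft]
    exact Finset.sum_congr rfl fun i hi => by
      rw [(h.constantSquare i hi).boundaryTerm_periodic N n]
  have hzero : ∑ n ∈ Finset.range (2 * P), boundaryTerm P (ZMod.dft f) (-N) n = 0 := by
    rw [h.boundaryTerm_dft, Finset.sum_comm]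
    refine Finset.sum_eq_zero fun i hi => ?_
    rw [← Finset.mul_sum, (h.constantSquare i hi).sum_boundaryTerm (h.sum_eq_zero' i hi), mul_zero]
  have e1 : boundaryTerm P (ZMod.dft f) (-N) = fun n : ℕ => ZMod.dft f n *
      cexp (-I * freq (2 * P) n ^ 2 / (4 * (Real.pi / (2 * P * N) : ℝ))) := by
    funext n
    unfold boundaryTerm freq
    congr 2
    push_cast
    field_simp
  have hv : ∀ j, j ≤ 1 → HasAbelSum (fun n : ℕ => ZMod.dft f n *
      cexp (-I * freq (2 * P) n ^ 2 / (4 * (Real.pi / (2 * P * N) : ℝ))) * n ^ j)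
      (regularizedValue (2 * P) (boundaryTerm P (ZMod.dft f) (-N)) j) := fun j hj => by
    have := hasAbelSum_regularizedValue hT hper hzero hj
    rw [e1] at this ⊢
    exact this
  have hv0 := hv 0 zero_le_one
  simp only [pow_zero, mul_one] at hv0
  have key := hasAbelSum_mul_fresnel hα hj h.sum_eq_zero h.map_neg hL hv0 (hv j hj)
  rw [h.boundaryTerm_dft, regularizedValue_sum_mul] at key
  have e2 : Real.pi / (Real.pi / (2 * P * N)) = 2 * P * N := by field_simp
  have e3 : (freq (2 * P) 1 : ℂ) / (2 * (Real.pi / (2 * P * N) : ℝ)) = N := by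
    unfold freq
    push_cast
    field_simp
  have e4 : (fun n : ℕ => boundaryTerm P f (1 / N) n * n ^ j)
      = fun n : ℕ => f n * cexp (I * (Real.pi / (2 * P * N) : ℝ) * n ^ 2) * n ^ j := by
    funext n
    unfold boundaryTerm
    congr 3
    push_cast
    field_simp
    ring
  rw [e2, e3, ← e4] at key
  exact key

/-- The Gauss sums over a period vanish. For `N > 0` this follows from the mere existence of the Abel
sum in the reciprocity formula, for `N < 0` by complex conjugation, as `f` is real. -/
theorem sum_boundaryTerm_one_div (h : IsModularSystem P j f s W g) (hj : j ≤ 1) {N : ℤ}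
    (hN : N ≠ 0) :
    ∑ n ∈ Finset.range (2 * P * N.natAbs), boundaryTerm P f (1 / N) n = 0 := by
  have pos : ∀ {N : ℤ}, 0 < N →
      ∑ n ∈ Finset.range (2 * P * N.natAbs), boundaryTerm P f (1 / N) n = 0 := fun {N} hN =>
    sum_range_eq_zero_of_hasAbelSum (Nat.mul_pos (NeZero.pos _) (Int.natAbs_pos.mpr hN.ne'))
      (boundaryTerm_one_div_periodic (NeZero.pos P) f hN.ne') hj (h.hasAbelSum hj hN)
  rcases lt_or_gt_of_ne hN with hneg | hpos
  · have := congrArg (starRingEnd ℂ) (pos (Int.neg_pos.mpr hneg))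
    rw [map_sum, _root_.map_zero, Int.natAbs_neg] at this
    rw [← this]
    refine Finset.sum_congr rfl fun n _ => ?_
    unfold boundaryTerm
    rw [map_mul, h.real n, ← Complex.exp_conj]
    congr 2
    simp [Complex.conj_ofNat]
  · exact pos hpos

theorem hasLimitingValue_one_div (h : IsModularSystem P j f s W g) (hj : j ≤ 1) {N : ℤ}
    (hN : N ≠ 0) : HasLimitingValue (eichlerIntegral P f j) (1 / N)
      (regularizedValue (2 * P * N.natAbs) (boundaryTerm P f (1 / N)) j) :=
  hasLimitingValue_eichlerIntegral (NeZero.pos P)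
    (Nat.mul_pos (NeZero.pos _) (Int.natAbs_pos.mpr hN))
    (boundaryTerm_one_div_periodic (NeZero.pos P) f hN) (h.sum_boundaryTerm_one_div hj hN) hj

/-- The period function at `1 / N` is an explicit convergent series: the square root factor and the
powers of `I` in `IsModularSystem` are such that the boundary values at `-N` cancel. -/
theorem limitingValue_add_eq (h : IsModularSystem P j f s W g) (hj : j ≤ 1) {N : ℤ} (hN : 0 < N) :
    limitingValue (eichlerIntegral P f j) (1 / N) + (N / I) ^ (j + 1 / 2 : ℂ) *
      ∑ i ∈ s, W i * limitingValue (eichlerIntegral P (g i) j) (-N)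
    = ZMod.LFunction f (-j) + ((2 * P : ℕ) : ℂ)⁻¹ * ∑' n : ℕ, ZMod.dft f n *
          (2 * rotatedRemainder (Real.pi / (2 * P * N)) (freq (2 * P) n) j) := by
  have hN' : (0 : ℝ) < N := by exact_mod_cast hN
  have hP' : (0 : ℝ) ≤ 2 * P := by positivity
  have hP2 : (P : ℂ) ≠ 0 := NeZero.ne _
  have e0 : ∑ i ∈ s, W i * limitingValue (eichlerIntegral P (g i) j) (-N)
      = ∑ i ∈ s, W i * regularizedValue (2 * P) (boundaryTerm P (g i) (-N)) j :=
    Finset.sum_congr rfl fun i hi => by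
      rw [((h.constantSquare i hi).hasLimitingValue (h.sum_eq_zero' i hi) N hj).limitingValue_eq]
  rw [e0, (h.hasLimitingValue_one_div hj hN.ne').limitingValue_eq,
    (hasAbelSum_regularizedValue (Nat.mul_pos (NeZero.pos _) (Int.natAbs_pos.mpr hN.ne'))
      (boundaryTerm_one_div_periodic (NeZero.pos P) f hN.ne')
      (h.sum_boundaryTerm_one_div hj hN.ne') hj).unique (h.hasAbelSum hj hN)]
  have e := div_I_cpow j hN'
  rw [ofReal_intCast] at e
  simp only [mul_assoc (-I ^ (j + 1) * (√(2 * P : ℝ) : ℂ)), ← Finset.mul_sum]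
  set v := ∑ i ∈ s, W i * regularizedValue (2 * P) (boundaryTerm P (g i) (-N)) j
  have hsq : ((√(2 * P : ℝ) : ℝ) : ℂ) * (√(2 * P : ℝ) : ℝ) = 2 * P := by
    exact_mod_cast Real.mul_self_sqrt hP'
  rw [e, Real.sqrt_mul hP', ofReal_mul, neg_pow I]
  push_cast
  have h2 : (2 * P : ℂ)⁻¹ * (2 * P) = 1 := inv_mul_cancel₀ (by simpa using hP2)
  linear_combination (-(-1) ^ (j + 1) * I ^ (j + 1) * eighthRoot * (√(N : ℝ) : ℝ) * N ^ j * v) *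
    ((2 * P : ℂ)⁻¹ * hsq + h2)

/-- The asymptotic expansion of the period function of an Eichler integral. -/
theorem hasAsymptoticExpansion (h : IsModularSystem P j f s W g) (hj : j ≤ 1) :
    HasAsymptoticExpansion
      (fun N : ℤ => limitingValue (eichlerIntegral P f j) (1 / N) + (N / I) ^ (j + 1 / 2 : ℂ) *
        ∑ i ∈ s, W i * limitingValue (eichlerIntegral P (g i) j) (-N))
      (fun k => ZMod.LFunction f (-2 * k - j) / k.factorial *
        (Real.pi * I / (2 * P)) ^ k) := by
  set F : ℤ → ℂ := fun N : ℤ => limitingValue (eichlerIntegral P f j) (1 / N) +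
    (N / I) ^ (j + 1 / 2 : ℂ) * ∑ i ∈ s, W i * limitingValue (eichlerIntegral P (g i) j) (-N)
  set c : ℕ → ℂ := fun k => ZMod.LFunction f (-2 * k - j) / k.factorial *
        (Real.pi * I / (2 * P)) ^ k with hc
  have hP' : (0 : ℝ) < P := by exact_mod_cast NeZero.pos P
  have hpi := Real.pi_pos
  have succ : ∀ K : ℕ, (fun N : ℤ => F N - ∑ k ∈ Finset.range (K + 1), c k * ((N : ℂ)⁻¹) ^ k)
      =O[atTop] fun N : ℤ => ((N : ℝ)⁻¹) ^ (K + 1) := fun K => by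
    obtain ⟨B, hB⟩ := exists_norm_tsum_rotatedRemainder_sub_le h.sum_eq_zero h.map_neg K
    refine IsBigO.of_bound (B * (Real.pi / (2 * P)) ^ (K + 1)) ?_
    filter_upwards [eventually_gt_atTop 0] with N hN
    have hN' : (0 : ℝ) < N := by exact_mod_cast hN
    have hα : 0 < Real.pi / (2 * P * N) := by positivity
    have e : F N - ∑ k ∈ Finset.range (K + 1), c k * ((N : ℂ)⁻¹) ^ k
        = ((2 * P : ℕ) : ℂ)⁻¹ * ∑' n : ℕ, ZMod.dft f n *
          (2 * rotatedRemainder (Real.pi / (2 * P * N)) (freq (2 * P) n) j)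
          - ∑ k ∈ Finset.range K, ZMod.LFunction f (-(2 * (k + 1 : ℕ)) - j) / (k + 1).factorial *
            (I * (Real.pi / (2 * P * N) : ℝ)) ^ (k + 1) := by
      have e0 : F N = _ := h.limitingValue_add_eq hj hN
      rw [e0, Finset.sum_range_succ']
      have e1 : c 0 * ((N : ℂ)⁻¹) ^ 0 = ZMod.LFunction f (-j) := by simp [hc]
      have e2 : ∀ k, c (k + 1) * ((N : ℂ)⁻¹) ^ (k + 1)
          = ZMod.LFunction f (-(2 * (k + 1 : ℕ)) - j) / (k + 1).factorial *
            (I * (Real.pi / (2 * P * N) : ℝ)) ^ (k + 1) := fun k => by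
        simp only [hc]
        rw [mul_assoc, ← mul_pow, neg_mul]
        congr 2
        push_cast
        rw [← div_div]
        ring
      rw [e1, Finset.sum_congr rfl fun k _ => e2 k]
      ring
    rw [e, Real.norm_of_nonneg (by positivity), mul_assoc B, ← mul_pow]
    refine (hB _ hα).trans_eq ?_
    congr 2
    field_simp
  intro K
  cases K with
  | zero =>
    have h0 : (fun N : ℤ => ((N : ℝ)⁻¹) ^ (0 + 1)) =O[atTop] fun _ : ℤ => (1 : ℝ) := by
      refine IsBigO.of_bound 1 ?_
      filter_upwards [eventually_ge_atTop 1] with N hN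
      have hN' : (1 : ℝ) ≤ N := by exact_mod_cast hN
      have := inv_le_one_of_one_le₀ hN'
      simpa [abs_of_nonneg (by linarith : (0 : ℝ) ≤ N)] using this
    simpa using ((succ 0).trans h0).add
      (isBigO_const_const (c 0) (one_ne_zero (α := ℝ)) (atTop : Filter ℤ))
  | succ K => exact succ K

end IsModularSystem

/-! ### The functions `ψ` -/

theorem stdAddChar_neg_sub_stdAddChar {P : ℕ} [NeZero P] (m : ℤ) :
    ZMod.stdAddChar (-(m : ZMod (2 * P))) - ZMod.stdAddChar (m : ZMod (2 * P))
      = -2 * I * (Real.sin (m / P * Real.pi) : ℂ) := by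
  have hP : (P : ℂ) ≠ 0 := NeZero.ne _
  rw [← Int.cast_neg, ZMod.stdAddChar_coe, ZMod.stdAddChar_coe, ofReal_sin, Complex.sin]
  have e1 : 2 * Real.pi * I * (m : ℤ) / (2 * P : ℕ) = ((m / P * Real.pi : ℝ) : ℂ) * I := by
    push_cast; field_simp
  have e2 : 2 * Real.pi * I * (-m : ℤ) / (2 * P : ℕ) = -((m / P * Real.pi : ℝ) : ℂ) * I := by
    push_cast; field_simp
  rw [e1, e2]
  linear_combination (cexp (-((m / P * Real.pi : ℝ) : ℂ) * I)
    - cexp (((m / P * Real.pi : ℝ) : ℂ) * I)) * I_sq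

theorem natCast_eq_neg_natCast_iff {P a b : ℕ} (ha : 0 < a) (haP : a < P) (hbP : b ≤ P) :
    ¬ (a : ZMod (2 * P)) = -(b : ZMod (2 * P)) := by
  rw [eq_neg_iff_add_eq_zero, ← Nat.cast_add, ZMod.natCast_eq_zero_iff]
  intro h
  have := Nat.le_of_dvd (by omega) h
  omega

theorem natCast_inj_of_lt {P a b : ℕ} (haP : a < 2 * P) (hbP : b < 2 * P)
    (h : (a : ZMod (2 * P)) = b) : a = b := by
  have := congrArg ZMod.val h
  rwa [ZMod.val_natCast_of_lt haP, ZMod.val_natCast_of_lt hbP] at this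

section Psi

variable {P a : ℕ}

theorem psi_eq (ha : 0 < a) (haP : a < P) (x : ZMod (2 * P)) :
    psi P a x = (if x = a then 1 else 0) - (if x = -a then 1 else 0) := by
  unfold psi
  split_ifs with h1 h2
  · exact absurd (h1.symm.trans h2) (natCast_eq_neg_natCast_iff ha haP haP.le)
  all_goals simp

theorem psi_neg (ha : 0 < a) (haP : a < P) (x : ZMod (2 * P)) : psi P a (-x) = -psi P a x := by
  rw [psi_eq ha haP, psi_eq ha haP]
  simp only [neg_eq_iff_eq_neg, neg_neg, neg_sub]

theorem sum_psi [NeZero P] (ha : 0 < a) (haP : a < P) : ∑ x, psi P a x = 0 := by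
  simp [psi_eq ha haP]

theorem psi_eq_zero {b : ℕ} (hb : 0 < b) (hbP : b < P) (haP : a ≤ P) (hab : a ≠ b) :
    psi P b a = 0 := by
  unfold psi
  rw [if_neg fun h => hab (natCast_inj_of_lt (by omega) (by omega) h),
    if_neg fun h => natCast_eq_neg_natCast_iff hb hbP haP (by rw [h, neg_neg])]

theorem hasConstantSquare_psi (a : ℕ) : HasConstantSquare P (psi P a) := by
  refine ⟨a ^ 2, fun x hx => ?_⟩
  have h : (2 * P : ℤ) ∣ x - a ∨ (2 * P : ℤ) ∣ x + a := by
    unfold psi at hx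
    split_ifs at hx with h1 h2
    · left
      have := (ZMod.intCast_eq_intCast_iff_dvd_sub a x (2 * P)).mp (by simpa using h1.symm)
      simpa using this
    · right
      have := (ZMod.intCast_eq_intCast_iff_dvd_sub (-a) x (2 * P)).mp (by simpa using h2.symm)
      simpa using this
    · exact absurd rfl hx
  rcases h with ⟨k, hk⟩ | ⟨k, hk⟩
  · exact ⟨k * (a + P * k), by rw [eq_add_of_sub_eq hk]; ring⟩
  · exact ⟨k * (P * k - a), by rw [eq_sub_of_add_eq hk]; ring⟩

theorem dft_psi [NeZero P] (ha : 0 < a) (haP : a < P) (x : ZMod (2 * P)) :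
    ZMod.dft (psi P a) x = ZMod.stdAddChar (-((a : ZMod (2 * P)) * x)) -
      ZMod.stdAddChar ((a : ZMod (2 * P)) * x) := by
  rw [ZMod.dft_apply]
  simp [psi_eq ha haP, mul_sub, Finset.sum_sub_distrib]

theorem exists_eq_natCast_or_neg [NeZero P] (x : ZMod (2 * P)) :
    ∃ b : ℕ, b ≤ P ∧ (x = b ∨ x = -b) := by
  have hx : ((x.val : ℕ) : ZMod (2 * P)) = x := ZMod.natCast_zmod_val x
  have hlt := ZMod.val_lt x
  rcases le_total x.val P with h | h
  · exact ⟨x.val, h, Or.inl hx.symm⟩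
  · refine ⟨2 * P - x.val, by omega, Or.inr ?_⟩
    rw [Nat.cast_sub hlt.le, ZMod.natCast_self, hx]; simp

/-- The matrix `M` is the Fourier transform in the basis of the functions `ψ`. -/
theorem dft_psi_eq_sum [NeZero P] (ha : 0 < a) (haP : a < P) (x : ZMod (2 * P)) :
    ZMod.dft (psi P a) x = -I ^ (0 + 1) * √(2 * P : ℝ) *
      ∑ b ∈ Finset.Icc 1 (P - 1), (M P a b : ℂ) * psi P b x := by
  have hP : 0 < P := NeZero.pos P
  have hP' : (P : ℝ) ≠ 0 := NeZero.ne _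
  have key : ∀ b : ℕ, b ≤ P → ZMod.dft (psi P a) (b : ZMod (2 * P)) =
      -I ^ (0 + 1) * √(2 * P : ℝ) *
      ∑ c ∈ Finset.Icc 1 (P - 1), (M P a c : ℂ) * psi P c (b : ZMod (2 * P)) := fun b hb => by
    rw [dft_psi ha haP]
    have h := stdAddChar_neg_sub_stdAddChar (P := P) (a * b)
    push_cast at h
    rw [h]
    by_cases hb' : b ∈ Finset.Icc 1 (P - 1)
    · rw [Finset.sum_eq_single_of_mem b hb' fun c hc hcb => by
        rw [Finset.mem_Icc] at hc
        rw [psi_eq_zero (by omega) (by omega) hb hcb.symm, mul_zero]]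
      have hs : ((√(2 * P : ℝ) : ℝ) : ℂ) * (√(2 / P : ℝ) : ℝ) = 2 := by
        rw [← ofReal_mul, ← Real.sqrt_mul (by positivity),
          show (2 * P : ℝ) * (2 / P) = 2 ^ 2 by field_simp, Real.sqrt_sq zero_le_two]
        norm_num
      simp only [M, psi, if_true]
      push_cast
      linear_combination (I * Complex.sin (a * b / P * Real.pi)) * hs
    · rw [Finset.sum_eq_zero fun c hc => by
        rw [psi_eq_zero (by rw [Finset.mem_Icc] at hc; omega) (by rw [Finset.mem_Icc] at hc; omega)
          hb (by rintro rfl; exact hb' hc), mul_zero], mul_zero]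
      rw [Finset.mem_Icc] at hb'
      rcases (by omega : b = 0 ∨ b = P) with rfl | rfl
      · simp
      · rw [← Complex.ofReal_natCast, ← Complex.ofReal_natCast, ← ofReal_mul, ← ofReal_div,
          ← ofReal_mul, ← ofReal_sin, mul_div_cancel_right₀ _ hP', Real.sin_nat_mul_pi]
        simp
  obtain ⟨b, hb, rfl | rfl⟩ := exists_eq_natCast_or_neg x
  · exact key b hb
  · have h1 : ZMod.dft (psi P a) (-(b : ZMod (2 * P))) = -ZMod.dft (psi P a) b := by
      rw [dft_psi ha haP, dft_psi ha haP]; simp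
    rw [h1, key b hb, ← mul_neg, ← Finset.sum_neg_distrib]
    congr 1
    refine Finset.sum_congr rfl fun c hc => ?_
    rw [Finset.mem_Icc] at hc
    rw [psi_neg (by omega) (by omega), mul_neg]

theorem isModularSystem_psi [NeZero P] (ha : 0 < a) (haP : a < P) :
    IsModularSystem P 0 (psi P a) (Finset.Icc 1 (P - 1)) (fun b => (M P a b : ℂ)) (psi P) where
  sum_eq_zero := sum_psi ha haP
  map_neg x := by rw [psi_neg ha haP]; ring
  map_zero := by
    have := psi_eq_zero (a := 0) ha haP (Nat.zero_le _) ha.ne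
    rw [Nat.cast_zero] at this
    rw [this, zero_mul]
  real x := by unfold psi; split_ifs <;> simp
  dft_eq := dft_psi_eq_sum ha haP
  sum_eq_zero' b hb := by rw [Finset.mem_Icc] at hb; exact sum_psi (by omega) (by omega)
  constantSquare b _ := hasConstantSquare_psi b

theorem PsiTilde_eq (P a : ℕ) : PsiTilde P a = eichlerIntegral P (psi P a) 0 := by
  funext τ
  simp [PsiTilde, eichlerIntegral]

end Psi

/-! ### Arithmetic of the residue classes -/

section Residues

variable {p l l' : Fin 4 → ℕ}

theorem mul_cofactor (p : Fin 4 → ℕ) (j : Fin 4) : p j * (P p / p j) = P p :=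
  Nat.mul_div_cancel' (Finset.dvd_prod_of_mem p (Finset.mem_univ j))

theorem cofactor_eq_prod [∀ j, NeZero (p j)] (j : Fin 4) :
    P p / p j = ∏ k ∈ Finset.univ.erase j, p k := by
  rw [P, ← Finset.mul_prod_erase Finset.univ p (Finset.mem_univ j),
    Nat.mul_div_cancel_left _ (NeZero.pos (p j))]

theorem dvd_cofactor [∀ j, NeZero (p j)] {i j : Fin 4} (h : i ≠ j) : p i ∣ P p / p j := by
  rw [cofactor_eq_prod]
  exact Finset.dvd_prod_of_mem p (Finset.mem_erase.mpr ⟨h, Finset.mem_univ i⟩)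

theorem isCoprime_cofactor [∀ j, NeZero (p j)] (hp : ∀ i j, i ≠ j → (p i).Coprime (p j))
    (j : Fin 4) : IsCoprime (p j : ℤ) (P p / p j : ℕ) := by
  rw [Nat.isCoprime_iff_coprime, cofactor_eq_prod]
  exact Nat.Coprime.prod_right fun k hk => hp j k (Finset.ne_of_mem_erase hk).symm

theorem P_dvd_of_forall_dvd (hp : ∀ i j, i ≠ j → (p i).Coprime (p j)) {n : ℤ}
    (h : ∀ j, (p j : ℤ) ∣ n) : (P p : ℤ) ∣ n := by
  rw [P, Nat.cast_prod]
  exact Finset.prod_dvd_of_coprime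
    (fun i _ j _ hij => Nat.isCoprime_iff_coprime.mpr (hp i j hij)) fun j _ => h j

/-- Modulo `p i` only the `i`-th summand survives. -/
theorem dvd_sum_mul_cofactor_sub [∀ j, NeZero (p j)] (c : Fin 4 → ℤ) (i : Fin 4) :
    (p i : ℤ) ∣ ∑ j, c j * (P p / p j : ℕ) - c i * (P p / p i : ℕ) := by
  rw [← Finset.add_sum_erase Finset.univ _ (Finset.mem_univ i), add_sub_cancel_left]
  refine Finset.dvd_sum fun j hj => Dvd.dvd.mul_left ?_ _
  exact_mod_cast dvd_cofactor (Finset.ne_of_mem_erase hj).symm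

theorem dvd_P (p : Fin 4 → ℕ) (i : Fin 4) : (p i : ℤ) ∣ P p := by
  exact_mod_cast Finset.dvd_prod_of_mem p (Finset.mem_univ i)

theorem intCast_eq_iff_exists {n : ℕ} {a b : ℤ} :
    (a : ZMod (2 * n)) = b ↔ ∃ t : ℤ, b = a + 2 * n * t := by
  rw [ZMod.intCast_eq_intCast_iff_dvd_sub]
  constructor
  · rintro ⟨t, ht⟩
    exact ⟨t, by push_cast at ht; linarith⟩
  · rintro ⟨t, rfl⟩
    exact ⟨t, by push_cast; ring⟩

theorem exists_units_eq_one_sub (ε : Fin 4 → ℤˣ) :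
    ∃ d : Fin 4 → ℤ, ∀ j, (ε j : ℤ) = 1 - 2 * d j ∧ (d j = 0 ∨ d j = 1) := by
  have h : ∀ j, ∃ d : ℤ, (ε j : ℤ) = 1 - 2 * d ∧ (d = 0 ∨ d = 1) := fun j => by
    rcases Int.units_eq_one_or (ε j) with h | h
    · exact ⟨0, by simp [h], Or.inl rfl⟩
    · exact ⟨1, by simp [h], Or.inr rfl⟩
  exact ⟨fun j => (h j).choose, fun j => (h j).choose_spec⟩

theorem residue_neg (ε : Fin 4 → ℤˣ) : residue p l (-ε) = -residue p l ε := by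
  unfold residue
  rw [← Int.cast_neg, intCast_eq_iff_exists]
  refine ⟨-1, ?_⟩
  simp only [Pi.neg_apply, Units.val_neg, neg_mul, Finset.sum_neg_distrib]
  ring

/-- The square of an element of the classes attached to `l` is constant modulo `4P`. -/
theorem four_mul_P_dvd_sq_sub_sq [∀ j, NeZero (p j)] (hp : ∀ i j, i ≠ j → (p i).Coprime (p j))
    (ε : Fin 4 → ℤˣ) :
    (4 * P p : ℤ) ∣ (P p + ∑ j, (ε j : ℤ) * l j * (P p / p j : ℕ)) ^ 2
      - (P p + ∑ j, (l j : ℤ) * (P p / p j : ℕ)) ^ 2 := by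
  obtain ⟨d, hd⟩ := exists_units_eq_one_sub ε
  have h1 : ∑ j, (ε j : ℤ) * l j * (P p / p j : ℕ) = ∑ j, (l j : ℤ) * (P p / p j : ℕ)
      - 2 * ∑ j, d j * l j * (P p / p j : ℕ) := by
    rw [Finset.mul_sum, ← Finset.sum_sub_distrib]
    exact Finset.sum_congr rfl fun j _ => by rw [(hd j).1]; ring
  have h2 : ∑ j, (l j : ℤ) * (P p / p j : ℕ) = ∑ j, d j * l j * (P p / p j : ℕ)
      + ∑ j, (1 - d j) * l j * (P p / p j : ℕ) := by
    rw [← Finset.sum_add_distrib]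
    exact Finset.sum_congr rfl fun j _ => by ring
  have h3 : (P p : ℤ) ∣ (∑ j, d j * l j * (P p / p j : ℕ)) *
      (P p + ∑ j, (1 - d j) * l j * (P p / p j : ℕ)) := by
    refine P_dvd_of_forall_dvd hp fun i => ?_
    rcases (hd i).2 with h | h
    · refine Dvd.dvd.mul_right ?_ _
      simpa [h] using dvd_sum_mul_cofactor_sub (p := p) (fun j => d j * l j) i
    · refine Dvd.dvd.mul_left (dvd_add (dvd_P p i) ?_) _
      simpa [h] using dvd_sum_mul_cofactor_sub (p := p) (fun j => (1 - d j) * l j) i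
  obtain ⟨k, hk⟩ := h3
  refine ⟨-k, ?_⟩
  rw [h1, h2]
  linear_combination (-4) * hk

/-- An integer divisible by none of the `p j` lies in a class: the Chinese remainder theorem gives `l`
with `ε = 1` up to a multiple of `P`, and reflecting one coordinate corrects an odd multiple. -/
theorem exists_admissible_residue [∀ j, NeZero (p j)] (hp : ∀ i j, i ≠ j → (p i).Coprime (p j))
    {m : ℤ} (hm : ∀ j, ¬ (p j : ℤ) ∣ m) :
    ∃ l ε, Admissible p l ∧ (m : ZMod (2 * P p)) = residue p l ε := by
  have hp0 : ∀ j, (0 : ℤ) < p j := fun j => by exact_mod_cast NeZero.pos (p j)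
  have h1 : ∀ j, ∃ a : ℕ, 0 < a ∧ a < p j ∧ (p j : ℤ) ∣ a * (P p / p j : ℕ) - m := fun j => by
    obtain ⟨u, v, huv⟩ := isCoprime_cofactor hp j
    have e0 := Int.emod_nonneg (m * v) (hp0 j).ne'
    have e1 := Int.emod_lt_of_pos (m * v) (hp0 j)
    have e2 := Int.emod_add_mul_ediv (m * v) (p j)
    have hdvd : (p j : ℤ) ∣ (m * v % p j) * (P p / p j : ℕ) - m :=
      ⟨-(m * u) - (m * v / p j) * (P p / p j : ℕ), by
        linear_combination ((P p / p j : ℕ) : ℤ) * e2 + m * huv⟩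
    obtain ⟨a, ha⟩ := Int.eq_ofNat_of_zero_le e0
    rw [ha] at hdvd e1
    refine ⟨a, Nat.pos_of_ne_zero ?_, by exact_mod_cast e1, hdvd⟩
    rintro rfl
    exact hm j (by simpa using hdvd)
  choose a ha0 hap had using h1
  have h2 : (P p : ℤ) ∣ ∑ j, (a j : ℤ) * (P p / p j : ℕ) - m := P_dvd_of_forall_dvd hp fun i => by
    have := dvd_add (dvd_sum_mul_cofactor_sub (p := p) (fun j => (a j : ℤ)) i) (had i)
    simpa using this
  obtain ⟨t, ht⟩ := h2
  obtain ⟨s, hs | hs⟩ := Int.even_or_odd' t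
  · -- the parity is wrong: reflect the first coordinate
    refine ⟨Function.update a 0 (p 0 - a 0), Function.update 1 0 (-1), fun j => ?_, ?_⟩
    · rcases eq_or_ne j 0 with rfl | hj
      · have := ha0 0; have := hap 0
        rw [Function.update_self]; omega
      · rw [Function.update_of_ne hj]; exact ⟨ha0 j, hap j⟩
    · unfold residue
      rw [intCast_eq_iff_exists]
      refine ⟨s, ?_⟩
      have e : ∑ j, ((Function.update (1 : Fin 4 → ℤˣ) 0 (-1) j : ℤˣ) : ℤ) *
          (Function.update a 0 (p 0 - a 0) j : ℕ) * (P p / p j : ℕ)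
          = ∑ j, (a j : ℤ) * (P p / p j : ℕ) - P p := by
        rw [← Finset.add_sum_erase Finset.univ _ (Finset.mem_univ (0 : Fin 4)),
          ← Finset.add_sum_erase Finset.univ (fun j => (a j : ℤ) * (P p / p j : ℕ))
            (Finset.mem_univ (0 : Fin 4))]
        have e1 : ∑ j ∈ Finset.univ.erase (0 : Fin 4),
            ((Function.update (1 : Fin 4 → ℤˣ) 0 (-1) j : ℤˣ) : ℤ) *
            (Function.update a 0 (p 0 - a 0) j : ℕ) * (P p / p j : ℕ)
            = ∑ j ∈ Finset.univ.erase (0 : Fin 4), (a j : ℤ) * (P p / p j : ℕ) :=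
          Finset.sum_congr rfl fun j hj => by
            rw [Function.update_of_ne (Finset.ne_of_mem_erase hj),
              Function.update_of_ne (Finset.ne_of_mem_erase hj)]
            simp
        have e2 : (p 0 : ℤ) * (P p / p 0 : ℕ) = P p := by exact_mod_cast mul_cofactor p 0
        rw [e1, Function.update_self, Function.update_self, Nat.cast_sub (hap 0).le]
        simp only [Units.val_neg, Units.val_one]
        linear_combination (-1) * e2
      rw [e]
      rw [hs] at ht
      linear_combination ht
  · refine ⟨a, 1, fun j => ⟨ha0 j, hap j⟩, ?_⟩
    unfold residue
    rw [intCast_eq_iff_exists]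
    refine ⟨s + 1, ?_⟩
    simp only [Pi.one_apply, Units.val_one, one_mul]
    rw [hs] at ht
    linear_combination ht

theorem not_dvd_of_eq_residue [∀ j, NeZero (p j)] (hp : ∀ i j, i ≠ j → (p i).Coprime (p j))
    (hl : Admissible p l) {ε : Fin 4 → ℤˣ} {m : ℤ} (hm : (m : ZMod (2 * P p)) = residue p l ε)
    (i : Fin 4) : ¬ (p i : ℤ) ∣ m := by
  intro h
  unfold residue at hm
  obtain ⟨t, ht⟩ := intCast_eq_iff_exists.mp hm
  have h1 : (p i : ℤ) ∣ (ε i : ℤ) * l i * (P p / p i : ℕ) := by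
    have h2 := dvd_sum_mul_cofactor_sub (p := p) (fun j => (ε j : ℤ) * l j) i
    have h3 : (p i : ℤ) ∣ ∑ j, (ε j : ℤ) * l j * (P p / p j : ℕ) := by
      rw [show ∑ j, (ε j : ℤ) * l j * (P p / p j : ℕ) = m + P p * (2 * t - 1) by
        linear_combination ht]
      exact dvd_add h (Dvd.dvd.mul_right (dvd_P p i) _)
    exact (dvd_sub_right h3).mp h2
  have h4 := (isCoprime_cofactor hp i).dvd_of_dvd_mul_right h1
  rw [mul_comm, Units.dvd_mul_right] at h4
  have := Nat.le_of_dvd (hl i).1 (by exact_mod_cast h4)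
  exact absurd this (not_le.mpr (hl i).2)

theorem even_sum_iff_even_card {J : Finset (Fin 4)} {c : Fin 4 → ℤ} (hc : ∀ j ∈ J, Odd (c j)) :
    Even (∑ j ∈ J, c j) ↔ Even J.card := by
  have h2 := Finset.even_sum (s := J) (fun j => c j - 1) fun j hj => (hc j hj).sub_odd odd_one
  rw [Finset.sum_sub_distrib, Finset.sum_const, nsmul_eq_mul, mul_one, Int.even_sub] at h2
  rw [h2, Int.even_coe_nat]

/-- The classes attached to `l` only depend on the orbit of `l`. -/
theorem SameOrbit.exists_residue_eq (hl : Admissible p l) (h : SameOrbit p l l')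
    (ε : Fin 4 → ℤˣ) : ∃ ε', residue p l' ε' = residue p l ε := by
  obtain ⟨J, hJ, hl'⟩ := h
  refine ⟨fun j => if j ∈ J then -ε j else ε j, ?_⟩
  obtain ⟨t, ht⟩ : Even (∑ j ∈ J, (ε j : ℤ)) := (even_sum_iff_even_card fun j _ => by
    rcases Int.units_eq_one_or (ε j) with h | h <;> rw [h] <;> decide).mpr hJ
  unfold residue
  rw [intCast_eq_iff_exists]
  refine ⟨t, ?_⟩
  have e : ∀ j, ((if j ∈ J then -ε j else ε j : ℤˣ) : ℤ) * l' j * (P p / p j : ℕ)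
      = (ε j : ℤ) * l j * (P p / p j : ℕ) - P p * (if j ∈ J then (ε j : ℤ) else 0) := fun j => by
    rw [hl' j]
    split_ifs
    · have e2 : (p j : ℤ) * (P p / p j : ℕ) = P p := by exact_mod_cast mul_cofactor p j
      rw [Nat.cast_sub (hl j).2.le, Units.val_neg]
      linear_combination (-(ε j : ℤ)) * e2
    · ring
  rw [Finset.sum_congr rfl fun j _ => e j, Finset.sum_sub_distrib, ← Finset.mul_sum,
    Finset.sum_ite_mem, Finset.univ_inter, ht]
  ring

/-- Quadruples with a common class lie in the same orbit. -/
theorem sameOrbit_of_residue_eq [∀ j, NeZero (p j)] (hp : ∀ i j, i ≠ j → (p i).Coprime (p j))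
    (hl : Admissible p l) (hl' : Admissible p l') {ε ε' : Fin 4 → ℤˣ}
    (h : residue p l ε = residue p l' ε') : SameOrbit p l l' := by
  unfold residue at h
  obtain ⟨t, ht⟩ := intCast_eq_iff_exists.mp h
  have hsum : ∑ j, ((ε' j : ℤ) * l' j - (ε j : ℤ) * l j) * (P p / p j : ℕ) = P p * (2 * t) := by
    simp only [sub_mul, Finset.sum_sub_distrib]
    linear_combination ht
  have hdvd : ∀ j, (p j : ℤ) ∣ (ε' j : ℤ) * l' j - (ε j : ℤ) * l j := fun j => by
    have h1 := dvd_sum_mul_cofactor_sub (p := p)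
      (fun j => (ε' j : ℤ) * l' j - (ε j : ℤ) * l j) j
    rw [hsum] at h1
    exact (isCoprime_cofactor hp j).dvd_of_dvd_mul_right
      ((dvd_sub_right (Dvd.dvd.mul_right (dvd_P p j) _)).mp h1)
  choose c hc using hdvd
  have hc2 : ∑ j, c j = 2 * t := by
    have e : ∀ j, ((ε' j : ℤ) * l' j - (ε j : ℤ) * l j) * (P p / p j : ℕ) = P p * c j := fun j => by
      have e2 : (p j : ℤ) * (P p / p j : ℕ) = P p := by exact_mod_cast mul_cofactor p j
      rw [hc j]
      linear_combination c j * e2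
    rw [Finset.sum_congr rfl fun j _ => e j, ← Finset.mul_sum] at hsum
    refine mul_left_cancel₀ ?_ hsum
    exact_mod_cast Finset.prod_ne_zero_iff.mpr fun j _ => NeZero.ne (p j)
  have hcase : ∀ j, (c j = 0 ∧ l' j = l j) ∨ (Odd (c j) ∧ l' j = p j - l j) := fun j => by
    obtain ⟨h1, h2⟩ := hl j
    obtain ⟨h1', h2'⟩ := hl' j
    have hcj := hc j
    have hpj : (0 : ℤ) < p j := by omega
    have hlt : c j < 2 := by
      by_contra! hge
      have : (p j : ℤ) * 2 ≤ p j * c j := mul_le_mul_of_nonneg_left hge hpj.le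
      rcases Int.units_eq_one_or (ε j) with e | e <;> rcases Int.units_eq_one_or (ε' j) with e' | e'
        <;> rw [e, e'] at hcj <;> simp only [Units.val_neg, Units.val_one] at hcj <;> omega
    have hgt : -2 < c j := by
      by_contra! hge
      have : (p j : ℤ) * c j ≤ p j * (-2) := mul_le_mul_of_nonneg_left hge hpj.le
      rcases Int.units_eq_one_or (ε j) with e | e <;> rcases Int.units_eq_one_or (ε' j) with e' | e'
        <;> rw [e, e'] at hcj <;> simp only [Units.val_neg, Units.val_one] at hcj <;> omega
    rcases (by omega : c j = -1 ∨ c j = 0 ∨ c j = 1) with h0 | h0 | h0 <;> rw [h0] at hcj ⊢ <;>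
      rcases Int.units_eq_one_or (ε j) with e | e <;> rcases Int.units_eq_one_or (ε' j) with e' | e'
        <;> rw [e, e'] at hcj <;> simp only [Units.val_neg, Units.val_one] at hcj <;>
      first
        | (exfalso; omega)
        | (left; exact ⟨rfl, by omega⟩)
        | (right; exact ⟨by decide, by omega⟩)
  classical
  refine ⟨Finset.univ.filter fun j => Odd (c j), ?_, fun j => ?_⟩
  · have h1 : Even (∑ j, c j) := ⟨t, by rw [hc2]; ring⟩
    rw [← Finset.sum_filter_of_ne (p := fun j => Odd (c j)) fun j _ hj =>
      ((hcase j).resolve_left fun h => hj h.1).1] at h1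
    exact (even_sum_iff_even_card fun j hj => (Finset.mem_filter.mp hj).2).mp h1
  · rcases hcase j with ⟨h1, h2⟩ | ⟨h1, h2⟩
    · rw [h2, if_neg (by simp [h1])]
    · rw [h2, if_pos (by simpa using h1)]

end Residues

/-! ### The functions `χ` -/

section Chi

variable {p l l' : Fin 4 → ℕ}

theorem prod_neg_units (ε : Fin 4 → ℤˣ) : ∏ j, (((-ε) j : ℤˣ) : ℤ) = ∏ j, (ε j : ℤ) := by
  simp [Finset.prod_neg]

theorem chi_neg (x : ZMod (2 * P p)) : chi p l (-x) = chi p l x := by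
  unfold chi
  rw [← Equiv.sum_comp (Equiv.neg (Fin 4 → ℤˣ))]
  refine Finset.sum_congr rfl fun ε _ => ?_
  simp only [Equiv.neg_apply, residue_neg, prod_neg_units, neg_inj]

theorem conj_chi (x : ZMod (2 * P p)) : (starRingEnd ℂ) (chi p l x) = chi p l x := by
  unfold chi
  rw [map_sum]
  refine Finset.sum_congr rfl fun ε _ => ?_
  rw [apply_ite (starRingEnd ℂ), map_neg, map_intCast, map_zero]

/-- A sum over the values of `chi` as a sum over sign vectors. -/
theorem sum_chi_mul [∀ j, NeZero (p j)] (l : Fin 4 → ℕ) (F : ZMod (2 * P p) → ℂ) :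
    ∑ x, chi p l x * F x = -∑ ε : Fin 4 → ℤˣ, ((∏ j, (ε j : ℤ) : ℤ) : ℂ) * F (residue p l ε) := by
  unfold chi
  simp only [Finset.sum_mul, ite_mul, zero_mul]
  rw [Finset.sum_comm, ← Finset.sum_neg_distrib]
  exact Finset.sum_congr rfl fun ε _ => by simp

theorem sum_units_prod (F : Fin 4 → ℤˣ → ℂ) :
    ∑ ε : Fin 4 → ℤˣ, ((∏ j, (ε j : ℤ) : ℤ) : ℂ) * ∏ j, F j (ε j) = ∏ j, (F j 1 - F j (-1)) := by
  have h : ∀ j, F j 1 - F j (-1) = ∑ u : ℤˣ, ((u : ℤ) : ℂ) * F j u := fun j => by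
    have : (Finset.univ : Finset ℤˣ) = {1, -1} := rfl
    rw [this, Finset.sum_pair (by decide)]
    simp
    ring
  rw [Finset.prod_congr rfl fun j _ => h j, Finset.prod_univ_sum, Fintype.piFinset_univ]
  refine Finset.sum_congr rfl fun ε _ => ?_
  rw [Finset.prod_mul_distrib]
  push_cast
  rfl

theorem sum_chi [∀ j, NeZero (p j)] : ∑ x, chi p l x = 0 := by
  have h1 := sum_chi_mul (p := p) l fun _ => 1
  have h2 := sum_units_prod fun _ _ => 1
  simp only [mul_one, Finset.prod_const_one, sub_self] at h1 h2
  rw [h1, h2]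
  simp

theorem hasConstantSquare_chi [∀ j, NeZero (p j)] (hp : ∀ i j, i ≠ j → (p i).Coprime (p j))
    (l : Fin 4 → ℕ) : HasConstantSquare (P p) (chi p l) := by
  refine ⟨(P p + ∑ j, (l j : ℤ) * (P p / p j : ℕ)) ^ 2, fun x hx => ?_⟩
  obtain ⟨ε, hε⟩ : ∃ ε, (x : ZMod (2 * P p)) = residue p l ε := by
    by_contra! h
    exact hx (chi_eq_zero h)
  obtain ⟨t, ht⟩ := intCast_eq_iff_exists.mp hε
  obtain ⟨k, hk⟩ := four_mul_P_dvd_sq_sub_sq (l := l) hp ε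
  rw [ht] at hk
  refine ⟨k - x * t - P p * t ^ 2, ?_⟩
  linear_combination hk

theorem residue_eq_sum (p l : Fin 4 → ℕ) (ε : Fin 4 → ℤˣ) :
    residue p l ε = (P p : ZMod (2 * P p)) +
      ∑ j, ((ε j : ℤ) : ZMod (2 * P p)) * ((l j * (P p / p j) : ℕ) : ZMod (2 * P p)) := by
  unfold residue
  simp only [Int.cast_add, Int.cast_sum, Int.cast_mul, Int.cast_natCast, Nat.cast_mul, mul_assoc]

instance [∀ j, NeZero (p j)] : NeZero (P p) :=
  ⟨Finset.prod_ne_zero_iff.mpr fun j _ => NeZero.ne (p j)⟩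

/-- The Fourier transform of `χ` factors, because the sum runs over independent signs. -/
theorem dft_chi [∀ j, NeZero (p j)] (l : Fin 4 → ℕ) (m : ℤ) :
    ZMod.dft (chi p l) m = -16 * ZMod.stdAddChar (-((P p : ZMod (2 * P p)) * (m : ZMod (2 * P p)))) *
      ∏ j, (Real.sin ((l j * (P p / p j : ℕ) * m : ℤ) / P p * Real.pi) : ℂ) := by
  rw [ZMod.dft_apply]
  have h0 : ∑ x : ZMod (2 * P p), ZMod.stdAddChar (-(x * (m : ZMod (2 * P p)))) • chi p l x
      = ∑ x : ZMod (2 * P p), chi p l x * ZMod.stdAddChar (-(x * (m : ZMod (2 * P p)))) :=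
    Finset.sum_congr rfl fun x _ => by rw [smul_eq_mul, mul_comm]
  rw [h0, sum_chi_mul]
  have h1 : ∀ ε : Fin 4 → ℤˣ, ZMod.stdAddChar (-(residue p l ε * (m : ZMod (2 * P p))))
      = ZMod.stdAddChar (-((P p : ZMod (2 * P p)) * (m : ZMod (2 * P p)))) * ∏ j, ZMod.stdAddChar
        (-(((ε j : ℤ) : ZMod (2 * P p)) * ((l j * (P p / p j : ℕ) * m : ℤ) : ZMod (2 * P p)))) :=
    fun ε => by
      simp only [Fin.prod_univ_four, ← AddChar.map_add_eq_mul, residue_eq_sum, Fin.sum_univ_four]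
      simp only [Int.cast_mul, Int.cast_natCast, Nat.cast_mul]
      congr 1
      ring
  have h2 := sum_units_prod fun j u => ZMod.stdAddChar
        (-(((u : ℤ) : ZMod (2 * P p)) * ((l j * (P p / p j : ℕ) * m : ℤ) : ZMod (2 * P p))))
  simp only [Units.val_one, Units.val_neg, Int.cast_one, Int.cast_neg, one_mul, neg_one_mul, neg_neg,
    stdAddChar_neg_sub_stdAddChar, Finset.prod_mul_distrib, Finset.prod_const, Finset.card_univ,
    Fintype.card_fin] at h2
  simp only [h1, mul_left_comm _ (ZMod.stdAddChar (-((P p : ZMod (2 * P p)) * (m : ZMod (2 * P p))))),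
    ← Finset.mul_sum]
  rw [h2]
  have h3 : (I : ℂ) ^ 4 = 1 := I_pow_four
  linear_combination (-16 * ZMod.stdAddChar (-((P p : ZMod (2 * P p)) * (m : ZMod (2 * P p)))) *
      ∏ j, (Real.sin ((l j * (P p / p j : ℕ) * m : ℤ) / P p * Real.pi) : ℂ)) * h3

theorem neg_one_pow_eq_stdAddChar [∀ j, NeZero (p j)] (m : ℕ) :
    ZMod.stdAddChar (-((P p : ZMod (2 * P p)) * (m : ZMod (2 * P p)))) = (-1 : ℂ) ^ m := by
  have hP : (P p : ℂ) ≠ 0 := NeZero.ne _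
  have e : (-((P p : ZMod (2 * P p)) * (m : ZMod (2 * P p)))) = ((-(P p * m) : ℤ) : ZMod _) := by
    push_cast; ring
  rw [e, ZMod.stdAddChar_coe, ← Complex.exp_neg_pi_mul_I, ← Complex.exp_nat_mul]
  congr 1
  rw [Int.cast_neg, Int.cast_mul, Int.cast_natCast, Int.cast_natCast, Nat.cast_mul, Nat.cast_ofNat]
  field_simp

/-! ### The Fourier transform of `χ` in terms of the matrix `S` -/

theorem cofactor_mul_cofactor [∀ j, NeZero (p j)] {j k : Fin 4} (h : j ≠ k) :
    (P p / p j) * (P p / p k) = P p * (P p / (p j * p k)) := by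
  rw [← Nat.div_div_eq_div_mul]
  obtain ⟨r, hr⟩ := dvd_cofactor (p := p) h.symm
  have h2 := mul_cofactor p k
  rw [hr, Nat.mul_div_cancel_left _ (NeZero.pos (p k))]
  calc _ = p k * (P p / p k) * r := by ring
    _ = _ := by rw [h2]

/-- On the class of `ε` the argument of the `j`-th sine is `ε j` times the argument in the matrix `S`,
up to an integer multiple of `π` whose parity does not depend on `ε`. -/
theorem sin_mul_class [∀ j, NeZero (p j)] (l l' : Fin 4 → ℕ) (ε : Fin 4 → ℤˣ) (j : Fin 4) :
    Real.sin ((l j * (P p / p j : ℕ) * (P p + ∑ k, (ε k : ℤ) * l' k * (P p / p k : ℕ)) : ℤ) /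
        P p * Real.pi)
      = (-1) ^ (l j * (P p / p j) + ∑ k ∈ Finset.univ.erase j, l j * l' k * (P p / (p j * p k))) *
        ((ε j : ℤ) * Real.sin (P p * ((l j * l' j : ℝ) / (p j : ℝ) ^ 2) * Real.pi)) := by
  obtain ⟨d, hd⟩ := exists_units_eq_one_sub ε
  have hP : (P p : ℝ) ≠ 0 := NeZero.ne _
  have hpj : (p j : ℝ) ≠ 0 := NeZero.ne _
  set J : ℕ := l j * (P p / p j) + ∑ k ∈ Finset.univ.erase j, l j * l' k * (P p / (p j * p k))
    with hJ
  set t : ℤ := ∑ k ∈ Finset.univ.erase j, d k * l j * l' k * (P p / (p j * p k) : ℕ) with ht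
  have h1 : (l j * (P p / p j : ℕ) * (P p + ∑ k, (ε k : ℤ) * l' k * (P p / p k : ℕ)) : ℤ)
      = P p * (J - 2 * t) + (ε j : ℤ) * l j * l' j * ((P p / p j : ℕ) : ℤ) ^ 2 := by
    have h2 : ∀ k ∈ Finset.univ.erase j, (l j : ℤ) * (P p / p j : ℕ) *
        ((ε k : ℤ) * l' k * (P p / p k : ℕ))
        = P p * (l j * l' k * (P p / (p j * p k) : ℕ))
          - 2 * P p * (d k * l j * l' k * (P p / (p j * p k) : ℕ)) := fun k hk => by
      have h3 : ((P p / p j : ℕ) : ℤ) * (P p / p k : ℕ) = P p * (P p / (p j * p k) : ℕ) := by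
        exact_mod_cast cofactor_mul_cofactor (Finset.ne_of_mem_erase hk).symm
      rw [(hd k).1]
      linear_combination ((1 - 2 * d k) * l j * l' k) * h3
    rw [← Finset.add_sum_erase Finset.univ _ (Finset.mem_univ j), mul_add, mul_add, Finset.mul_sum,
      Finset.sum_congr rfl h2, Finset.sum_sub_distrib, ← Finset.mul_sum, ← Finset.mul_sum, ← ht, hJ]
    simp only [Nat.cast_add, Nat.cast_mul, Nat.cast_sum]
    ring
  have h4 : (p j : ℝ) * (P p / p j : ℕ) = P p := by exact_mod_cast mul_cofactor p j
  have h5 : ((l j * (P p / p j : ℕ) * (P p + ∑ k, (ε k : ℤ) * l' k * (P p / p k : ℕ)) : ℤ) : ℝ) /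
      P p * Real.pi = ((ε j : ℤ) * (P p * ((l j * l' j : ℝ) / (p j : ℝ) ^ 2) * Real.pi)
        + J * Real.pi) + (-t : ℤ) * (2 * Real.pi) := by
    rw [h1]
    simp only [Int.cast_add, Int.cast_mul, Int.cast_sub, Int.cast_natCast, Int.cast_pow,
      Int.cast_neg, Int.cast_ofNat]
    rw [← h4] at hP ⊢
    have hq := right_ne_zero_of_mul hP
    field_simp
    ring
  rw [h5, Real.sin_add_int_mul_two_pi, Real.sin_add_nat_mul_pi]
  congr 1
  rcases Int.units_eq_one_or (ε j) with h | h <;> rw [h] <;> simp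

theorem stdAddChar_P_mul_residue [∀ j, NeZero (p j)] (ε : Fin 4 → ℤˣ) :
    ZMod.stdAddChar (-((P p : ZMod (2 * P p)) * residue p l ε))
      = (-1 : ℂ) ^ (P p + ∑ j, l j * (P p / p j)) := by
  obtain ⟨d, hd⟩ := exists_units_eq_one_sub ε
  rw [← neg_one_pow_eq_stdAddChar (p := p)]
  congr 2
  unfold residue
  have e : ∀ n : ℤ, (P p : ZMod (2 * P p)) * (n : ZMod (2 * P p)) = ((P p * n : ℤ) : ZMod _) :=
    fun n => by simp only [Int.cast_mul, Int.cast_natCast]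
  rw [← Int.cast_natCast (P p + _), e, e, intCast_eq_iff_exists]
  refine ⟨∑ j, d j * l j * (P p / p j : ℕ), ?_⟩
  have h : ∑ j, (ε j : ℤ) * l j * (P p / p j : ℕ) = ∑ j, (l j : ℤ) * (P p / p j : ℕ)
      - 2 * ∑ j, d j * l j * (P p / p j : ℕ) := by
    rw [Finset.mul_sum, ← Finset.sum_sub_distrib]
    exact Finset.sum_congr rfl fun j _ => by rw [(hd j).1]; ring
  rw [h]
  simp only [Nat.cast_add, Nat.cast_sum, Nat.cast_mul]
  ring

/-- The Fourier transform of `χ^l` on the classes attached to `l'`. -/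
theorem dft_chi_residue [∀ j, NeZero (p j)] (hp : ∀ i j, i ≠ j → (p i).Coprime (p j))
    (hl' : Admissible p l') (ε : Fin 4 → ℤˣ) :
    ZMod.dft (chi p l) (residue p l' ε)
      = √(2 * P p : ℝ) * ((S p l l' : ℂ) * chi p l' (residue p l' ε)) := by
  have h1 := dft_chi (p := p) l (P p + ∑ k, (ε k : ℤ) * l' k * (P p / p k : ℕ))
  have h2 : (((P p + ∑ k, (ε k : ℤ) * l' k * (P p / p k : ℕ) : ℤ)) : ZMod (2 * P p))
    = residue p l' ε := rfl
  rw [h2, stdAddChar_P_mul_residue, Finset.prod_congr rfl fun j _ => by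
    rw [sin_mul_class l l' ε j]] at h1
  rw [h1, chi_residue hp hl']
  have hs : √(2 * P p : ℝ) ≠ 0 := by
    have : (0 : ℝ) < P p := by exact_mod_cast NeZero.pos (P p)
    positivity
  have e : P p + ∑ j, (l j + l' j) * (P p / p j) +
      ∑ j, ∑ k ∈ Finset.univ.erase j, l j * l' k * (P p / (p j * p k))
      = (P p + ∑ j, l' j * (P p / p j)) + ∑ j, (l j * (P p / p j) +
        ∑ k ∈ Finset.univ.erase j, l j * l' k * (P p / (p j * p k))) := by
    simp only [add_mul, Finset.sum_add_distrib]
    ring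
  unfold S
  rw [e, pow_add _ (P p + ∑ j, l' j * (P p / p j)), ← Finset.prod_pow_eq_pow_sum]
  simp only [ofReal_mul, ofReal_div, ofReal_prod, ofReal_pow, ofReal_neg, ofReal_one, ofReal_ofNat,
    Finset.prod_mul_distrib, Int.cast_prod, ofReal_intCast]
  have hs' : ((√(2 * P p : ℝ) : ℝ) : ℂ) * ((√(2 * P p : ℝ) : ℝ) : ℂ)⁻¹ = 1 :=
    mul_inv_cancel₀ (by exact_mod_cast hs)
  set A := ∏ j, ((-1 : ℂ) ^ (l j * (P p / p j) +
    ∑ k ∈ Finset.univ.erase j, l j * l' k * (P p / (p j * p k))))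
  set B := ∏ j, (Real.sin (P p * ((l j * l' j : ℝ) / (p j : ℝ) ^ 2) * Real.pi) : ℂ)
  set D := ∏ j, ((ε j : ℤ) : ℂ)
  set E := (-1 : ℂ) ^ (P p + ∑ j, l' j * (P p / p j))
  linear_combination (16 * E * A * B * D) * hs'

theorem dft_chi_eq_zero [∀ j, NeZero (p j)] {m : ℤ} {j : Fin 4} (h : (p j : ℤ) ∣ m) :
    ZMod.dft (chi p l) m = 0 := by
  rw [dft_chi, Finset.prod_eq_zero (Finset.mem_univ j), mul_zero]
  obtain ⟨c, rfl⟩ := h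
  have hP : (P p : ℝ) ≠ 0 := NeZero.ne _
  have h4 : (p j : ℤ) * (P p / p j : ℕ) = P p := by exact_mod_cast mul_cofactor p j
  have e : (l j * (P p / p j : ℕ) * (p j * c) : ℤ) = (l j * c) * P p := by
    linear_combination (l j * c) * h4
  rw [e, Int.cast_mul, Int.cast_natCast, mul_div_cancel_right₀ _ hP, Real.sin_int_mul_pi, ofReal_zero]

theorem sameOrbit_refl (p l : Fin 4 → ℕ) : SameOrbit p l l := ⟨∅, by simp, by simp⟩

/-- The matrix `S` is the Fourier transform in the basis of the functions `χ`. An integer divisible by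
some `p j` lies in no class and both sides vanish there; any other integer lies in a class of exactly
one of the representatives, so a single term of the sum survives. -/
theorem dft_chi_eq_sum [∀ j, NeZero (p j)] (hp : ∀ i j, i ≠ j → (p i).Coprime (p j))
    {R : Finset (Fin 4 → ℕ)} (hR : IsRepSystem p R) (x : ZMod (2 * P p)) :
    ZMod.dft (chi p l) x = -I ^ (1 + 1) * √(2 * P p : ℝ) *
      ∑ l' ∈ R, (S p l l' : ℂ) * chi p l' x := by
  obtain ⟨m, rfl⟩ := ZMod.intCast_surjective x
  rw [show (-I ^ (1 + 1) : ℂ) = 1 by rw [one_add_one_eq_two, I_sq, neg_neg], one_mul]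
  by_cases hm : ∃ j, (p j : ℤ) ∣ m
  · obtain ⟨j, hj⟩ := hm
    rw [dft_chi_eq_zero hj, Finset.sum_eq_zero, mul_zero]
    intro l' hl'
    rw [chi_eq_zero fun ε h => not_dvd_of_eq_residue hp (hR.1 l' hl') h j hj, mul_zero]
  · rw [not_exists] at hm
    obtain ⟨l₁, ε₁, hl₁, h₁⟩ := exists_admissible_residue hp hm
    obtain ⟨l₂, ⟨hl₂, h₁₂⟩, -⟩ := hR.2 l₁ hl₁
    obtain ⟨ε₂, h₂⟩ := h₁₂.exists_residue_eq hl₁ ε₁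
    rw [h₁, ← h₂, dft_chi_residue hp (hR.1 l₂ hl₂), Finset.sum_eq_single_of_mem l₂ hl₂]
    intro l₃ hl₃ hne
    rw [chi_eq_zero fun ε h => hne ((hR.2 l₂ (hR.1 l₂ hl₂)).unique
      ⟨hl₃, sameOrbit_of_residue_eq hp (hR.1 l₂ hl₂) (hR.1 l₃ hl₃) h⟩
      ⟨hl₂, sameOrbit_refl p l₂⟩), mul_zero]

theorem isModularSystem_chi [∀ j, NeZero (p j)] (hp : ∀ i j, i ≠ j → (p i).Coprime (p j))
    {R : Finset (Fin 4 → ℕ)} (hR : IsRepSystem p R) :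
    IsModularSystem (P p) 1 (chi p l) R (fun l' => (S p l l' : ℂ)) (chi p) where
  sum_eq_zero := sum_chi
  map_neg x := by rw [chi_neg]; ring
  map_zero := by simp
  real := conj_chi
  dft_eq := dft_chi_eq_sum hp hR
  sum_eq_zero' _ _ := sum_chi
  constantSquare l' _ := hasConstantSquare_chi hp l'

theorem PhiTilde_eq (p l : Fin 4 → ℕ) : PhiTilde p l = eichlerIntegral (P p) (chi p l) 1 := by
  funext τ
  simp only [PhiTilde, eichlerIntegral, pow_one]
  exact tsum_congr fun n => by ring

/-- Orbits of admissible quadruples have systems of representatives. Two quadruples lie in the same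
orbit if and only if they have the same set of classes. -/
theorem exists_isRepSystem {p : Fin 4 → ℕ} [∀ j, NeZero (p j)]
    (hp : ∀ i j, i ≠ j → (p i).Coprime (p j)) : ∃ R, IsRepSystem p R := by
  classical
  set A : Finset (Fin 4 → ℕ) := Fintype.piFinset fun j => Finset.Ioo 0 (p j)
  have hA : ∀ l, l ∈ A ↔ Admissible p l := fun l => by
    simp [A, Admissible]
  set K : (Fin 4 → ℕ) → Finset (ZMod (2 * P p)) := fun l => Finset.univ.image (residue p l)
  have hK : ∀ l l', Admissible p l → Admissible p l' → (K l = K l' ↔ SameOrbit p l l') := by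
    intro l l' hl hl'
    constructor
    · intro h
      have h1 : residue p l 1 ∈ K l' := by rw [← h]; exact Finset.mem_image_of_mem _ (Finset.mem_univ _)
      obtain ⟨ε, -, hε⟩ := Finset.mem_image.mp h1
      exact sameOrbit_of_residue_eq hp hl hl' hε.symm
    · intro h
      refine Finset.eq_of_subset_of_card_le (fun x hx => ?_) ?_
      · obtain ⟨ε, -, rfl⟩ := Finset.mem_image.mp hx
        obtain ⟨ε', hε'⟩ := h.exists_residue_eq hl ε
        exact Finset.mem_image.mpr ⟨ε', Finset.mem_univ _, hε'⟩
      · rw [Finset.card_image_of_injective _ (residue_injective hp hl),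
          Finset.card_image_of_injective _ (residue_injective hp hl')]
  obtain ⟨R, hRA, hinj, himg⟩ := Finset.exists_subset_injOn_image_eq_of_surjOn
    (A : Set (Fin 4 → ℕ)) (A.image K) (by rw [Finset.coe_image]; exact Set.surjOn_image K A)
  refine ⟨R, fun l hl => (hA l).mp (hRA hl), fun l hl => ?_⟩
  obtain ⟨m, hm, hml⟩ := Finset.mem_image.mp
    (himg ▸ Finset.mem_image_of_mem K ((hA l).mpr hl) : K l ∈ R.image K)
  refine ⟨m, ⟨hm, (hK l m hl ((hA m).mp (hRA hm))).mp hml.symm⟩, fun m' hm' => ?_⟩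
  exact hinj hm'.1 hm
    (((hK l m' hl ((hA m').mp (hRA hm'.1))).mpr hm'.2).symm.trans hml.symm)

end Chi

end SeifertEichler

theorem mainTheorem9 :
    (∀ (p : Fin 4 → ℕ) [∀ j, NeZero (p j)] (_hp : ∀ i j, i ≠ j → (p i).Coprime (p j)),
      (∀ l, SeifertEichler.Admissible p l → ∀ N : ℤ, N ≠ 0 →
        (∃ c, SeifertEichler.HasLimitingValue (SeifertEichler.PhiTilde p l) (1 / N) c) ∧
        (∃ c, SeifertEichler.HasLimitingValue (SeifertEichler.PhiTilde p l) (-N) c)) ∧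
      ∀ R : Finset (Fin 4 → ℕ), SeifertEichler.IsRepSystem p R →
        ∀ l, SeifertEichler.Admissible p l →
          SeifertEichler.HasAsymptoticExpansion
            (fun N : ℤ =>
              SeifertEichler.limitingValue (SeifertEichler.PhiTilde p l) (1 / N) +
                ((N : ℂ) / Complex.I) ^ (3 / 2 : ℂ) *
                  ∑ l' ∈ R, (SeifertEichler.S p l l' : ℂ) *
                    SeifertEichler.limitingValue (SeifertEichler.PhiTilde p l') (-N))
            (fun k : ℕ =>
              ZMod.LFunction (SeifertEichler.chi p l) (-2 * (k : ℂ) - 1) / (k.factorial : ℂ) *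
                (Real.pi * Complex.I / (2 * (SeifertEichler.P p : ℂ))) ^ k)) ∧
    (∀ (P : ℕ) [NeZero P] (a : ℕ), 0 < a → a < P →
      (∀ N : ℤ, N ≠ 0 →
        (∃ c, SeifertEichler.HasLimitingValue (SeifertEichler.PsiTilde P a) (1 / N) c) ∧
        (∃ c, SeifertEichler.HasLimitingValue (SeifertEichler.PsiTilde P a) (-N) c)) ∧
      SeifertEichler.HasAsymptoticExpansion
        (fun N : ℤ =>
          SeifertEichler.limitingValue (SeifertEichler.PsiTilde P a) (1 / N) +
            ((N : ℂ) / Complex.I) ^ (1 / 2 : ℂ) *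
              ∑ b ∈ Finset.Icc 1 (P - 1), (SeifertEichler.M P a b : ℂ) *
                SeifertEichler.limitingValue (SeifertEichler.PsiTilde P b) (-N))
        (fun k : ℕ =>
          ZMod.LFunction (SeifertEichler.psi P a) (-2 * (k : ℂ)) / (k.factorial : ℂ) *
            (Real.pi * Complex.I / (2 * (P : ℂ))) ^ k)) := by
  refine ⟨fun p _ hp => ⟨fun l _ N hN => ?_, fun R hR l _ => ?_⟩,
    fun P _ a ha haP => ⟨fun N hN => ?_, ?_⟩⟩
  · obtain ⟨R, hR⟩ := SeifertEichler.exists_isRepSystem hp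
    rw [SeifertEichler.PhiTilde_eq]
    exact ⟨⟨_, (SeifertEichler.isModularSystem_chi hp hR).hasLimitingValue_one_div le_rfl hN⟩,
      ⟨_, (SeifertEichler.hasConstantSquare_chi hp l).hasLimitingValue SeifertEichler.sum_chi N
        le_rfl⟩⟩
  · have h := (SeifertEichler.isModularSystem_chi (l := l) hp hR).hasAsymptoticExpansion le_rfl
    simp only [SeifertEichler.PhiTilde_eq]
    norm_num at h ⊢
    exact h
  · rw [SeifertEichler.PsiTilde_eq]
    exact ⟨⟨_, (SeifertEichler.isModularSystem_psi ha haP).hasLimitingValue_one_div zero_le_one hN⟩,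
      ⟨_, (SeifertEichler.hasConstantSquare_psi a).hasLimitingValue (SeifertEichler.sum_psi ha haP)
        N zero_le_one⟩⟩
  · have h := (SeifertEichler.isModularSystem_psi ha haP).hasAsymptoticExpansion zero_le_one
    simp only [SeifertEichler.PsiTilde_eq]
    simpa only [Nat.cast_zero, zero_add, sub_zero] using h
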